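/- Let $\mathcal M=(S,\mathbf P,\mathbf D,\alpha_0)$ be a semi-Markov process: $S$ is finite, $\mathbf P(s)$ is a probability distribution on $S$ for each $s\in S$, and each $\mathbf D(s,s')$ is a measurable density $f:\mathbb R\to[0,\infty)$ with $f=0$ on $(-\infty,0)$ and $\int_0^\infty f=1$, such that for some interval $I=[\ell,u]$ ($\ell<u$ natural numbers) or $I=[\ell,\infty)$ ($\ell$ a natural number) $f$ vanishes off $I$ and is bounded below by a positive constant on every $[c,d]\subseteq I$. Let $\mathcal A$ be a deterministic timed automaton with finite location set $Q$, alphabet $S$, finite clock set $\mathcal X$ and finitely many edges $(q,a,g,Y,q')$, where the guards $g$ are finite conjunctions of constraints $x\bowtie c$ with $\bowtie\in\{<,\le,>,\ge\}$, $c\in\mathbb N_0$, and for each location and letter the guards are deterministic and total. Let $B_{\max}$ be the largest constant in the guards ($0$ if there is none). The product process $\mathcal M\times\mathcal A$ has states $(s,q,\nu)\in S\times Q\times(\mathbb R_{\ge0})^{\mathcal X}$ and transition kernel $$P\big((s,q,\nu),B\big)=\sum_{s'\in S}\mathbf P(s)(s')\int_0^\infty \mathbf D(s,s')(t)\,\mathbf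 1_B(s',\bar q,\bar\nu+t)\,dt,$$ where $(\bar q,\bar\nu)$ is the configuration that $\mathcal A$ enters from $(q,\nu)$ on reading $s$ (with the clocks of the edge taken reset to $0$); it is started from some initial probability distribution $\mu$ on the states. A clock $x$ is relevant for $\nu$ if $\nu(x)\le B_{\max}$. Two states are region equivalent if they have the same $s$ and $q$, the same relevant clocks, on each relevant clock the values have the same integer part and are both integers or both non-integers, and the relevant clocks have the same ordering of fractional parts (ties included). The equivalence classes are the regions. The region graph $(V,E)$ has as vertices the regions that are reached with positive probability from $\mu$ at some time, and an edge $R\to R'$ iff $P(z,R')>0$ for some $z\in R$. Assume that $(V,E)$ is strongly connected, that there are no growing clocks (each clock is reset by the edge of $\mathcal A$ taken from some state of some region in $V$), and let $p$ be the period of $(V,E)$, i.e. the greatest common divisor of the lengths of its cycles. Let $V_0,\dots,V_{p-1}$ be a cyclic decomposition: disjoint sets with union $V$ such that every edge from $V_k$ leads to $V_{(k+1)\bmod p}$. Put $\Gamma^k=\bigcup_{R\in V_k}R$ and let $\Phi_k$ be the chain on $\Gamma^k$ whose transition kernel is the restriction of $P^p$. Let $p_{\min}$ be the smallest positive transition probability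 of $\mathcal M$, and let $c_\delta>0$ be such that for all $f=\mathbf D(s,s')$ ($s,s'\in S$), at every $t\in[0,B_{\max}]$ either $f(t)>c_\delta$ or $f(t)=0$, and $\int_{B_{\max}}^\infty f$ is either larger than $c_\delta$ or $0$. Let $r=\lfloor |V|^{4\ln|V|}\rfloor$. Then for every $k\in\{0,\dots,p-1\}$ there exist a region $R_k\in V_k$, a measurable set $S_k\subseteq R_k$, an integer $n_k\ge1$, a real $b_k>0$ and a probability measure $\kappa_k$ with $\kappa_k(S_k)=1$ such that $$P^{n_kp}(z,T)>b_k\,\kappa_k(T)\quad\text{for all } z\in\Gamma^k\text{ and all measurable }T\subseteq S_k\text{ with }\kappa_k(T)>0 .$$ Consequently $\Phi_k$ is $(n_k,b_k,\kappa_k)$-small, i.e. $\Phi_k^{n_k}(z,B)\ge b_k\,\kappa_k(B)$ for all $z\in\Gamma^k$ and all measurable $B\subseteq\Gamma^k$, where $\Phi_k^{n_k}$ is its $n_k$-step kernel. Moreover these can be chosen with $n_k\,p\le r$ (hence $n_k\le r$) and $b_k\ge\left(p_{\min}\,c_\delta/r\right)^r$. For $p=1$ this says that the whole state space $\bigcup_{R\in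 V}R$ is small. -/

import Mathlib

open MeasureTheory ProbabilityTheory
open scoped NNReal ENNReal

namespace SMPDTA

/-! ### Semi-Markov processes -/

/-- A delay density: a measurable `f : ℝ → ℝ≥0` with `f t = 0` for `t < 0` and `∫₀^∞ f = 1`, for
which there is an interval `I`, either `[l, u]` with naturals `l < u` or `[l, ∞)` with `l` natural,
such that `f` vanishes off `I` and is bounded away from zero on each `[c, d] ⊆ I`. -/
structure DelayDensity where
  toFun : ℝ → ℝ≥0
  measurable_toFun : Measurable toFun
  eq_zero_of_neg : ∀ t : ℝ, t < 0 → toFun t = 0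
  lintegral_eq_one : ∫⁻ t in Set.Ici (0 : ℝ), (toFun t : ℝ≥0∞) = 1
  exists_interval : ∃ I : Set ℝ,
    ((∃ l u : ℕ, l < u ∧ I = Set.Icc (l : ℝ) (u : ℝ)) ∨ (∃ l : ℕ, I = Set.Ici (l : ℝ))) ∧
    (∀ t : ℝ, t ∉ I → toFun t = 0) ∧
    (∀ c d : ℝ, Set.Icc c d ⊆ I → ∃ b : ℝ≥0, 0 < b ∧ ∀ t ∈ Set.Icc c d, b ≤ toFun t)

/-- The law of a delay with density `f`. -/
noncomputable def DelayDensity.law (f : DelayDensity) : Measure ℝ :=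
  (volume.restrict (Set.Ici (0 : ℝ))).withDensity fun t => (f.toFun t : ℝ≥0∞)

/-- A semi-Markov process with finite state set `S`. -/
structure SMP (S : Type*) where
  trans : S → PMF S
  delay : S → S → DelayDensity
  init : PMF S

/-- The smallest (positive) transition probability of a semi-Markov process. -/
noncomputable def SMP.pMin {S : Type*} (M : SMP S) : ℝ :=
  sInf {r : ℝ | ∃ s s' : S, M.trans s s' ≠ 0 ∧ r = (M.trans s s').toReal}

/-! ### Deterministic timed automata -/

/-- Valuations of the clocks in `X`. -/
abbrev Valuation (X : Type*) := X → ℝ≥0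

/-- The four comparison symbols. -/
inductive Cmp
  | lt
  | le
  | gt
  | ge

/-- `c.Holds a n` : the comparison `a c n` holds. -/
def Cmp.Holds : Cmp → ℝ≥0 → ℕ → Prop
  | .lt, a, n => a < n
  | .le, a, n => a ≤ n
  | .gt, a, n => (n : ℝ≥0) < a
  | .ge, a, n => (n : ℝ≥0) ≤ a

/-- A basic clock constraint `x ⋈ c`. -/
structure BasicConstraint (X : Type*) where
  clock : X
  cmp : Cmp
  bound : ℕ

/-- A guard: a finite conjunction of basic constraints. -/
abbrev Guard (X : Type*) := Finset (BasicConstraint X)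

/-- `v ⊨ g`. -/
def Guard.Sat {X : Type*} (g : Guard X) (v : Valuation X) : Prop :=
  ∀ b ∈ g, b.cmp.Holds (v b.clock) b.bound

/-- An edge `(q, a, g, Y, q')` of a timed automaton. -/
structure TAEdge (Q S X : Type*) where
  src : Q
  letter : S
  guard : Guard X
  reset : Set X
  tgt : Q

/-- A deterministic timed automaton with locations `Q`, alphabet `S`, clocks `X`. -/
structure DTA (Q S X : Type*) where
  edges : Finset (TAEdge Q S X)
  start : Q
  deterministic : ∀ e ∈ edges, ∀ e' ∈ edges, e.src = e'.src → e.letter = e'.letter →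
    (∃ v : Valuation X, e.guard.Sat v ∧ e'.guard.Sat v) →
    e.guard = e'.guard ∧ e.reset = e'.reset ∧ e.tgt = e'.tgt
  total : ∀ (q : Q) (a : S) (v : Valuation X),
    ∃ e ∈ edges, e.src = q ∧ e.letter = a ∧ e.guard.Sat v

/-- States `(s, q, v)` of the product of a semi-Markov process and a timed automaton. -/
abbrev State (S Q X : Type*) := S × Q × Valuation X

/-- `v[Y := 0]`. -/
noncomputable def resetClocks {X : Type*} (Y : Set X) (v : Valuation X) : Valuation X :=
  open Classical in fun x => if x ∈ Y then 0 else v x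

namespace DTA

variable {S Q X : Type*} (A : DTA Q S X)

/-- The (unique) edge taken from the configuration `(q, v)` on reading `s`, where `z = (s, q, v)`. -/
noncomputable def edgeAt (z : State S Q X) : TAEdge Q S X :=
  (A.total z.2.1 z.1 z.2.2).choose

/-- The configuration entered from `(q, v)` after reading `s`, where `z = (s, q, v)`. -/
noncomputable def config (z : State S Q X) : Q × Valuation X :=
  ((A.edgeAt z).tgt, resetClocks (A.edgeAt z).reset z.2.2)

/-- The maximal constant in the guards (`0` if there is none). -/
def maxConst : ℕ := A.edges.sup fun e => e.guard.sup fun b => b.bound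

lemma edgeAt_spec (z : State S Q X) :
    A.edgeAt z ∈ A.edges ∧ (A.edgeAt z).src = z.2.1 ∧ (A.edgeAt z).letter = z.1 ∧
      (A.edgeAt z).guard.Sat z.2.2 :=
  (A.total z.2.1 z.1 z.2.2).choose_spec

lemma config_eq {z : State S Q X} {e : TAEdge Q S X} (he : e ∈ A.edges) (h1 : e.src = z.2.1)
    (h2 : e.letter = z.1) (h3 : e.guard.Sat z.2.2) :
    A.config z = (e.tgt, resetClocks e.reset z.2.2) := by
  obtain ⟨g1, g2, g3, g4⟩ := A.edgeAt_spec z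
  obtain ⟨-, h5, h6⟩ := A.deterministic _ g1 e he (g2.trans h1.symm) (g3.trans h2.symm)
    ⟨z.2.2, g4, h3⟩
  simp only [config, h5, h6]

end DTA

section Measurability

variable {S Q X : Type*}

lemma measurable_resetClocks (Y : Set X) :
    Measurable (resetClocks Y : Valuation X → Valuation X) := by
  classical
  refine measurable_pi_lambda _ fun x => ?_
  by_cases h : x ∈ Y
  · simp [resetClocks, h]
  · simpa [resetClocks, h] using measurable_pi_apply x

lemma measurableSet_sat (g : Guard X) : MeasurableSet {v : Valuation X | g.Sat v} := by
  have : {v : Valuation X | g.Sat v} = ⋂ b ∈ g, {v | b.cmp.Holds (v b.clock) b.bound} := by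
    ext v; simp [Guard.Sat]
  rw [this]
  refine Finset.measurableSet_biInter _ fun b _ => ?_
  rcases b with ⟨x, c, n⟩
  cases c
  · exact measurableSet_lt (measurable_pi_apply x) measurable_const
  · exact measurableSet_le (measurable_pi_apply x) measurable_const
  · exact measurableSet_lt measurable_const (measurable_pi_apply x)
  · exact measurableSet_le measurable_const (measurable_pi_apply x)

variable [MeasurableSpace S] [DiscreteMeasurableSpace S]
  [MeasurableSpace Q] [DiscreteMeasurableSpace Q]

lemma DTA.measurable_config (A : DTA Q S X) : Measurable A.config := by
  intro T hT
  have : A.config ⁻¹' T = ⋃ e ∈ A.edges, ({z : State S Q X | z.1 = e.letter} ∩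
      {z | z.2.1 = e.src} ∩ {z | e.guard.Sat z.2.2} ∩
      {z | (e.tgt, resetClocks e.reset z.2.2) ∈ T}) := by
    ext z
    simp only [Set.mem_preimage, Set.mem_iUnion, Set.mem_inter_iff, Set.mem_ofPred_eq, exists_prop]
    constructor
    · intro h
      obtain ⟨g1, g2, g3, g4⟩ := A.edgeAt_spec z
      exact ⟨_, g1, ⟨⟨g3.symm, g2.symm⟩, g4⟩, h⟩
    · rintro ⟨e, he, ⟨⟨h1, h2⟩, h3⟩, h4⟩
      rwa [A.config_eq he h2.symm h1.symm h3]
  rw [this]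
  refine Finset.measurableSet_biUnion _ fun e _ => ?_
  have hv : Measurable fun z : State S Q X => z.2.2 := measurable_snd.comp measurable_snd
  refine (((?_ : MeasurableSet _).inter ?_).inter ?_).inter ?_
  · exact measurable_fst (MeasurableSet.of_discrete (s := {e.letter}))
  · exact (measurable_fst.comp measurable_snd) (MeasurableSet.of_discrete (s := {e.src}))
  · exact hv (measurableSet_sat e.guard)
  · exact (measurable_const.prodMk ((measurable_resetClocks e.reset).comp hv)) hT

end Measurability

/-! ### The product process -/

section Product

variable {S Q X : Type*}
  [MeasurableSpace S] [DiscreteMeasurableSpace S]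
  [MeasurableSpace Q] [DiscreteMeasurableSpace Q]

/-- The state `(s', q', v' + t)` reached from `z` when the next state of the semi-Markov process is
`s'` and the transition takes time `t ≥ 0`; here `(q', v')` is the configuration `A.config z`. -/
noncomputable def advance (A : DTA Q S X) (s' : S) (z : State S Q X) (t : ℝ) : State S Q X :=
  (s', (A.config z).1, fun x => (A.config z).2 x + t.toNNReal)

lemma measurable_advance (A : DTA Q S X) (s' : S) :
    Measurable fun y : State S Q X × ℝ => advance A s' y.1 y.2 := by
  have hc : Measurable fun y : State S Q X × ℝ => A.config y.1 :=
    A.measurable_config.comp measurable_fst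
  refine measurable_const.prodMk (hc.fst.prodMk (measurable_pi_lambda _ fun x => ?_))
  exact ((measurable_pi_apply x).comp hc.snd).add (measurable_real_toNNReal.comp measurable_snd)

instance (f : DelayDensity) : IsProbabilityMeasure f.law :=
  ⟨by rw [DelayDensity.law, withDensity_apply _ MeasurableSet.univ, Measure.restrict_univ,
    f.lintegral_eq_one]⟩

/-- The one-step transition kernel of the product process:
`P(z, B) = ∑_{s'} P(s)(s') · ∫₀^∞ f_{s,s'}(t) 1_B(s', q', v' + t) dt` for `z = (s, q, v)`. -/
noncomputable def productKernel [Fintype S] (M : SMP S) (A : DTA Q S X) :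
    Kernel (State S Q X) (State S Q X) where
  toFun z := ∑ s' : S, M.trans z.1 s' • (M.delay z.1 s').law.map (advance A s' z)
  measurable' := by
    refine Measure.measurable_of_measurable_coe _ fun B hB => ?_
    simp only [Measure.coe_finsetSum, Finset.sum_apply, Measure.smul_apply, smul_eq_mul]
    refine Finset.measurable_sum _ fun s' _ => Measurable.mul ?_ ?_
    · exact (Measurable.of_discrete (f := fun s => M.trans s s')).comp measurable_fst
    · let κ : Kernel S ℝ := ⟨fun s => (M.delay s s').law, Measurable.of_discrete⟩
      have : IsMarkovKernel κ := ⟨fun s => inferInstanceAs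
        (IsProbabilityMeasure (M.delay s s').law)⟩
      let η : Kernel (State S Q X) (State S Q X) :=
        (Kernel.id ×ₖ (κ.comap Prod.fst measurable_fst)).map fun y => advance A s' y.1 y.2
      have hη : ∀ z, η z = (M.delay z.1 s').law.map (advance A s' z) := by
        intro z
        rw [Kernel.map_apply _ (measurable_advance A s'), Kernel.prod_apply, Kernel.id_apply,
          Kernel.comap_apply, Measure.dirac_prod,
          Measure.map_map (measurable_advance A s') measurable_prodMk_left]
        rfl
      simp only [← hη]
      exact η.measurable_coe hB

instance [Fintype S] (M : SMP S) (A : DTA Q S X) : IsMarkovKernel (productKernel M A) := by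
  refine ⟨fun z => ⟨?_⟩⟩
  have hm : ∀ s', Measurable (advance A s' z) := fun s' =>
    (measurable_advance A s').comp measurable_prodMk_left
  have h : ∀ s', (M.delay z.1 s').law.map (advance A s' z) Set.univ = 1 := fun s' => by
    rw [Measure.map_apply (hm s') MeasurableSet.univ, Set.preimage_univ, measure_univ]
  change (∑ s' : S, M.trans z.1 s' • (M.delay z.1 s').law.map (advance A s' z)) Set.univ = 1
  simp only [Measure.coe_finsetSum, Finset.sum_apply, Measure.smul_apply, smul_eq_mul, h, mul_one]
  rw [← tsum_fintype (L := .unconditional S), (M.trans z.1).tsum_coe]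

end Product

/-! ### Regions and the region graph -/

section Regions

variable {S Q X : Type*}

/-- Two reals agree on integral part. -/
def AgreeInt (a b : ℝ) : Prop :=
  ⌊a⌋ = ⌊b⌋ ∧ (Int.fract a = 0 ↔ Int.fract b = 0)

/-- The clock `x` is relevant for `v`. -/
def DTA.Relevant (A : DTA Q S X) (v : Valuation X) (x : X) : Prop := v x ≤ A.maxConst

/-- The region relation. (Agreement of the sets of relevant clocks is spelled out.) -/
def DTA.RegionRel (A : DTA Q S X) (z z' : State S Q X) : Prop :=
  z.1 = z'.1 ∧ z.2.1 = z'.2.1 ∧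
  (∀ x, A.Relevant z.2.2 x ↔ A.Relevant z'.2.2 x) ∧
  (∀ x, A.Relevant z.2.2 x → AgreeInt (z.2.2 x) (z'.2.2 x)) ∧
  (∀ x y, A.Relevant z.2.2 x → A.Relevant z.2.2 y →
    (Int.fract (z.2.2 x : ℝ) ≤ Int.fract (z.2.2 y : ℝ) ↔
      Int.fract (z'.2.2 x : ℝ) ≤ Int.fract (z'.2.2 y : ℝ)))

/-- The region relation is an equivalence. -/
def DTA.regionSetoid (A : DTA Q S X) : Setoid (State S Q X) where
  r := A.RegionRel
  iseqv :=
    { refl := fun z => ⟨rfl, rfl, fun _ => Iff.rfl, fun _ _ => ⟨rfl, Iff.rfl⟩,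
        fun _ _ _ _ => Iff.rfl⟩
      symm := fun {z z'} h => by
        obtain ⟨h1, h2, h3, h4, h5⟩ := h
        refine ⟨h1.symm, h2.symm, fun x => (h3 x).symm, fun x hx => ?_, fun x y hx hy => ?_⟩
        · have := h4 x ((h3 x).2 hx)
          exact ⟨this.1.symm, this.2.symm⟩
        · exact (h5 x y ((h3 x).2 hx) ((h3 y).2 hy)).symm
      trans := fun {z z' z''} h g => by
        obtain ⟨h1, h2, h3, h4, h5⟩ := h
        obtain ⟨g1, g2, g3, g4, g5⟩ := g
        refine ⟨h1.trans g1, h2.trans g2, fun x => (h3 x).trans (g3 x), fun x hx => ?_,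
          fun x y hx hy => ?_⟩
        · have a := h4 x hx
          have b := g4 x ((h3 x).1 hx)
          exact ⟨a.1.trans b.1, a.2.trans b.2⟩
        · exact (h5 x y hx hy).trans (g5 x y ((h3 x).1 hx) ((h3 y).1 hy)) }

/-- Regions: the equivalence classes of the region relation. -/
abbrev DTA.Region (A : DTA Q S X) := Quotient A.regionSetoid

/-- The union of the regions in `W`, as a set of states. -/
def DTA.stateSpace (A : DTA Q S X) (W : Set A.Region) : Set (State S Q X) :=
  {z | Quotient.mk A.regionSetoid z ∈ W}

/-- There are only finitely many regions. -/
instance DTA.finite_region [Finite S] [Finite Q] [Finite X] (A : DTA Q S X) :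
    Finite A.Region := by
  classical
  let B := A.maxConst
  let F : State S Q X → S × Q × (X → Prop) × (X → Fin (B + 1)) × (X → Prop) × (X → X → Prop) :=
    fun z => (z.1, z.2.1, fun x => A.Relevant z.2.2 x,
      fun x => ⟨min ⌊(z.2.2 x : ℝ)⌋₊ B, by omega⟩, fun x => Int.fract (z.2.2 x : ℝ) = 0,
      fun x y => Int.fract (z.2.2 x : ℝ) ≤ Int.fract (z.2.2 y : ℝ))
  have hF : ∀ z z', F z = F z' → A.RegionRel z z' := by
    intro z z' h
    simp only [F, Prod.mk.injEq, funext_iff, Fin.mk.injEq, eq_iff_iff] at h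
    obtain ⟨h1, h2, h3, h4, h5, h6⟩ := h
    refine ⟨h1, h2, h3, fun x hx => ⟨?_, h5 x⟩, fun x y _ _ => h6 x y⟩
    have cast : ∀ a : ℝ≥0, a ≤ (B : ℝ≥0) → (a : ℝ) ≤ (B : ℝ) := fun a h => by exact_mod_cast h
    have e1 : ⌊(z.2.2 x : ℝ)⌋₊ ≤ B := Nat.floor_le_of_le (cast _ hx)
    have e2 : ⌊(z'.2.2 x : ℝ)⌋₊ ≤ B := Nat.floor_le_of_le (cast _ ((h3 x).1 hx))
    have e3 : ⌊(z.2.2 x : ℝ)⌋₊ = ⌊(z'.2.2 x : ℝ)⌋₊ := by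
      have := h4 x
      rwa [min_eq_left e1, min_eq_left e2] at this
    rw [← Int.natCast_floor_eq_floor (NNReal.coe_nonneg _),
      ← Int.natCast_floor_eq_floor (NNReal.coe_nonneg _), e3]
  exact Finite.of_injective (fun R : A.Region => F (Quotient.out R)) fun R R' h => by
    rw [← Quotient.out_eq R, ← Quotient.out_eq R']
    exact Quotient.sound (hF _ _ h)

variable [MeasurableSpace S] [DiscreteMeasurableSpace S]
  [MeasurableSpace Q] [DiscreteMeasurableSpace Q]

lemma DTA.measurableSet_stateSpace [Finite S] [Finite Q] [Finite X] (A : DTA Q S X)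
    (W : Set A.Region) : MeasurableSet (A.stateSpace W) := by
  have : A.stateSpace W = ⋃ R ∈ W, {z | A.RegionRel (Quotient.out R) z} := by
    ext z
    simp only [stateSpace, Set.mem_ofPred_eq, Set.mem_iUnion, exists_prop]
    constructor
    · intro h
      exact ⟨_, h, Quotient.exact (Quotient.out_eq (Quotient.mk A.regionSetoid z))⟩
    · rintro ⟨R, hR, h⟩
      have : Quotient.mk A.regionSetoid z = R := by
        rw [← Quotient.out_eq R]; exact (Quotient.sound h).symm
      rwa [this]
  rw [this]
  refine (Set.toFinite W).measurableSet_biUnion fun R _ => ?_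
  generalize Quotient.out R = z₀
  have hv : ∀ x, Measurable fun z : State S Q X => z.2.2 x := fun x =>
    (measurable_pi_apply x).comp (measurable_snd.comp measurable_snd)
  have hr : ∀ x, Measurable fun z : State S Q X => (z.2.2 x : ℝ) := fun x =>
    measurable_coe_nnreal_real.comp (hv x)
  refine measurableSet_setOfPred.2 (Measurable.and ?_ (Measurable.and ?_ (Measurable.and ?_
    (Measurable.and ?_ ?_))))
  · exact (Measurable.of_discrete (f := fun s => z₀.1 = s)).comp measurable_fst
  · exact (Measurable.of_discrete (f := fun q => z₀.2.1 = q)).comp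
      (measurable_fst.comp measurable_snd)
  · exact Measurable.forall fun x => measurable_const.iff
      (measurableSet_setOfPred.1 (measurableSet_le (hv x) measurable_const))
  · exact Measurable.forall fun x => measurable_const.imp (Measurable.and
      (measurableSet_setOfPred.1
        (measurableSet_eq_fun measurable_const (Int.measurable_floor.comp (hr x))))
      (measurable_const.iff (measurableSet_setOfPred.1
        (measurableSet_eq_fun (measurable_fract.comp (hr x)) measurable_const))))
  · exact Measurable.forall fun x => Measurable.forall fun y => measurable_const.imp
      (measurable_const.imp (measurable_const.iff (measurableSet_setOfPred.1
        (measurableSet_le (measurable_fract.comp (hr x)) (measurable_fract.comp (hr y))))))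

variable [Fintype S]

/-- The vertices of the region graph of the product process started from the distribution `μ`:
the regions reachable with positive probability. -/
def vertices (M : SMP S) (A : DTA Q S X) (μ : Measure (State S Q X)) : Set A.Region :=
  {R | ∃ n : ℕ, 0 < μ.bind (productKernel M A ^ n) (A.stateSpace {R})}

/-- The edge relation of the region graph of the product process started from `μ`. -/
def regionEdge (M : SMP S) (A : DTA Q S X) (μ : Measure (State S Q X)) (R R' : A.Region) : Prop :=
  R ∈ vertices M A μ ∧ R' ∈ vertices M A μ ∧
    ∃ z ∈ A.stateSpace {R}, 0 < productKernel M A z (A.stateSpace {R'})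

/-- No growing clocks: each clock is reset in some region of the region graph, that is, by the
transition of the automaton taken from some state of some region of the graph. -/
def NoGrowingClocks (M : SMP S) (A : DTA Q S X) (μ : Measure (State S Q X)) : Prop :=
  ∀ x : X, ∃ z ∈ A.stateSpace (vertices M A μ), x ∈ (A.edgeAt z).reset

end Regions

/-! ### Strong connectedness, period, cyclic classes -/

section Graphs

variable {α : Type*}

/-- The graph `(V, E)` is strongly connected. -/
def StronglyConnected (V : Set α) (E : α → α → Prop) : Prop :=
  ∀ u ∈ V, ∀ v ∈ V, Relation.ReflTransGen E u v

/-- `n` is the length of a cycle (closed walk with at least one edge) of the graph `E`. -/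
def IsCycleLength (E : α → α → Prop) (n : ℕ) : Prop :=
  0 < n ∧ ∃ w : ℕ → α, w n = w 0 ∧ ∀ i < n, E (w i) (w (i + 1))

/-- `p` is the period of the graph `E`: the greatest common divisor of the lengths of all cycles. -/
def IsPeriod (E : α → α → Prop) (p : ℕ) : Prop :=
  (∀ n, IsCycleLength E n → p ∣ n) ∧ ∀ d, (∀ n, IsCycleLength E n → d ∣ n) → d ∣ p

/-- `W 0, …, W (p - 1)` are cyclic classes of the graph `(V, E)`: they are pairwise disjoint,
have union `V`, and every edge that starts in `W i` ends in `W ((i + 1) mod p)`. -/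
structure IsCyclicDecomposition (V : Set α) (E : α → α → Prop) (p : ℕ) (W : Fin p → Set α) :
    Prop where
  disjoint : ∀ i j, i ≠ j → Disjoint (W i) (W j)
  union : ⋃ i, W i = V
  edge : ∀ i j : Fin p, (j : ℕ) = (i + 1) % p → ∀ u ∈ W i, ∀ v, E u v → v ∈ W j

end Graphs

/-! ### Small chains -/

section Small

variable {Γ : Type*} [MeasurableSpace Γ]

/-- The set `C` is `(m, ε, ν)`-small for the kernel `P`. -/
def IsSmall (P : Kernel Γ Γ) (C : Set Γ) (m : ℕ) (ε : ℝ) (ν : Measure Γ) : Prop :=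
  0 < m ∧ 0 < ε ∧ IsProbabilityMeasure ν ∧ MeasurableSet C ∧
    ∀ z ∈ C, ∀ B, MeasurableSet B → ENNReal.ofReal ε * ν B ≤ (P ^ m) z B

/-- The restriction of the kernel `P` to a measurable set `C` of states. -/
noncomputable def restrictKernel (P : Kernel Γ Γ) (C : Set Γ) (hC : MeasurableSet C) :
    Kernel C C :=
  (P.comap Subtype.val measurable_subtype_coe).comapRight (MeasurableEmbedding.subtype_coe hC)

end Small

section Chains

variable {S Q X : Type*} [Fintype S] [Finite Q] [Finite X]
  [MeasurableSpace S] [DiscreteMeasurableSpace S]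
  [MeasurableSpace Q] [DiscreteMeasurableSpace Q]

/-- The transition kernel of the chain that makes `p` steps of the product process at once, on the
union of the regions in `W`. -/
noncomputable def cyclicKernel (M : SMP S) (A : DTA Q S X) (p : ℕ) (W : Set A.Region) :
    Kernel (A.stateSpace W) (A.stateSpace W) :=
  restrictKernel (productKernel M A ^ p) (A.stateSpace W) (A.measurableSet_stateSpace W)

end Chains

/-- `c > 0` is a uniform bound on the delay densities of `M`: each of them is, at each point of
`[0, B]`, either `0` or larger than `c`, and its integral over `[B, ∞)` is either `0` or larger
than `c`. Here `B` is the maximal constant in the guards of `A`. -/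
def IsDelayBound {S Q X : Type*} (M : SMP S) (A : DTA Q S X) (c : ℝ) : Prop :=
  0 < c ∧ ∀ s s' : S,
    (∀ t ∈ Set.Icc (0 : ℝ) A.maxConst,
      (M.delay s s').toFun t = 0 ∨ c < ((M.delay s s').toFun t : ℝ)) ∧
    ((M.delay s s').law (Set.Ici (A.maxConst : ℝ)) = 0 ∨
      ENNReal.ofReal c < (M.delay s s').law (Set.Ici (A.maxConst : ℝ)))

/-- `⌊N ^ (4 ln N)⌋`. -/
noncomputable def rBound (N : ℕ) : ℕ := ⌊(N : ℝ) ^ (4 * Real.log N)⌋₊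

end SMPDTA

/-! The minorizing measure comes from a coupling. States of a class are given the same next letters
and the same delays. If they follow the same regions and every clock gets reset meanwhile, they end
in the same state, and the law of the shared moves is a common part of all their laws
(`Couples.step`, `exists_minorizing`). The obstacle is that fractional parts may lie arbitrarily
close to each other or to integers, so the window of delays that leads to a given region may be
arbitrarily short.

Gaps: if the fractional parts of the relevant clocks are `δ`-separated, each edge of the region
graph can be taken with any delay from a window of length `δ / 3`, and the new state has gaps `δ /
3` (`exists_window`). Hence walks of bounded length have probability bounded below.

Descents: gaps are created from nothing by delays `l + 1 - σ` with `η < σ < 2 * η`, where `l` is the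
left end of the support of a delay density. They lower the fractional part of each relevant clock
that is not reset by `σ`, and put clocks that are reset at `1 - σ`. Clocks reset at different times
are therefore `η` apart. A clock that is never reset gains an integral part at each descent, with at
most one exception, so it keeps visiting new regions and is irrelevant after more than `|V|`
descents (`DescentInv.step`, `DescentInv.not_relevant`). If all relevant fractional parts are large
at the start, no clock misses its integer, and all states of a region descend through the same
regions (`couples_of_descent`).

For `N = |V| ≥ 3` a path consists of `N + 1` descents, a walk of common length to one region
(`NiceGraph.exists_uniform_walk`), another `N + 1` descents shared by all states with gaps in that
region, after which they agree on relevant clocks, and a tour of all regions that resets every clock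
(`couples_of_tour`). It has at most `2 * N ^ 2 + 3` steps, and the narrowest window is wide enough
for the bound in `r` (`window_pow_lt`).

For `N ≤ 2` the number `r` is too small for descents. If every relevant clock that is not reset
becomes irrelevant in one step (`Fast`), regions depend only on the integral part of the delay, and
a walk and a tour suffice. This covers `N = 1`. Otherwise `N = 2` and the process has one explicit
shape (`exists_twoPhase`), for which four steps are enough. -/

namespace SMPDTA

/-! ### Walks in finite strongly connected graphs. -/

section Walks

variable {α : Type*}

/-- `Walk E n u v` : there is a walk with `n` edges from `u` to `v`. -/
def Walk (E : α → α → Prop) : ℕ → α → α → Prop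
  | 0, u, v => u = v
  | n + 1, u, v => ∃ w, E u w ∧ Walk E n w v

lemma Walk.add {E : α → α → Prop} {m n : ℕ} {u v w : α} (h : Walk E m u v) (h' : Walk E n v w) :
    Walk E (m + n) u w := by
  induction m generalizing u with
  | zero => cases h; simpa using h'
  | succ m ih =>
    obtain ⟨x, hx, h⟩ := h
    rw [Nat.add_right_comm]
    exact ⟨x, hx, ih h⟩

lemma walk_of_path {E : α → α → Prop} (w : ℕ → α) (n : ℕ) (h : ∀ i < n, E (w i) (w (i + 1))) :
    Walk E n (w 0) (w n) := by
  induction n generalizing w with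
  | zero => exact rfl
  | succ n ih =>
    exact ⟨w 1, h 0 (by omega), ih (fun i => w (i + 1)) fun i hi => h (i + 1) (by omega)⟩

lemma Walk.exists_path {E : α → α → Prop} {n : ℕ} {u v : α} (h : Walk E n u v) :
    ∃ w : ℕ → α, w 0 = u ∧ w n = v ∧ ∀ i < n, E (w i) (w (i + 1)) := by
  induction n generalizing u with
  | zero => exact ⟨fun _ => u, rfl, h, by omega⟩
  | succ n ih =>
    obtain ⟨x, hx, h⟩ := h
    obtain ⟨w, h0, hn, hw⟩ := ih h
    refine ⟨fun i => if i = 0 then u else w (i - 1), by simp, by simpa using hn, fun i hi => ?_⟩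
    rcases i with _ | i
    · simpa [h0] using hx
    · simpa using hw i (by omega)

lemma exists_walk_of_reflTransGen {E : α → α → Prop} {u v : α} (h : Relation.ReflTransGen E u v) :
    ∃ n, Walk E n u v := by
  induction h with
  | refl => exact ⟨0, rfl⟩
  | tail _ h ih =>
    obtain ⟨n, hn⟩ := ih
    exact ⟨n + 1, hn.add ⟨_, h, rfl⟩⟩

/-- An increasing sequence of subsets of a set with `N` elements, in which each set determines the
next one, is constant from index `N - 1` on if it starts with a nonempty set. -/
lemma subset_of_iterate {V : Set α} (hV : V.Finite) (F : Set α → Set α) (Y : ℕ → Set α)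
    (hF : ∀ i, Y (i + 1) = F (Y i)) (hmono : ∀ i, Y i ⊆ Y (i + 1)) (hYV : ∀ i, Y i ⊆ V)
    (h0 : (Y 0).Nonempty) (j : ℕ) : Y j ⊆ Y (V.ncard - 1) := by
  have hm : Monotone Y := monotone_nat_of_le_succ hmono
  have hst : ∃ i < V.ncard, Y i = Y (i + 1) := by
    -- Strict inclusions at all indices below `N` would give `Y N` at least `N + 1` elements.
    by_contra! hne
    have hc : ∀ i ≤ V.ncard, i + 1 ≤ (Y i).ncard := by
      intro i hi
      induction i with
      | zero => exact (Set.ncard_pos (hV.subset (hYV 0))).2 h0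
      | succ i ih =>
        have := Set.ncard_lt_ncard (ssubset_of_subset_of_ne (hmono i) (hne i (by omega)))
          (hV.subset (hYV _))
        have := ih (by omega)
        omega
    have := hc _ le_rfl
    have := Set.ncard_le_ncard (hYV V.ncard) hV
    omega
  obtain ⟨i, hi, he⟩ := hst
  have hconst : ∀ k, Y (i + k) = Y i := by
    intro k
    induction k with
    | zero => rfl
    | succ k ih => rw [← Nat.add_assoc, hF, ih, ← hF, ← he]
  rcases le_total j i with h | h
  · exact hm (h.trans (by omega))
  · obtain ⟨k, rfl⟩ := Nat.exists_eq_add_of_le h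
    rw [hconst]
    exact hm (by omega)

/-- The setting: a finite strongly connected graph all of whose vertices have a successor. -/
structure NiceGraph (V : Set α) (E : α → α → Prop) : Prop where
  finite : V.Finite
  left_mem : ∀ {u v}, E u v → u ∈ V
  right_mem : ∀ {u v}, E u v → v ∈ V
  conn : StronglyConnected V E
  out : ∀ u ∈ V, ∃ v, E u v

variable {V : Set α} {E : α → α → Prop}

/-- Search backwards from `v`: the sets of vertices with a walk of length at most `i` to `v` grow
and each determines the next, so `subset_of_iterate` applies. -/
lemma NiceGraph.exists_walk (h : NiceGraph V E) {u v : α} (hu : u ∈ V) (hv : v ∈ V) :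
    ∃ n, n ≤ V.ncard - 1 ∧ Walk E n u v := by
  let Y : ℕ → Set α := fun i => {x | x ∈ V ∧ ∃ n ≤ i, Walk E n x v}
  have key := subset_of_iterate h.finite (fun T => T ∪ {x | ∃ y ∈ T, E x y}) Y ?_ ?_
    (fun i x hx => hx.1) ⟨v, hv, 0, le_rfl, rfl⟩
  · obtain ⟨n, hn⟩ := exists_walk_of_reflTransGen (h.conn u hu v hv)
    exact (key n ⟨hu, n, le_rfl, hn⟩).2
  · intro i
    ext x
    constructor
    · rintro ⟨hx, n, hn, hw⟩
      rcases n with _ | n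
      · exact Or.inl ⟨hx, 0, by omega, hw⟩
      · obtain ⟨y, hy, hw⟩ := hw
        exact Or.inr ⟨y, ⟨h.right_mem hy, n, by omega, hw⟩, hy⟩
    · rintro (⟨hx, n, hn, hw⟩ | ⟨y, ⟨hx, n, hn, hw⟩, hy⟩)
      · exact ⟨hx, n, by omega, hw⟩
      · exact ⟨h.left_mem hy, n + 1, by omega, y, hy, hw⟩
  · rintro i x ⟨hx, n, hn, hw⟩
    exact ⟨hx, n, by omega, hw⟩

lemma NiceGraph.exists_pos_walk (h : NiceGraph V E) {u v : α} (hu : u ∈ V) (hv : v ∈ V) :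
    ∃ n, 0 < n ∧ n ≤ V.ncard ∧ Walk E n u v := by
  obtain ⟨w, hw⟩ := h.out u hu
  obtain ⟨n, hn, hwn⟩ := h.exists_walk (h.right_mem hw) hv
  have := (Set.ncard_pos h.finite).2 ⟨u, hu⟩
  exact ⟨n + 1, by omega, by omega, w, hw, hwn⟩

lemma NiceGraph.exists_pred (h : NiceGraph V E) {v : α} (hv : v ∈ V) : ∃ u, E u v := by
  obtain ⟨n, hn, -, hw⟩ := h.exists_pos_walk hv hv
  obtain ⟨w, -, h1, h2⟩ := hw.exists_path
  refine ⟨w (n - 1), ?_⟩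
  have := h2 (n - 1) (by omega)
  rwa [Nat.sub_add_cancel hn, h1] at this

lemma dvd_of_closed_walk {p : ℕ} (hp : IsPeriod E p) {n : ℕ} {u : α} (h : Walk E n u u) :
    p ∣ n := by
  rcases Nat.eq_zero_or_pos n with rfl | hn
  · exact dvd_zero p
  · obtain ⟨w, h0, h1, h2⟩ := h.exists_path
    exact hp.1 n ⟨hn, w, h1.trans h0.symm, h2⟩

/-! ### Cyclic classes, and walks of a common length inside a class. -/

section Cyclic

variable {p : ℕ} {W : Fin p → Set α}

/-- The cyclic class with index `i` modulo `p`. -/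
def cls (W : Fin p → Set α) (i : ℕ) : Set α := {u | ∃ j : Fin p, (j : ℕ) = i % p ∧ u ∈ W j}

lemma cls_coe (k : Fin p) : cls W k = W k := by
  ext u
  constructor
  · rintro ⟨j, hj, hu⟩
    rw [Nat.mod_eq_of_lt k.2] at hj
    rwa [← Fin.ext hj]
  · exact fun hu => ⟨k, (Nat.mod_eq_of_lt k.2).symm, hu⟩

lemma cls_congr {i j : ℕ} (h : i % p = j % p) : cls W i = cls W j := by simp [cls, h]

variable (hW : IsCyclicDecomposition V E p W)

include hW

lemma cls_subset (i : ℕ) : cls W i ⊆ V := by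
  rintro u ⟨j, -, hu⟩
  rw [← hW.union]
  exact Set.mem_iUnion_of_mem j hu

lemma cls_edge {i : ℕ} {u v : α} (hu : u ∈ cls W i) (h : E u v) : v ∈ cls W (i + 1) := by
  obtain ⟨j, hj, hu⟩ := hu
  have hp : 0 < p := j.pos
  refine ⟨⟨(j + 1) % p, Nat.mod_lt _ hp⟩, ?_, hW.edge j _ rfl u hu v h⟩
  simp [hj]

lemma cls_walk {i n : ℕ} {u v : α} (hu : u ∈ cls W i) (h : Walk E n u v) : v ∈ cls W (i + n) := by
  induction n generalizing u i with
  | zero => cases h; exact hu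
  | succ n ih =>
    obtain ⟨w, hw, h⟩ := h
    have := ih (cls_edge hW hu hw) h
    rwa [Nat.add_assoc, Nat.add_comm 1] at this

lemma cls_index {i j : ℕ} {u : α} (hi : u ∈ cls W i) (hj : u ∈ cls W j) : i % p = j % p := by
  obtain ⟨a, ha, hua⟩ := hi
  obtain ⟨b, hb, hub⟩ := hj
  by_contra hne
  have hab : a ≠ b := by rintro rfl; exact hne (ha.symm.trans hb)
  exact Set.disjoint_left.1 (hW.disjoint a b hab) hua hub

lemma exists_cls {u : α} (hu : u ∈ V) : ∃ k : Fin p, u ∈ cls W k := by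
  rw [← hW.union] at hu
  obtain ⟨k, hk⟩ := Set.mem_iUnion.1 hu
  exact ⟨k, by rwa [cls_coe]⟩

lemma NiceGraph.cls_nonempty (h : NiceGraph V E) (hne : V.Nonempty) (i : ℕ) :
    (cls W i).Nonempty := by
  obtain ⟨u, hu⟩ := hne
  obtain ⟨k, hk⟩ := exists_cls hW hu
  have hp : 0 < p := k.pos
  have key : ∀ n, (cls W (k + n)).Nonempty := by
    intro n
    induction n with
    | zero => exact ⟨u, hk⟩
    | succ n ih =>
      obtain ⟨v, hv⟩ := ih
      obtain ⟨w, hw⟩ := h.out v (cls_subset hW _ hv)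
      exact ⟨w, cls_edge hW hv hw⟩
  have := key (i + (p - k))
  rwa [cls_congr (j := i)] at this
  have : (k : ℕ) + (i + (p - k)) = i + p := by have := k.2; omega
  rw [this, Nat.add_mod_right]

/-- All vertices of a cyclic class have walks of a common length to a given vertex of the class. -/
lemma NiceGraph.exists_uniform_walk (h : NiceGraph V E) (hp : IsPeriod E p) {i : ℕ} {v : α}
    (hv : v ∈ cls W i) : ∃ L, L ≤ V.ncard * (V.ncard - 1) ∧ p ∣ L ∧
      ∀ u ∈ cls W i, Walk E L u v := by
  have hvV := cls_subset hW _ hv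
  obtain ⟨a, ha0, ha, hav⟩ := h.exists_pos_walk hvV hvV
  have hpa : p ∣ a := dvd_of_closed_walk hp hav
  -- Walks are counted in blocks of the length `a` of a closed walk at `v`. Appending that closed
  -- walk makes the sets `Y i` increase, so they are stationary from index `N - 1` on.
  refine ⟨a * (V.ncard - 1), Nat.mul_le_mul_right _ ha, hpa.mul_right _, fun u hu => ?_⟩
  have huV := cls_subset hW _ hu
  let Y : ℕ → Set α := fun i => {x | x ∈ V ∧ Walk E (a * i) x v}
  have key := subset_of_iterate h.finite
    (fun T => {x | x ∈ V ∧ ∃ y ∈ T, Walk E a x y}) Y ?_ ?_ (fun i x hx => hx.1)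
    ⟨v, hvV, rfl⟩
  · suffices ∃ j, u ∈ Y j by
      obtain ⟨j, hj⟩ := this
      exact (key j hj).2
    obtain ⟨l, -, hl⟩ := h.exists_walk huV hvV
    have hpl : p ∣ l := by
      have := cls_index hW hv (cls_walk hW hu hl)
      have h2 : (i + 0) % p = (i + l) % p := this
      exact Nat.modEq_zero_iff_dvd.1 (Nat.ModEq.add_left_cancel' i h2).symm
    -- The lengths of closed walks at `v` form a numerical semigroup. Any cycle can be inserted into
    -- a closed walk at `v`, so the gcd of the semigroup divides `p`, and the semigroup contains all
    -- large multiples of the gcd.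
    let C : Set ℕ := {n | Walk E n v v}
    have hC : ∀ n ∈ AddSubmonoid.closure C, Walk E n v v := by
      intro n hn
      induction hn using AddSubmonoid.closure_induction with
      | mem x hx => exact hx
      | zero => exact rfl
      | add x y _ _ hx hy => exact hx.add hy
    obtain ⟨n₀, hn₀⟩ := Nat.exists_mem_closure_of_ge C
    have hd : Nat.setGcd C ∣ p := by
      refine hp.2 _ ?_
      rintro n ⟨hn, w, hw, hE⟩
      have h0 := h.left_mem (hE 0 hn)
      have hcyc := walk_of_path w n hE
      rw [hw] at hcyc
      obtain ⟨b, -, hb⟩ := h.exists_walk hvV h0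
      obtain ⟨e, -, he⟩ := h.exists_walk h0 hvV
      have h1 : Nat.setGcd C ∣ b + e := Nat.setGcd_dvd_of_mem (hb.add he)
      have h2 : Nat.setGcd C ∣ b + n + e := Nat.setGcd_dvd_of_mem ((hb.add hcyc).add he)
      have h3 : b + n + e = (b + e) + n := by omega
      rw [h3] at h2
      exact (Nat.dvd_add_right h1).1 h2
    -- A walk of length `l` is completed by a closed walk at `v` to length `a * (n₀ + l)`; the
    -- difference is a multiple of `p` and at least `n₀`.
    refine ⟨n₀ + l, huV, ?_⟩
    have hle : n₀ + l ≤ a * (n₀ + l) := Nat.le_mul_of_pos_left _ ha0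
    obtain ⟨c, hc⟩ := Nat.exists_eq_add_of_le (show l ≤ a * (n₀ + l) by omega)
    rw [hc]
    refine hl.add (hC _ (hn₀ c (by omega) (hd.trans ?_)))
    rw [← Nat.dvd_add_right hpl, ← hc]
    exact hpa.mul_right _
  · intro j
    ext x
    constructor
    · rintro ⟨hx, hw⟩
      refine ⟨hx, ?_⟩
      rw [Nat.mul_succ, Nat.add_comm] at hw
      obtain ⟨w, h0, h1, h2⟩ := hw.exists_path
      have g1 := walk_of_path w a fun i hi => h2 i (by omega)
      have g2 := walk_of_path (fun i => w (a + i)) (a * j) fun i hi => h2 (a + i) (by omega)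
      have haV : w a ∈ V := h.right_mem (by
        have := h2 (a - 1) (by omega)
        rwa [Nat.sub_add_cancel ha0] at this)
      simp only [Nat.add_zero, h1] at g2
      rw [h0] at g1
      exact ⟨w a, ⟨haV, g2⟩, g1⟩
    · rintro ⟨hx, y, ⟨hy, hw⟩, g⟩
      refine ⟨hx, ?_⟩
      rw [Nat.mul_succ, Nat.add_comm]
      exact g.add hw
  · rintro j x ⟨hx, hw⟩
    exact ⟨hx, hw.add hav⟩

end Cyclic

/-! ### Tours: walks that reset all clocks. -/

section Tours

/-- `Tour E f n u Y v` : there is a walk with `n` edges from `u` to `v` such that the sets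
`f w`, for the vertices `w` that it leaves, cover the complement of `Y`. -/
def Tour {β : Type*} (E : α → α → Prop) (f : α → Set β) : ℕ → α → Set β → α → Prop
  | 0, u, Y, v => u = v ∧ Y = Set.univ
  | n + 1, u, Y, v => ∃ w, E u w ∧ Tour E f n w (Y ∪ f u) v

variable {β : Type*} {f : α → Set β}

lemma Tour.mono {n : ℕ} {u v : α} {Y Y' : Set β} (h : Tour E f n u Y v) (hY : Y ⊆ Y') :
    Tour E f n u Y' v := by
  induction n generalizing u Y Y' with
  | zero => exact ⟨h.1, Set.eq_univ_of_univ_subset (h.2 ▸ hY)⟩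
  | succ n ih =>
    obtain ⟨w, hw, h⟩ := h
    exact ⟨w, hw, ih h (Set.union_subset_union_left _ hY)⟩

lemma Walk.tour {m n : ℕ} {u v w : α} {Y : Set β} (h : Walk E m u v) (h' : Tour E f n v Y w) :
    Tour E f (m + n) u Y w := by
  induction m generalizing u with
  | zero => cases h; simpa using h'
  | succ m ih =>
    obtain ⟨x, hx, h⟩ := h
    rw [Nat.add_right_comm]
    exact ⟨x, hx, (ih h).mono Set.subset_union_left⟩

lemma Tour.walk {n : ℕ} {u v : α} {Y : Set β} (h : Tour E f n u Y v) : Walk E n u v := by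
  induction n generalizing u Y with
  | zero => exact h.1
  | succ n ih =>
    obtain ⟨w, hw, h⟩ := h
    exact ⟨w, hw, ih h⟩

/-- Induction on the number of vertices still to be left. Each of them costs a leg of at most `N -
1` edges. Only vertices that are left count, so the final leg starts with an edge out of `u` and may
cost `N` edges. -/
lemma NiceGraph.exists_tour_aux (h : NiceGraph V E) {v : α} (hv : v ∈ V) (j : ℕ) :
    ∀ (A : Set α), A ⊆ V → A.ncard = j → ∀ u ∈ V, ∀ Y : Set β,
      Y ∪ f u ∪ (⋃ a ∈ A, f a) = Set.univ →
      ∃ n, 0 < n ∧ n ≤ j * (V.ncard - 1) + V.ncard ∧ Tour E f n u Y v := by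
  induction j with
  | zero =>
    intro A hA hc u hu Y hY
    rw [Set.ncard_eq_zero (h.finite.subset hA)] at hc
    subst hc
    obtain ⟨w, hw⟩ := h.out u hu
    obtain ⟨n, hn, hwn⟩ := h.exists_walk (h.right_mem hw) hv
    have := (Set.ncard_pos h.finite).2 ⟨u, hu⟩
    refine ⟨n + 1, by omega, by omega, w, hw, ?_⟩
    have : Tour E f 0 v (Y ∪ f u) v := ⟨rfl, by simpa using hY⟩
    simpa using hwn.tour this
  | succ j ih =>
    intro A hA hc u hu Y hY
    obtain ⟨a, ha⟩ : A.Nonempty := (Set.ncard_pos (h.finite.subset hA)).1 (by omega)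
    obtain ⟨n, hn, hw⟩ := h.exists_walk hu (hA ha)
    have hc' : (A \ {a}).ncard = j := by
      rw [Set.ncard_sdiff_singleton_of_mem ha, hc]; rfl
    have hcov : Y ∪ f u ∪ f a ∪ (⋃ b ∈ A \ {a}, f b) = Set.univ := by
      refine Set.eq_univ_of_univ_subset ?_
      rw [← hY]
      rintro x (hx | hx)
      · exact Or.inl (Or.inl hx)
      · obtain ⟨b, hb, hx⟩ := Set.mem_iUnion₂.1 hx
        by_cases hba : b = a
        · exact Or.inl (Or.inr (hba ▸ hx))
        · exact Or.inr (Set.mem_iUnion₂.2 ⟨b, ⟨hb, hba⟩, hx⟩)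
    rcases n with _ | n
    -- The target is the present vertex: its contribution is already counted by `f u`, and no edge
    -- is spent.
    · obtain rfl : u = a := hw
      obtain ⟨n, h0, h1, h2⟩ := ih (A \ {u}) (Set.sdiff_subset.trans hA) hc' u hu Y
        (by rwa [Set.union_assoc Y, Set.union_self] at hcov)
      exact ⟨n, h0, h1.trans (by gcongr; omega), h2⟩
    · obtain ⟨w, hw1, hw⟩ := hw
      obtain ⟨n', h0, h1, h2⟩ := ih (A \ {a}) (Set.sdiff_subset.trans hA) hc' a (hA ha) (Y ∪ f u)
        hcov
      refine ⟨n + 1 + n', by omega, by rw [Nat.add_mul]; omega, ?_⟩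
      rw [Nat.add_right_comm]
      exact ⟨w, hw1, hw.tour h2⟩

/-- There is a short walk from `u` to `v` that leaves each vertex. -/
lemma NiceGraph.exists_tour (h : NiceGraph V E) {u v : α} (hu : u ∈ V) (hv : v ∈ V)
    (hf : ∀ x, ∃ a ∈ V, x ∈ f a) :
    ∃ n, 0 < n ∧ n ≤ (V.ncard - 1) * (V.ncard - 1) + V.ncard ∧ Tour E f n u ∅ v := by
  refine h.exists_tour_aux hv (V.ncard - 1) (V \ {u}) Set.sdiff_subset
    (Set.ncard_sdiff_singleton_of_mem hu) u hu ∅ ?_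
  refine Set.eq_univ_of_forall fun x => ?_
  obtain ⟨a, ha, hx⟩ := hf x
  by_cases hau : a = u
  · exact Or.inl (Or.inr (hau ▸ hx))
  · exact Or.inr (Set.mem_iUnion₂.2 ⟨a, ⟨ha, hau⟩, hx⟩)

end Tours

end Walks

/-! ### Moves of the product process, and couplings through shared moves. -/

lemma lintegral_pow_succ {Γ : Type*} [MeasurableSpace Γ] (P : Kernel Γ Γ) (n : ℕ) (a : Γ)
    {T : Set Γ} (hT : MeasurableSet T) : (P ^ (n + 1)) a T = ∫⁻ b, (P ^ n) b T ∂P a := by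
  rw [add_comm, Kernel.pow_add_apply_eq_lintegral _ _ _ _ hT, pow_one]

section Moves

variable {S Q X : Type*} [Fintype S]
  [MeasurableSpace S] [DiscreteMeasurableSpace S]
  [MeasurableSpace Q] [DiscreteMeasurableSpace Q]

/-- The joint law of the next state of a semi-Markov process and the delay. -/
noncomputable def moveLaw (M : SMP S) (s : S) : Measure (S × ℝ) :=
  ∑ s' : S, M.trans s s' • (M.delay s s').law.map (Prod.mk s')

omit [DiscreteMeasurableSpace S] in
lemma moveLaw_apply (M : SMP S) (s : S) {B : Set (S × ℝ)} (hB : MeasurableSet B) :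
    moveLaw M s B = ∑ s' : S, M.trans s s' * (M.delay s s').law {t | (s', t) ∈ B} := by
  simp only [moveLaw, Measure.coe_finsetSum, Finset.sum_apply, Measure.smul_apply, smul_eq_mul]
  refine Finset.sum_congr rfl fun s' _ => ?_
  rw [Measure.map_apply measurable_prodMk_left hB]
  rfl

omit [DiscreteMeasurableSpace S] in
-- `B` need not be measurable: later target sets are described by existential statements. The
-- measurable hull of `B` makes up for this.
lemma le_moveLaw (M : SMP S) (s s' : S) (J : Set ℝ) (B : Set (S × ℝ))
    (h : ∀ t ∈ J, (s', t) ∈ B) : M.trans s s' * (M.delay s s').law J ≤ moveLaw M s B := by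
  calc M.trans s s' * (M.delay s s').law J
      ≤ M.trans s s' * (M.delay s s').law {t | (s', t) ∈ toMeasurable (moveLaw M s) B} := by
        gcongr
        exact fun t ht => subset_toMeasurable _ _ (h t ht)
    _ ≤ moveLaw M s (toMeasurable (moveLaw M s) B) := by
        rw [moveLaw_apply M s (measurableSet_toMeasurable _ _)]
        exact Finset.single_le_sum (f := fun s' => M.trans s s' *
          (M.delay s s').law {t | (s', t) ∈ toMeasurable (moveLaw M s) B})
          (fun _ _ => zero_le) (Finset.mem_univ s')
    _ = moveLaw M s B := measure_toMeasurable _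

/-- The state entered from `z` by the move `y`. -/
noncomputable def moveTo (A : DTA Q S X) (z : State S Q X) (y : S × ℝ) : State S Q X :=
  advance A y.1 z y.2

omit [Fintype S] in
lemma measurable_moveTo (A : DTA Q S X) :
    Measurable fun w : State S Q X × (S × ℝ) => moveTo A w.1 w.2 := by
  have hc : Measurable fun w : State S Q X × (S × ℝ) => A.config w.1 :=
    A.measurable_config.comp measurable_fst
  refine measurable_snd.fst.prodMk (hc.fst.prodMk (measurable_pi_lambda _ fun x => ?_))
  exact ((measurable_pi_apply x).comp hc.snd).add (measurable_real_toNNReal.comp measurable_snd.snd)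

omit [Fintype S] in
lemma measurable_moveTo_right (A : DTA Q S X) (z : State S Q X) : Measurable (moveTo A z) :=
  (measurable_moveTo A).comp measurable_prodMk_left

lemma productKernel_apply (M : SMP S) (A : DTA Q S X) (z : State S Q X) :
    productKernel M A z = (moveLaw M z.1).map (moveTo A z) := by
  change ∑ s' : S, M.trans z.1 s' • (M.delay z.1 s').law.map (advance A s' z) = _
  ext B hB
  rw [Measure.map_apply (measurable_moveTo_right A z) hB,
    moveLaw_apply M _ (measurable_moveTo_right A z hB)]
  simp only [Measure.coe_finsetSum, Finset.sum_apply, Measure.smul_apply, smul_eq_mul]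
  refine Finset.sum_congr rfl fun s' _ => ?_
  have hm : Measurable (advance A s' z) := (measurable_advance A s').comp measurable_prodMk_left
  rw [Measure.map_apply hm hB]
  rfl

instance (M : SMP S) (s : S) : IsProbabilityMeasure (moveLaw M s) := by
  refine ⟨?_⟩
  rw [moveLaw_apply M s MeasurableSet.univ]
  simp only [Set.mem_univ, Set.ofPred_true, measure_univ, mul_one]
  rw [← tsum_fintype (L := .unconditional S), (M.trans s).tsum_coe]

/-- The part of the transition kernel that comes from the moves in `U`. -/
noncomputable def stepOn (M : SMP S) (A : DTA Q S X) (U : Set (State S Q X × (S × ℝ)))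
    (hU : MeasurableSet U) : Kernel (State S Q X) (State S Q X) where
  toFun z := ((moveLaw M z.1).restrict {y | (z, y) ∈ U}).map (moveTo A z)
  measurable' := by
    let κ : Kernel S (S × ℝ) := ⟨moveLaw M, Measurable.of_discrete⟩
    have : IsMarkovKernel κ := ⟨fun s => inferInstanceAs (IsProbabilityMeasure (moveLaw M s))⟩
    let η : Kernel (State S Q X) (State S Q X) :=
      ((Kernel.id ×ₖ (κ.comap Prod.fst measurable_fst)).restrict hU).map
        fun w => moveTo A w.1 w.2
    have : ∀ z, η z = ((moveLaw M z.1).restrict {y | (z, y) ∈ U}).map (moveTo A z) := by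
      intro z
      rw [Kernel.map_apply _ (measurable_moveTo A), Kernel.restrict_apply, Kernel.prod_apply,
        Kernel.id_apply, Kernel.comap_apply, Measure.dirac_prod]
      rw [Measure.restrict_map measurable_prodMk_left hU,
        Measure.map_map (measurable_moveTo A) measurable_prodMk_left]
      rfl
    simp only [← this]
    exact η.measurable

lemma stepOn_apply (M : SMP S) (A : DTA Q S X) {U : Set (State S Q X × (S × ℝ))}
    (hU : MeasurableSet U) (z : State S Q X) :
    stepOn M A U hU z = ((moveLaw M z.1).restrict {y | (z, y) ∈ U}).map (moveTo A z) := rfl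

lemma stepOn_le (M : SMP S) (A : DTA Q S X) {U : Set (State S Q X × (S × ℝ))}
    (hU : MeasurableSet U) (z : State S Q X) : stepOn M A U hU z ≤ productKernel M A z := by
  rw [productKernel_apply, stepOn_apply]
  exact Measure.map_mono Measure.restrict_le_self (measurable_moveTo_right A z)

variable (M : SMP S) (A : DTA Q S X)

lemma le_productKernel (z : State S Q X) (G : Set (State S Q X)) :
    moveLaw M z.1 {y | moveTo A z y ∈ G} ≤ productKernel M A z G := by
  rw [productKernel_apply]
  exact Measure.le_map_apply (measurable_moveTo_right A z).aemeasurable _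

lemma one_le_pow_zero (M : SMP S) (A : DTA Q S X) {z : State S Q X} {T : Set (State S Q X)}
    (hT : MeasurableSet T) (hz : z ∈ T) : 1 ≤ (productKernel M A ^ 0) z T := by
  rw [pow_zero]
  change 1 ≤ Kernel.id z T
  rw [Kernel.id_apply, Measure.dirac_apply' _ hT, Set.indicator_of_mem hz]
  exact le_rfl

/-- From a state from which `G` is entered with probability at least `β` in `m` steps, the set `T`
is entered with probability at least `β * γ` in `m + n` steps if it is entered with probability at
least `γ` in `n` steps from `G`. -/
lemma le_pow_add {m n : ℕ} {z : State S Q X} {G T : Set (State S Q X)} {β γ : ℝ≥0∞}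
    (hT : MeasurableSet T) (hβ : β ≤ (productKernel M A ^ m) z G)
    (hγ : ∀ y ∈ G, γ ≤ (productKernel M A ^ n) y T) :
    β * γ ≤ (productKernel M A ^ (m + n)) z T := by
  rw [Kernel.pow_add_apply_eq_lintegral _ _ _ _ hT]
  have hm := Kernel.measurable_coe (productKernel M A ^ n) hT
  -- Markov's inequality for the superlevel set of `y ↦ P ^ n (y, T)`, which is measurable and
  -- contains `G`.
  calc β * γ ≤ γ * (productKernel M A ^ m) z {y | γ ≤ (productKernel M A ^ n) y T} := by
        rw [mul_comm]
        gcongr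
        exact hβ.trans (measure_mono hγ)
    _ ≤ _ := mul_meas_ge_le_lintegral hm γ

lemma le_pow_succ {n : ℕ} {z : State S Q X} {G T : Set (State S Q X)} {β γ : ℝ≥0∞}
    (hT : MeasurableSet T) (hβ : β ≤ moveLaw M z.1 {y | moveTo A z y ∈ G})
    (hγ : ∀ y ∈ G, γ ≤ (productKernel M A ^ n) y T) :
    β * γ ≤ (productKernel M A ^ (n + 1)) z T := by
  rw [Nat.add_comm]
  refine le_pow_add M A hT ?_ hγ
  rw [pow_one]
  exact hβ.trans (le_productKernel M A z G)

/-- All states related by `D` have a common part of their `n`-step distribution; on the domain of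
the symmetric relation `D`, its mass is at least `β`, and it is concentrated on `R`. -/
def Couples (R : Set (State S Q X)) (n : ℕ) (β : ℝ≥0∞)
    (D : State S Q X → State S Q X → Prop) : Prop :=
  ∃ K : Kernel (State S Q X) (State S Q X), (∀ z, K z ≤ (productKernel M A ^ n) z) ∧
    (∀ z z', D z z' → K z = K z') ∧ ∀ z, D z z → β ≤ K z Set.univ ∧ K z Rᶜ = 0

variable {M A}

lemma couples_zero {R : Set (State S Q X)} (hR : MeasurableSet R)
    {D : State S Q X → State S Q X → Prop} (hD : ∀ z z', D z z' → z = z' ∧ z ∈ R) :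
    Couples M A R 0 1 D := by
  refine ⟨Kernel.id, fun z => by rw [pow_zero]; exact le_rfl,
    fun z z' h => by rw [(hD z z' h).1], fun z h => ?_⟩
  rw [Kernel.id_apply]
  refine ⟨by simp, ?_⟩
  rw [Measure.dirac_apply' _ hR.compl]
  simp [(hD z z h).2]

/-- The first step is cut down to the moves in `U`. Related states have the same law of moves and
the same moves in `U`, and a shared move leads to states related by `D'`, between which `K` makes no
difference. -/
lemma Couples.step {R : Set (State S Q X)} (hR : MeasurableSet R) {n : ℕ} {β β' : ℝ≥0∞}
    {D D' : State S Q X → State S Q X → Prop} {U : Set (State S Q X × (S × ℝ))}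
    (hU : MeasurableSet U)
    (hD : ∀ z z', D z z' → z.1 = z'.1 ∧ (∀ y, (z, y) ∈ U ↔ (z', y) ∈ U) ∧
      ∀ y, (z, y) ∈ U → D' (moveTo A z y) (moveTo A z' y) ∧
        D' (moveTo A z y) (moveTo A z y))
    (hβ : ∀ z, D z z → β' ≤ moveLaw M z.1 {y | (z, y) ∈ U})
    (h : Couples M A R n β D') : Couples M A R (n + 1) (β' * β) D := by
  obtain ⟨K, hK1, hK2, hK3⟩ := h
  have hUz : ∀ z, MeasurableSet {y | (z, y) ∈ U} := fun z => measurable_prodMk_left hU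
  have hmv := fun z => measurable_moveTo_right A z
  have hval : ∀ z T, MeasurableSet T → (K ∘ₖ stepOn M A U hU) z T =
      ∫⁻ y in {y | (z, y) ∈ U}, K (moveTo A z y) T ∂moveLaw M z.1 := by
    intro z T hT
    rw [Kernel.comp_apply' _ _ _ hT, stepOn_apply,
      lintegral_map (K.measurable_coe hT) (hmv z)]
  refine ⟨K ∘ₖ stepOn M A U hU, fun z => ?_, fun z z' hzz => ?_, fun z hz => ⟨?_, ?_⟩⟩
  · refine Measure.le_iff.2 fun T hT => ?_
    rw [Kernel.comp_apply' _ _ _ hT, lintegral_pow_succ _ _ _ hT]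
    exact lintegral_mono' (stepOn_le M A hU z) fun y => hK1 y T
  · obtain ⟨h1, h2, h3⟩ := hD z z' hzz
    ext T hT
    have hs : {y | (z, y) ∈ U} = {y | (z', y) ∈ U} := Set.ext h2
    rw [hval z T hT, hval z' T hT, h1, ← hs]
    refine setLIntegral_congr_fun (hUz z) fun y hy => ?_
    simp only [hK2 _ _ (h3 y hy).1]
  · obtain ⟨-, -, h3⟩ := hD z z hz
    rw [hval z _ .univ]
    calc β' * β ≤ ∫⁻ _ in {y | (z, y) ∈ U}, β ∂moveLaw M z.1 := by
          rw [setLIntegral_const, mul_comm]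
          gcongr
          exact hβ z hz
      _ ≤ _ := setLIntegral_mono' (hUz z) fun y hy => (hK3 _ (h3 y hy).2).1
  · obtain ⟨-, -, h3⟩ := hD z z hz
    rw [hval z _ hR.compl]
    exact setLIntegral_eq_zero (hUz z) fun y hy => (hK3 _ (h3 y hy).2).2

lemma Couples.mono {R : Set (State S Q X)} {n : ℕ} {β β' : ℝ≥0∞}
    {D D' : State S Q X → State S Q X → Prop} (h : Couples M A R n β D) (hβ : β' ≤ β)
    (hD : ∀ z z', D' z z' → D z z') : Couples M A R n β' D' := by
  obtain ⟨K, h1, h2, h3⟩ := h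
  exact ⟨K, h1, fun z z' hz => h2 z z' (hD z z' hz), fun z hz =>
    ⟨hβ.trans (h3 z (hD z z hz)).1, (h3 z (hD z z hz)).2⟩⟩

/-- On `G` the kernel `K` is one fixed measure of mass at least `β₂`. Normalized, it is the
minorizing measure; reaching `G` costs the factor `β₁`. -/
lemma exists_minorizing {R G Γ : Set (State S Q X)} (hR : MeasurableSet R) (hG : MeasurableSet G)
    {n₁ n₂ : ℕ} {β₁ β₂ : ℝ≥0∞} {D : State S Q X → State S Q X → Prop}
    (hD : ∀ z ∈ G, ∀ z' ∈ G, D z z') (hc : Couples M A R n₂ β₂ D) (h1 : β₁ ≠ 0) (h2 : β₂ ≠ 0)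
    (hΓ : ∀ z ∈ Γ, β₁ ≤ (productKernel M A ^ n₁) z G) (hne : Γ.Nonempty) :
    ∃ κ : Measure (State S Q X), IsProbabilityMeasure κ ∧ κ R = 1 ∧ ∀ z ∈ Γ, ∀ T,
      MeasurableSet T → β₁ * β₂ * κ T ≤ (productKernel M A ^ (n₁ + n₂)) z T := by
  obtain ⟨K, hK1, hK2, hK3⟩ := hc
  obtain ⟨z₀, hz₀⟩ := hne
  obtain ⟨w, hw⟩ : G.Nonempty := by
    by_contra hne
    rw [Set.not_nonempty_iff_eq_empty] at hne
    have := hΓ z₀ hz₀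
    rw [hne, measure_empty] at this
    exact h1 (le_antisymm this zero_le)
  obtain ⟨hm, h0⟩ := hK3 w (hD w hw w hw)
  have hmk : ∀ n, IsMarkovKernel (productKernel M A ^ n) := by
    intro n
    induction n with
    | zero => rw [pow_zero]; exact inferInstanceAs (IsMarkovKernel Kernel.id)
    | succ n ih =>
      rw [pow_succ]
      exact inferInstanceAs (IsMarkovKernel ((productKernel M A ^ n) ∘ₖ productKernel M A))
  set m := K w Set.univ with hmdef
  have hm0 : m ≠ 0 := fun h => h2 (le_antisymm (h ▸ hm) zero_le)
  have hmt : m ≠ ∞ := by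
    have := hmk n₂
    exact ne_top_of_le_ne_top (measure_ne_top ((productKernel M A ^ n₂) w) Set.univ)
      (hK1 w Set.univ)
  have hKR : K w R = m := by
    have := measure_add_measure_compl (μ := K w) hR
    rwa [h0, add_zero] at this
  refine ⟨m⁻¹ • K w, ⟨?_⟩, ?_, fun z hz T hT => ?_⟩
  · rw [Measure.smul_apply, smul_eq_mul, ← hmdef, ENNReal.inv_mul_cancel hm0 hmt]
  · rw [Measure.smul_apply, smul_eq_mul, hKR, ENNReal.inv_mul_cancel hm0 hmt]
  · rw [Measure.smul_apply, smul_eq_mul, Kernel.pow_add_apply_eq_lintegral _ _ _ _ hT]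
    calc β₁ * β₂ * (m⁻¹ * K w T) ≤ β₁ * m * (m⁻¹ * K w T) := by gcongr
      _ = K w T * β₁ := by
        rw [mul_assoc, ← mul_assoc m, ENNReal.mul_inv_cancel hm0 hmt, one_mul, mul_comm]
      _ ≤ K w T * (productKernel M A ^ n₁) z G := by gcongr; exact hΓ z hz
      _ = ∫⁻ _ in G, K w T ∂(productKernel M A ^ n₁) z := by rw [setLIntegral_const]
      _ ≤ ∫⁻ y in G, (productKernel M A ^ n₂) y T ∂(productKernel M A ^ n₁) z := by
        refine setLIntegral_mono' hG fun y hy => ?_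
        rw [hK2 w y (hD w hw y hy)]
        exact hK1 y T
      _ ≤ _ := setLIntegral_le_lintegral _ _

end Moves

/-! ### Lower bounds for the probability of delay intervals. -/

section Delays

lemma DelayDensity.law_apply (f : DelayDensity) {B : Set ℝ} (hB : MeasurableSet B) :
    f.law B = ∫⁻ t in B ∩ Set.Ici 0, (f.toFun t : ℝ≥0∞) := by
  rw [law, withDensity_apply _ hB, Measure.restrict_restrict hB]

/-- Used to choose delays that avoid the countably many values at which a clock or the delay is an
integer. -/
lemma DelayDensity.exists_mem_of_law_pos (f : DelayDensity) {B C : Set ℝ} (hB : MeasurableSet B)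
    (hC : C.Countable) (h : f.law B ≠ 0) : ∃ t ∈ B, 0 ≤ t ∧ f.toFun t ≠ 0 ∧ t ∉ C := by
  by_contra! hne
  refine h ?_
  rw [f.law_apply hB]
  have hm : Measurable fun t => (f.toFun t : ℝ≥0∞) :=
    measurable_coe_nnreal_ennreal.comp f.measurable_toFun
  rw [lintegral_eq_zero_iff hm]
  have h0 : ∀ᵐ t ∂(volume.restrict (B ∩ Set.Ici 0)), t ∉ C :=
    ae_restrict_of_ae (measure_eq_zero_iff_ae_notMem.1 (hC.measure_zero volume))
  filter_upwards [h0, ae_restrict_mem (hB.inter measurableSet_Ici)] with t h1 h2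
  by_contra h3
  exact h1 (hne t h2.1 h2.2 fun h => h3 (by simp [h]))

lemma DelayDensity.law_countable (f : DelayDensity) {C : Set ℝ} (hC : C.Countable) :
    f.law C = 0 := by
  by_contra h
  obtain ⟨t, h1, -, -, h2⟩ := f.exists_mem_of_law_pos hC.measurableSet hC h
  exact h2 h1

lemma DelayDensity.le_law_Ioo (f : DelayDensity) {a b c : ℝ} (hc : 0 ≤ c)
    (ha : 0 ≤ a) (h : ∀ t ∈ Set.Ioo a b, c ≤ f.toFun t) :
    ENNReal.ofReal (c * (b - a)) ≤ f.law (Set.Ioo a b) := by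
  rw [f.law_apply measurableSet_Ioo, ENNReal.ofReal_mul hc, ← Real.volume_Ioo,
    ← setLIntegral_const]
  have hsub : Set.Ioo a b ⊆ Set.Ici 0 := fun t ht => Set.mem_Ici.2 (ha.trans ht.1.le)
  rw [Set.inter_eq_left.2 hsub]
  refine setLIntegral_mono' measurableSet_Ioo fun t ht => ?_
  rw [← ENNReal.ofReal_coe_nnreal]
  exact ENNReal.ofReal_le_ofReal (h t ht)

lemma DelayDensity.lt_law_Ioo (f : DelayDensity) {a b c : ℝ} (hc : 0 ≤ c)
    (ha : 0 ≤ a) (hab : a < b) (h : ∀ t ∈ Set.Ioo a b, c < f.toFun t) :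
    ENNReal.ofReal (c * (b - a)) < f.law (Set.Ioo a b) := by
  rw [f.law_apply measurableSet_Ioo, ENNReal.ofReal_mul hc, ← Real.volume_Ioo,
    ← setLIntegral_const]
  have hsub : Set.Ioo a b ⊆ Set.Ici 0 := fun t ht => Set.mem_Ici.2 (ha.trans ht.1.le)
  rw [Set.inter_eq_left.2 hsub]
  refine setLIntegral_strict_mono measurableSet_Ioo (by simp [hab])
    (measurable_coe_nnreal_ennreal.comp f.measurable_toFun) ?_ (ae_of_all _ fun t ht => ?_)
  · rw [setLIntegral_const]
    exact ENNReal.mul_ne_top ENNReal.ofReal_ne_top (by simp)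
  · rw [← ENNReal.ofReal_coe_nnreal]
    exact (ENNReal.ofReal_lt_ofReal_iff (hc.trans_lt (h t ht))).2 (h t ht)

/-- If a delay density does not vanish at a point that is not an integer, it does not vanish
between the neighbouring integers. -/
lemma DelayDensity.ne_zero_of_floor (f : DelayDensity) {t u : ℝ} {k : ℕ} (ht : f.toFun t ≠ 0)
    (h1 : k < t) (h2 : t < k + 1) (hu : u ∈ Set.Icc (k : ℝ) (k + 1)) : f.toFun u ≠ 0 := by
  obtain ⟨I, hI, h0, hpos⟩ := f.exists_interval
  have htI : t ∈ I := by
    by_contra h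
    exact ht (h0 t h)
  have hsub : Set.Icc (k : ℝ) (k + 1) ⊆ I := by
    rcases hI with ⟨l, u, -, rfl⟩ | ⟨l, rfl⟩
    · have a1 : l < k + 1 := by exact_mod_cast htI.1.trans_lt h2
      have a2 : k < u := by exact_mod_cast h1.trans_le htI.2
      have b1 : (l : ℝ) ≤ k := by exact_mod_cast Nat.lt_succ_iff.1 a1
      have b2 : (k : ℝ) + 1 ≤ u := by exact_mod_cast a2
      exact Set.Icc_subset_Icc b1 b2
    · have a1 : l < k + 1 := by exact_mod_cast (Set.mem_Ici.1 htI).trans_lt h2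
      have b1 : (l : ℝ) ≤ k := by exact_mod_cast Nat.lt_succ_iff.1 a1
      exact fun x hx => b1.trans hx.1
  obtain ⟨b, hb, hle⟩ := hpos _ _ hsub
  exact (hb.trans_le (hle u hu)).ne'

lemma DelayDensity.exists_left (f : DelayDensity) : ∃ l : ℕ, (∀ t < (l : ℝ), f.toFun t = 0) ∧
    ∀ t ∈ Set.Icc (l : ℝ) (l + 1), f.toFun t ≠ 0 := by
  obtain ⟨I, hI, h0, hpos⟩ := f.exists_interval
  rcases hI with ⟨l, u, hlu, rfl⟩ | ⟨l, rfl⟩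
  · refine ⟨l, fun t ht => h0 t fun h => absurd h.1 (not_le.2 ht), fun t ht => ?_⟩
    have : (l : ℝ) + 1 ≤ u := by exact_mod_cast hlu
    obtain ⟨b, hb, hle⟩ := hpos l (l + 1) (Set.Icc_subset_Icc le_rfl this)
    exact (hb.trans_le (hle t ht)).ne'
  · refine ⟨l, fun t ht => h0 t fun h => absurd h (not_le.2 ht), fun t ht => ?_⟩
    obtain ⟨b, hb, hle⟩ := hpos l (l + 1) (fun x hx => hx.1)
    exact (hb.trans_le (hle t ht)).ne'

/-- The left end of the support of a delay density. -/
noncomputable def DelayDensity.left (f : DelayDensity) : ℕ := f.exists_left.choose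

lemma DelayDensity.eq_zero_of_lt_left (f : DelayDensity) {t : ℝ} (h : t < f.left) :
    f.toFun t = 0 := f.exists_left.choose_spec.1 t h

lemma DelayDensity.ne_zero_of_left (f : DelayDensity) {t : ℝ}
    (h : t ∈ Set.Icc (f.left : ℝ) (f.left + 1)) : f.toFun t ≠ 0 := f.exists_left.choose_spec.2 t h

variable {S Q X : Type*}

lemma IsDelayBound.le_law_Ioo {M : SMP S} {A : DTA Q S X} {c : ℝ} (hc : IsDelayBound M A c)
    {s s' : S} {a b : ℝ} (ha : 0 ≤ a) (hb : b ≤ A.maxConst)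
    (h : ∀ t ∈ Set.Ioo a b, (M.delay s s').toFun t ≠ 0) :
    ENNReal.ofReal (c * (b - a)) ≤ (M.delay s s').law (Set.Ioo a b) := by
  refine (M.delay s s').le_law_Ioo hc.1.le ha fun t ht => ?_
  rcases (hc.2 s s').1 t ⟨ha.trans ht.1.le, ht.2.le.trans hb⟩ with h0 | h0
  · exact absurd h0 (h t ht)
  · exact h0.le

lemma IsDelayBound.lt_law_Ioo {M : SMP S} {A : DTA Q S X} {c : ℝ} (hc : IsDelayBound M A c)
    {s s' : S} {a b : ℝ} (ha : 0 ≤ a) (hab : a < b) (hb : b ≤ A.maxConst)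
    (h : ∀ t ∈ Set.Ioo a b, (M.delay s s').toFun t ≠ 0) :
    ENNReal.ofReal (c * (b - a)) < (M.delay s s').law (Set.Ioo a b) := by
  refine (M.delay s s').lt_law_Ioo hc.1.le ha hab fun t ht => ?_
  rcases (hc.2 s s').1 t ⟨ha.trans ht.1.le, ht.2.le.trans hb⟩ with h0 | h0
  · exact absurd h0 (h t ht)
  · exact h0

/-- The alternative that the tail integral vanishes is excluded: a density that is nonzero at the
non-integer `t` is nonzero on the whole unit interval around it, and this interval lies in the tail.
-/
lemma IsDelayBound.lt_law_Ioi {M : SMP S} {A : DTA Q S X} {c : ℝ} (hc : IsDelayBound M A c)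
    {s s' : S} {t : ℝ} (ht : A.maxConst ≤ ⌊t⌋₊) (hti : t ≠ ⌊t⌋₊)
    (h0 : 0 ≤ t) (h : (M.delay s s').toFun t ≠ 0) :
    ENNReal.ofReal c < (M.delay s s').law (Set.Ioi (A.maxConst : ℝ)) := by
  have h1 : (M.delay s s').law (Set.Ioi (A.maxConst : ℝ)) =
      (M.delay s s').law (Set.Ici (A.maxConst : ℝ)) := by
    refine le_antisymm (measure_mono Set.Ioi_subset_Ici_self) ?_
    rw [← Set.Ioi_union_left]
    refine (measure_union_le _ _).trans ?_
    rw [(M.delay s s').law_countable (Set.countable_singleton _), add_zero]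
  rw [h1]
  refine ((hc.2 s s').2).resolve_left fun h2 => ?_
  have hft : (⌊t⌋₊ : ℝ) < t := lt_of_le_of_ne (Nat.floor_le h0) hti.symm
  have hu := fun u hu => (M.delay s s').ne_zero_of_floor (u := u) h hft (Nat.lt_floor_add_one t) hu
  have h3 : (M.delay s s').law (Set.Icc (⌊t⌋₊ : ℝ) (⌊t⌋₊ + 1)) = 0 := by
    refine measure_mono_null (fun u hu => ?_) h2
    exact le_trans (by exact_mod_cast ht) hu.1
  have hsub : Set.Icc (⌊t⌋₊ : ℝ) (⌊t⌋₊ + 1) ⊆ Set.Ici 0 :=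
    fun u hu => Set.mem_Ici.2 (le_trans (Nat.cast_nonneg _) hu.1)
  have hm : Measurable fun t => ((M.delay s s').toFun t : ℝ≥0∞) :=
    measurable_coe_nnreal_ennreal.comp (M.delay s s').measurable_toFun
  rw [(M.delay s s').law_apply measurableSet_Icc, Set.inter_eq_left.2 hsub,
    setLIntegral_eq_zero_iff' measurableSet_Icc hm.aemeasurable] at h3
  have h4 : volume (Set.Icc (⌊t⌋₊ : ℝ) (⌊t⌋₊ + 1)) = 0 := by
    rw [measure_eq_zero_iff_ae_notMem]
    filter_upwards [h3] with u h5 h6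
    exact hu u h6 (by simpa using h5 h6)
  simp [Real.volume_Icc] at h4

lemma SMP.pMin_le [Fintype S] (M : SMP S) {s s' : S} (h : M.trans s s' ≠ 0) :
    ENNReal.ofReal M.pMin ≤ M.trans s s' := by
  rw [← ENNReal.ofReal_toReal ((M.trans s).apply_ne_top s')]
  refine ENNReal.ofReal_le_ofReal (csInf_le ⟨0, ?_⟩ ⟨s, s', h, rfl⟩)
  rintro r ⟨_, _, -, rfl⟩
  exact ENNReal.toReal_nonneg

lemma SMP.pMin_pos [Fintype S] [Nonempty S] (M : SMP S) : 0 < M.pMin := by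
  obtain ⟨s⟩ := ‹Nonempty S›
  have hfin : {r : ℝ | ∃ s s' : S, M.trans s s' ≠ 0 ∧ r = (M.trans s s').toReal}.Finite := by
    refine (Set.finite_range fun w : S × S => (M.trans w.1 w.2).toReal).subset ?_
    rintro r ⟨a, b, -, rfl⟩
    exact ⟨(a, b), rfl⟩
  obtain ⟨s', hs'⟩ := (M.trans s).support_nonempty
  have hne : {r : ℝ | ∃ s s' : S, M.trans s s' ≠ 0 ∧ r = (M.trans s s').toReal}.Nonempty :=
    ⟨_, s, s', hs', rfl⟩
  obtain ⟨a, b, h1, h2⟩ := hne.csInf_mem hfin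
  rw [SMP.pMin, h2]
  exact ENNReal.toReal_pos h1 ((M.trans a).apply_ne_top b)

lemma SMP.pMin_le_one [Fintype S] [Nonempty S] (M : SMP S) : M.pMin ≤ 1 := by
  obtain ⟨s⟩ := ‹Nonempty S›
  obtain ⟨s', hs'⟩ := (M.trans s).support_nonempty
  have := (M.pMin_le hs').trans ((M.trans s).coe_le_one s')
  rwa [ENNReal.ofReal_le_one] at this

lemma bound_mono [Fintype S] [Nonempty S] {M : SMP S} {A : DTA Q S X} {c : ℝ}
    (hc : IsDelayBound M A c) {w w' : ℝ} (h : w ≤ w') :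
    ENNReal.ofReal (M.pMin * (c * w)) ≤ ENNReal.ofReal (M.pMin * (c * w')) := by
  refine ENNReal.ofReal_le_ofReal ?_
  have := hc.1
  have := M.pMin_pos
  gcongr

end Delays

/-! ### Equivalent states take the same edge; regions after a move. -/

section RegionBasics

variable {S Q X : Type*} (A : DTA Q S X)

/-- The clocks that are reset by the edge taken from `z`. -/
noncomputable def DTA.resets (z : State S Q X) : Set X := (A.edgeAt z).reset

/-- The value of the clock `x` after the edge taken from `z`. -/
noncomputable def DTA.base (z : State S Q X) (x : X) : ℝ := (A.config z).2 x

variable {A}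

lemma base_reset {z : State S Q X} {x : X} (h : x ∈ A.resets z) : A.base z x = 0 := by
  have : x ∈ (A.edgeAt z).reset := h
  simp [DTA.base, DTA.config, resetClocks, this]

lemma base_of_notMem {z : State S Q X} {x : X} (h : x ∉ A.resets z) :
    A.base z x = z.2.2 x := by
  have : x ∉ (A.edgeAt z).reset := h
  simp [DTA.base, DTA.config, resetClocks, this]

lemma base_nonneg (z : State S Q X) (x : X) : 0 ≤ A.base z x := NNReal.coe_nonneg _

lemma moveTo_val (z : State S Q X) (s' : S) {t : ℝ} (ht : 0 ≤ t) (x : X) :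
    (((moveTo A z (s', t)).2.2 x : ℝ≥0) : ℝ) = A.base z x + t := by
  simp [moveTo, advance, DTA.base, Real.coe_toNNReal t ht]

lemma relevant_iff (v : Valuation X) (x : X) : A.Relevant v x ↔ (v x : ℝ) ≤ A.maxConst := by
  rw [DTA.Relevant, ← NNReal.coe_le_coe, NNReal.coe_natCast]

lemma le_maxConst {e : TAEdge Q S X} (he : e ∈ A.edges) {b : BasicConstraint X}
    (hb : b ∈ e.guard) : b.bound ≤ A.maxConst :=
  (Finset.le_sup (f := fun b : BasicConstraint X => b.bound) hb).trans
    (Finset.le_sup (f := fun e : TAEdge Q S X => e.guard.sup fun b => b.bound) he)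

lemma agreeInt_le {a b : ℝ} (h : AgreeInt a b) (n : ℕ) : a ≤ n → b ≤ n := by
  intro ha
  by_contra! hb
  have h1 : (n : ℤ) ≤ ⌊b⌋ := Int.le_floor.2 (by exact_mod_cast hb.le)
  have h2 : ⌊a⌋ ≤ n := by
    have := (Int.floor_le a).trans ha
    exact_mod_cast this
  have h3 : ⌊a⌋ = n := le_antisymm h2 (h.1 ▸ h1)
  have h4 : Int.fract a = 0 := by
    have := Int.floor_add_fract a
    rw [h3] at this
    have h5 := Int.fract_nonneg a
    push_cast at this
    linarith
  have h5 := h.2.1 h4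
  have := Int.floor_add_fract b
  rw [← h.1, h3, h5] at this
  push_cast at this
  linarith

lemma agreeInt_lt {a b : ℝ} (h : AgreeInt a b) (n : ℕ) : a < n → b < n := by
  intro ha
  have h1 : ⌊a⌋ < n := Int.floor_lt.2 (by exact_mod_cast ha)
  rw [h.1] at h1
  exact_mod_cast Int.floor_lt.1 h1

lemma AgreeInt.symm {a b : ℝ} (h : AgreeInt a b) : AgreeInt b a := ⟨h.1.symm, h.2.symm⟩

/-- Guards compare clocks only with integers up to `maxConst`, so the integral part and integrality
of relevant clocks decide them; an irrelevant clock exceeds all the constants. -/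
lemma sat_of_regionRel {z z' : State S Q X} (h : A.RegionRel z z') {e : TAEdge Q S X}
    (he : e ∈ A.edges) (hs : e.guard.Sat z.2.2) : e.guard.Sat z'.2.2 := by
  intro b hb
  have h1 := hs b hb
  have hle : (b.bound : ℝ≥0) ≤ A.maxConst := by exact_mod_cast le_maxConst he hb
  obtain ⟨-, -, h2, h3, -⟩ := h
  by_cases hr : A.Relevant z.2.2 b.clock
  · have ha := h3 _ hr
    rcases b with ⟨x, c, n⟩
    have cl : ∀ u : ℝ≥0, u ≤ n ↔ (u : ℝ) ≤ n := fun u => by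
      rw [← NNReal.coe_le_coe, NNReal.coe_natCast]
    have cl' : ∀ u : ℝ≥0, u < n ↔ (u : ℝ) < n := fun u => by
      rw [← NNReal.coe_lt_coe, NNReal.coe_natCast]
    cases c <;> simp only [Cmp.Holds] at h1 ⊢
    · rw [cl'] at h1 ⊢
      exact agreeInt_lt ha n h1
    · rw [cl] at h1 ⊢
      exact agreeInt_le ha n h1
    · rw [← not_le, cl] at h1 ⊢
      exact fun h => h1 (agreeInt_le ha.symm n h)
    · rw [← not_lt, cl'] at h1 ⊢
      exact fun h => h1 (agreeInt_lt ha.symm n h)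
  · have hr' : ¬ A.Relevant z'.2.2 b.clock := fun h => hr ((h2 _).2 h)
    have g1 : (b.bound : ℝ≥0) < z.2.2 b.clock := hle.trans_lt (not_le.1 hr)
    have g2 : (b.bound : ℝ≥0) < z'.2.2 b.clock := hle.trans_lt (not_le.1 hr')
    rcases b with ⟨x, c, n⟩
    cases c <;> simp only [Cmp.Holds] at h1 g1 g2 ⊢
    · exact absurd h1 (not_lt.2 g1.le)
    · exact absurd h1 (not_le.2 g1)
    · exact g2
    · exact g2.le

lemma edge_congr {z z' : State S Q X} (h : A.RegionRel z z') :
    A.resets z = A.resets z' ∧ (A.edgeAt z).tgt = (A.edgeAt z').tgt := by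
  obtain ⟨g1, g2, g3, g4⟩ := A.edgeAt_spec z
  obtain ⟨k1, k2, k3, k4⟩ := A.edgeAt_spec z'
  obtain ⟨-, h5, h6⟩ := A.deterministic _ g1 _ k1 (g2.trans (h.2.1.trans k2.symm))
    (g3.trans (h.1.trans k3.symm)) ⟨z'.2.2, sat_of_regionRel h g1 g4, k4⟩
  exact ⟨h5, h6⟩

/-- The valuations after the edges from equivalent states are equivalent. -/
lemma base_equiv {z z' : State S Q X} (h : A.RegionRel z z') :
    (∀ x, A.base z x ≤ A.maxConst ↔ A.base z' x ≤ A.maxConst) ∧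
    (∀ x, A.base z x ≤ A.maxConst → AgreeInt (A.base z x) (A.base z' x)) ∧
    (∀ x y, A.base z x ≤ A.maxConst → A.base z y ≤ A.maxConst →
      (Int.fract (A.base z x) ≤ Int.fract (A.base z y) ↔
        Int.fract (A.base z' x) ≤ Int.fract (A.base z' y))) := by
  have hr := (edge_congr h).1
  obtain ⟨-, -, h3, h4, h5⟩ := h
  simp only [relevant_iff] at h3 h4 h5
  have e : ∀ x, (x ∈ A.resets z ∧ A.base z x = 0 ∧ A.base z' x = 0) ∨
      (x ∉ A.resets z ∧ A.base z x = z.2.2 x ∧ A.base z' x = z'.2.2 x) := by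
    intro x
    by_cases hx : x ∈ A.resets z
    · exact Or.inl ⟨hx, base_reset hx, base_reset (hr ▸ hx)⟩
    · exact Or.inr ⟨hx, base_of_notMem hx, base_of_notMem (hr ▸ hx)⟩
  refine ⟨fun x => ?_, fun x hx => ?_, fun x y hx hy => ?_⟩
  · rcases e x with ⟨-, a, b⟩ | ⟨-, a, b⟩ <;> rw [a, b]
    exact h3 x
  · rcases e x with ⟨-, a, b⟩ | ⟨-, a, b⟩ <;> rw [a, b]
    · exact ⟨rfl, Iff.rfl⟩
    · exact h4 x (a ▸ hx)
  · rcases e x with ⟨-, a, b⟩ | ⟨-, a, b⟩ <;> rcases e y with ⟨-, a', b'⟩ | ⟨-, a', b'⟩ <;>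
      rw [a, b, a', b']
    · simp
    · have h1 := (h4 x (a ▸ hx)).2
      rw [Int.fract_zero]
      refine ⟨fun h => ?_, fun h => ?_⟩
      · exact (h1.1 (le_antisymm h (Int.fract_nonneg _))).le
      · exact (h1.2 (le_antisymm h (Int.fract_nonneg _))).le
    · exact h5 x y (a ▸ hx) (a' ▸ hy)

lemma regionRel_moveTo {z z' : State S Q X} (h : A.RegionRel z z') (s' : S) {t t' : ℝ}
    (ht : 0 ≤ t) (ht' : 0 ≤ t')
    (h1 : ∀ x, A.base z x + t ≤ A.maxConst ↔ A.base z' x + t' ≤ A.maxConst)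
    (h2 : ∀ x, A.base z x + t ≤ A.maxConst → AgreeInt (A.base z x + t) (A.base z' x + t'))
    (h3 : ∀ x y, A.base z x + t ≤ A.maxConst → A.base z y + t ≤ A.maxConst →
      (Int.fract (A.base z x + t) ≤ Int.fract (A.base z y + t) ↔
        Int.fract (A.base z' x + t') ≤ Int.fract (A.base z' y + t'))) :
    A.RegionRel (moveTo A z (s', t)) (moveTo A z' (s', t')) := by
  refine ⟨rfl, (edge_congr h).2, fun x => ?_, fun x => ?_, fun x y => ?_⟩
  · rw [relevant_iff, relevant_iff, moveTo_val _ _ ht, moveTo_val _ _ ht']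
    exact h1 x
  · rw [relevant_iff, moveTo_val _ _ ht, moveTo_val _ _ ht']
    exact h2 x
  · rw [relevant_iff, relevant_iff, moveTo_val _ _ ht, moveTo_val _ _ ht, moveTo_val _ _ ht',
      moveTo_val _ _ ht']
    exact h3 x y

/-- Moves that make all clocks irrelevant lead to equivalent states. -/
lemma regionRel_moveTo_of_gt {z z' : State S Q X} (h : A.RegionRel z z') (s' : S) {t t' : ℝ}
    (ht : A.maxConst < t) (ht' : A.maxConst < t') :
    A.RegionRel (moveTo A z (s', t)) (moveTo A z' (s', t')) := by
  have hB : (0 : ℝ) ≤ A.maxConst := Nat.cast_nonneg _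
  have g : ∀ x, ¬ A.base z x + t ≤ A.maxConst := fun x h => by
    have := base_nonneg (A := A) z x; linarith
  have g' : ∀ x, ¬ A.base z' x + t' ≤ A.maxConst := fun x h => by
    have := base_nonneg (A := A) z' x; linarith
  refine regionRel_moveTo h s' (hB.trans ht.le) (hB.trans ht'.le)
    (fun x => iff_of_false (g x) (g' x)) (fun x hx => absurd hx (g x))
    fun x y hx => absurd hx (g x)

end RegionBasics

/-! ### Gaps between fractional parts. -/

section Gaps

variable {S Q X : Type*}

/-- The fractional part of the clock `x`. -/
noncomputable def fr (z : State S Q X) (x : X) : ℝ := Int.fract (z.2.2 x : ℝ)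

/-- The fractional parts of the relevant clocks and the integers are at distance at least `δ`,
unless they are equal. -/
def DTA.Gap (A : DTA Q S X) (δ : ℝ) (z : State S Q X) : Prop :=
  ∀ x, A.Relevant z.2.2 x → (fr z x = 0 ∨ δ ≤ fr z x) ∧ fr z x ≤ 1 - δ ∧
    ∀ y, A.Relevant z.2.2 y → fr z x = fr z y ∨ fr z x + δ ≤ fr z y ∨ fr z y + δ ≤ fr z x

/-- The fractional parts of the relevant clocks and the integers are at distance at least `δ`,
and only fractional parts may be equal. -/
def DTA.Sep (A : DTA Q S X) (δ : ℝ) (z : State S Q X) : Prop :=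
  ∀ x, A.Relevant z.2.2 x → δ ≤ fr z x ∧ fr z x ≤ 1 - δ ∧
    ∀ y, A.Relevant z.2.2 y → fr z x = fr z y ∨ fr z x + δ ≤ fr z y ∨ fr z y + δ ≤ fr z x

lemma DTA.Sep.gap {A : DTA Q S X} {δ : ℝ} {z : State S Q X} (h : A.Sep δ z) : A.Gap δ z :=
  fun x hx => ⟨Or.inr (h x hx).1, (h x hx).2⟩

/-- The midpoint argument on the circle: let the fractional parts `f x` and `g x` be in the same
order, those of `g` with gaps `δ`. If no `f x + τ` is an integer, there is an interval of length
`δ` such that `g x` plus a point of the interval has the same integral part as `f x + τ`. -/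
lemma exists_arc {ι : Type*} [Finite ι] (f g : ι → ℝ) {τ δ : ℝ} (hδ : δ ≤ 1)
    (hτ : 0 < τ ∧ τ < 1)
    (hfg0 : ∀ i, f i = 0 ↔ g i = 0)
    (hfg : ∀ i j, f i ≤ f j ↔ g i ≤ g j)
    (hg : ∀ i, (g i = 0 ∨ δ ≤ g i) ∧ g i ≤ 1 - δ ∧
      ∀ j, g i = g j ∨ g i + δ ≤ g j ∨ g j + δ ≤ g i)
    (hne : ∀ i, f i + τ ≠ 1) :
    ∃ a, 0 ≤ a ∧ a + δ ≤ 1 ∧ ∀ i, (1 < f i + τ ∧ 1 ≤ g i + a) ∨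
      (f i + τ < 1 ∧ g i + a + δ ≤ 1) := by
  -- `a` is the time at which the last of the clocks that have to pass an integer reaches it, or `0`
  -- if there are none.
  have key : ∃ a, 0 ≤ a ∧ (a = 0 ∨ ∃ i, 1 < f i + τ ∧ a = 1 - g i) ∧
      ∀ i, 1 < f i + τ → 1 - g i ≤ a := by
    by_cases hL : {i | 1 < f i + τ}.Nonempty
    · obtain ⟨i, hi, hmax⟩ := Set.exists_max_image {i | 1 < f i + τ} (fun i => 1 - g i)
        (Set.toFinite _) hL
      by_cases hi1 : g i ≤ 1
      · exact ⟨1 - g i, by linarith, Or.inr ⟨i, hi, rfl⟩, hmax⟩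
      · exact ⟨0, le_rfl, Or.inl rfl, fun j hj => by
          have := hmax j hj; linarith⟩
    · exact ⟨0, le_rfl, Or.inl rfl, fun i hi => absurd ⟨i, hi⟩ hL⟩
  obtain ⟨a, ha0, ha1, ha2⟩ := key
  refine ⟨a, ha0, ?_, fun i => ?_⟩
  · rcases ha1 with rfl | ⟨i, hi, rfl⟩
    · linarith
    · rcases (hg i).1 with h | h
      · have := (hfg0 i).2 h
        linarith
      · linarith
  · rcases lt_or_gt_of_ne (hne i) with h | h
    · refine Or.inr ⟨h, ?_⟩
      rcases ha1 with rfl | ⟨j, hj, rfl⟩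
      · have := (hg i).2.1
        linarith
      -- A clock that must stay below the integer has a smaller fractional part than the clock `j`
      -- that defines `a`, and then it is smaller by at least `δ`.
      · have hlt : f i < f j := by linarith
        have h2 : ¬ g j ≤ g i := fun h => absurd ((hfg j i).2 h) (not_le.2 hlt)
        rcases (hg i).2.2 j with h3 | h3 | h3
        · exact absurd h3.ge h2
        · linarith
        · by_contra
          rcases le_or_gt δ 0 with h4 | h4
          · linarith [(hg i).2.1]
          · linarith
    · exact Or.inl ⟨h, by linarith [ha2 i h]⟩

lemma floor_fract_add {a t τ : ℝ} {k e : ℤ} (ht : t = k + τ) (h1 : e ≤ Int.fract a + τ)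
    (h2 : Int.fract a + τ < e + 1) :
    ⌊a + t⌋ = ⌊a⌋ + k + e ∧ Int.fract (a + t) = Int.fract a + τ - e := by
  have h3 := Int.floor_add_fract a
  have h4 : ⌊a + t⌋ = ⌊a⌋ + k + e := by
    rw [Int.floor_eq_iff]
    push_cast
    constructor <;> linarith
  refine ⟨h4, ?_⟩
  rw [Int.fract, h4]
  push_cast
  linarith

lemma le_natCast_iff_of_fract_ne {a : ℝ} (h : Int.fract a ≠ 0) (n : ℕ) :
    a ≤ n ↔ ⌊a⌋ < n := by
  constructor
  · intro ha
    rw [Int.floor_lt]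
    refine lt_of_le_of_ne (by exact_mod_cast ha) fun h' => h ?_
    rw [h']
    exact Int.fract_intCast _
  · intro ha
    exact_mod_cast (Int.floor_lt.1 ha).le

end Gaps

/-! ### One step of the region graph with control of the gaps. -/

section CoreStep

variable {S Q X : Type*} {A : DTA Q S X}

/-- A reset produces the fractional part `0`. This is why `DTA.Gap` admits `0`, unlike `DTA.Sep`,
which holds again after a suitable move. -/
lemma base_gap {δ : ℝ} {z : State S Q X} (hδ : δ ≤ 1) (h : A.Gap δ z) {x : X}
    (hx : A.base z x ≤ A.maxConst) :
    (Int.fract (A.base z x) = 0 ∨ δ ≤ Int.fract (A.base z x)) ∧ Int.fract (A.base z x) ≤ 1 - δ ∧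
    ∀ y, A.base z y ≤ A.maxConst → Int.fract (A.base z x) = Int.fract (A.base z y) ∨
      Int.fract (A.base z x) + δ ≤ Int.fract (A.base z y) ∨
      Int.fract (A.base z y) + δ ≤ Int.fract (A.base z x) := by
  have e : ∀ x, A.base z x ≤ A.maxConst → Int.fract (A.base z x) = 0 ∨
      (A.Relevant z.2.2 x ∧ Int.fract (A.base z x) = fr z x) := by
    intro x hx
    by_cases hr : x ∈ A.resets z
    · left
      rw [base_reset hr, Int.fract_zero]
    · right
      rw [base_of_notMem hr] at hx ⊢
      exact ⟨(relevant_iff _ _).2 hx, rfl⟩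
  rcases e x hx with h0 | ⟨h0, h1⟩
  · refine ⟨Or.inl h0, by rw [h0]; linarith, fun y hy => ?_⟩
    rcases e y hy with h2 | ⟨h2, h3⟩
    · exact Or.inl (h0.trans h2.symm)
    · rw [h0, h3]
      rcases (h y h2).1 with h4 | h4
      · exact Or.inl h4.symm
      · exact Or.inr (Or.inl (by linarith))
  · rw [h1]
    refine ⟨(h x h0).1, (h x h0).2.1, fun y hy => ?_⟩
    rcases e y hy with h2 | ⟨h2, h3⟩
    · rw [h2]
      rcases (h x h0).1 with h4 | h4
      · exact Or.inl h4
      · exact Or.inr (Or.inr (by linarith))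
    · rw [h3]
      exact (h x h0).2.2 y h2

/-- By `exists_arc` there is an interval of delays of length `δ`, in the same unit interval as `t`,
on which each relevant clock of `z'` passes the same integers as its counterpart in `z` does with
delay `t`. Clocks on the same side of the passage keep their distance and order. A clock that passed
and one that did not are `δ` apart, because fractional parts were at most `1 - δ`. -/
lemma exists_window [Finite X] {z z' : State S Q X} (h : A.RegionRel z z') {δ : ℝ} (hδ0 : 0 < δ)
    (hδ : δ ≤ 1) (hg : A.Gap δ z') (s' : S) {t : ℝ} (ht0 : 0 ≤ t)
    (hti : Int.fract t ≠ 0) (hgen : ∀ x, Int.fract (A.base z x + t) ≠ 0) :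
    ∃ a : ℝ, ⌊t⌋ ≤ a ∧ a + δ / 3 ≤ ⌊t⌋ + 1 ∧ ∀ t' ∈ Set.Ioo a (a + δ / 3),
      A.RegionRel (moveTo A z (s', t)) (moveTo A z' (s', t')) ∧
      A.Sep (δ / 3) (moveTo A z' (s', t')) := by
  obtain ⟨b1, b2, b3⟩ := base_equiv h
  let ι := {x // A.base z x ≤ A.maxConst}
  let f : ι → ℝ := fun i => Int.fract (A.base z i.1)
  let g : ι → ℝ := fun i => Int.fract (A.base z' i.1)
  have hτ : 0 < Int.fract t ∧ Int.fract t < 1 :=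
    ⟨lt_of_le_of_ne (Int.fract_nonneg t) hti.symm, Int.fract_lt_one t⟩
  have htk : t = ⌊t⌋ + Int.fract t := (Int.floor_add_fract t).symm
  obtain ⟨a, ha0, ha1, ha⟩ := exists_arc f g (τ := Int.fract t) hδ
    hτ (fun i => (b2 i.1 i.2).2)
    (fun i j => b3 i.1 j.1 i.2 j.2)
    (fun i => by
      have := base_gap hδ hg ((b1 i.1).1 i.2)
      exact ⟨this.1, this.2.1, fun j => this.2.2 j.1 ((b1 j.1).1 j.2)⟩)
    (fun i hi => by
      apply hgen i.1
      have h1 := Int.floor_add_fract (A.base z i.1)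
      have h2 : A.base z i.1 + t = ((⌊A.base z i.1⌋ + ⌊t⌋ + 1 : ℤ) : ℝ) := by
        have h3 : Int.fract (A.base z i.1) + Int.fract t = 1 := hi
        push_cast
        linarith
      rw [h2, Int.fract_intCast])
  -- The middle third of the interval is kept, so that clocks stay `δ / 3` away from the integers.
  refine ⟨⌊t⌋ + a + δ / 3, by linarith, by linarith, fun t' ht' => ?_⟩
  obtain ⟨τ', rfl⟩ : ∃ τ', t' = ⌊t⌋ + τ' := ⟨t' - ⌊t⌋, by ring⟩
  have hk0 : (0 : ℝ) ≤ ⌊t⌋ := by exact_mod_cast Int.floor_nonneg.2 ht0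
  have c1 : a + δ / 3 < τ' := by linarith [ht'.1]
  have c2 : τ' < a + δ / 3 + δ / 3 := by linarith [ht'.2]
  have ht'0 : 0 ≤ ⌊t⌋ + τ' := by linarith
  -- floors and fractional parts after the moves
  have key : ∀ x, A.base z x ≤ A.maxConst → ∃ e : ℤ, (e = 0 ∨ e = 1) ∧
      ⌊A.base z x + t⌋ = ⌊A.base z x⌋ + ⌊t⌋ + e ∧
      Int.fract (A.base z x + t) = Int.fract (A.base z x) + Int.fract t - e ∧
      ⌊A.base z' x + (⌊t⌋ + τ')⌋ = ⌊A.base z x⌋ + ⌊t⌋ + e ∧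
      Int.fract (A.base z' x + (⌊t⌋ + τ')) = Int.fract (A.base z' x) + τ' - e ∧
      δ / 3 ≤ Int.fract (A.base z' x) + τ' - e ∧
      Int.fract (A.base z' x) + τ' - e ≤ 1 - δ / 3 := by
    intro x hx
    have h0 := Int.fract_nonneg (A.base z x)
    have h0' := Int.fract_lt_one (A.base z x)
    have h1 := Int.fract_nonneg (A.base z' x)
    have h2 := (base_gap hδ hg ((b1 x).1 hx)).2.1
    rcases ha ⟨x, hx⟩ with ⟨h3, h4⟩ | ⟨h3, h4⟩
    · change 1 < Int.fract (A.base z x) + Int.fract t at h3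
      change 1 ≤ Int.fract (A.base z' x) + a at h4
      obtain ⟨d1, d2⟩ := floor_fract_add (a := A.base z x) (e := 1) htk (by push_cast; linarith)
        (by push_cast; linarith)
      obtain ⟨d3, d4⟩ := floor_fract_add (a := A.base z' x) (e := 1) (t := ⌊t⌋ + τ') rfl
        (by push_cast; linarith) (by push_cast; linarith)
      rw [← (b2 x hx).1] at d3
      exact ⟨1, Or.inr rfl, d1, d2, d3, d4, by push_cast; linarith, by push_cast; linarith⟩
    · change Int.fract (A.base z x) + Int.fract t < 1 at h3
      change Int.fract (A.base z' x) + a + δ ≤ 1 at h4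
      obtain ⟨d1, d2⟩ := floor_fract_add (a := A.base z x) (e := 0) htk (by push_cast; linarith)
        (by push_cast; linarith)
      obtain ⟨d3, d4⟩ := floor_fract_add (a := A.base z' x) (e := 0) (t := ⌊t⌋ + τ') rfl
        (by push_cast; linarith) (by push_cast; linarith)
      rw [← (b2 x hx).1] at d3
      exact ⟨0, Or.inl rfl, d1, d2, d3, d4, by push_cast; linarith, by push_cast; linarith⟩
  have irr : ∀ x, ¬ A.base z x ≤ A.maxConst → ¬ A.base z x + t ≤ A.maxConst ∧
      ¬ A.base z' x + (⌊t⌋ + τ') ≤ A.maxConst := by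
    intro x hx
    have hx' : ¬ A.base z' x ≤ A.maxConst := fun h => hx ((b1 x).2 h)
    exact ⟨fun h => hx (by linarith), fun h => hx' (by linarith)⟩
  have hrel : ∀ x, A.base z x + t ≤ A.maxConst ↔ A.base z' x + (⌊t⌋ + τ') ≤ A.maxConst := by
    intro x
    by_cases hx : A.base z x ≤ A.maxConst
    · obtain ⟨e, -, d1, d2, d3, d4, d5, d6⟩ := key x hx
      rw [le_natCast_iff_of_fract_ne (hgen x), le_natCast_iff_of_fract_ne (by rw [d4]; linarith),
        d1, d3]
    · exact iff_of_false (irr x hx).1 (irr x hx).2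
  have hrb : ∀ x, A.base z x + t ≤ A.maxConst → A.base z x ≤ A.maxConst :=
    fun x hx => by linarith
  refine ⟨regionRel_moveTo h s' ht0 ht'0 hrel (fun x hx => ?_) (fun x y hx hy => ?_),
    fun x hx => ?_⟩
  · obtain ⟨e, -, d1, d2, d3, d4, d5, d6⟩ := key x (hrb x hx)
    exact ⟨d1.trans d3.symm, iff_of_false (hgen x) (by rw [d4]; linarith)⟩
  · obtain ⟨e, he, d1, d2, d3, d4, d5, d6⟩ := key x (hrb x hx)
    obtain ⟨e', he', k1, k2, k3, k4, k5, k6⟩ := key y (hrb y hy)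
    have b4 := b3 x y (hrb x hx) (hrb y hy)
    rw [d2, k2, d4, k4]
    have i1 := Int.fract_lt_one (A.base z x)
    have i2 := Int.fract_lt_one (A.base z y)
    have i3 := Int.fract_lt_one (A.base z' x)
    have i4 := Int.fract_lt_one (A.base z' y)
    have j1 := Int.fract_nonneg (A.base z x)
    have j2 := Int.fract_nonneg (A.base z y)
    have j3 := Int.fract_nonneg (A.base z' x)
    have j4 := Int.fract_nonneg (A.base z' y)
    rcases he with rfl | rfl <;> rcases he' with rfl | rfl <;> push_cast
    · constructor <;> intro h
      · linarith [b4.1 (by linarith)]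
      · linarith [b4.2 (by linarith)]
    · constructor <;> intro h <;> linarith
    · constructor <;> intro h <;> linarith
    · constructor <;> intro h
      · linarith [b4.1 (by linarith)]
      · linarith [b4.2 (by linarith)]
  · have conv : ∀ x, A.Relevant (moveTo A z' (s', ⌊t⌋ + τ')).2.2 x → A.base z x ≤ A.maxConst := by
      intro x hx
      rw [relevant_iff, moveTo_val _ _ ht'0] at hx
      exact hrb x ((hrel x).2 hx)
    have hfr : ∀ x, fr (moveTo A z' (s', ⌊t⌋ + τ')) x =
        Int.fract (A.base z' x + (⌊t⌋ + τ')) := fun x => by rw [fr, moveTo_val _ _ ht'0]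
    obtain ⟨e, he, d1, d2, d3, d4, d5, d6⟩ := key x (conv x hx)
    refine ⟨by rw [hfr, d4]; linarith, by rw [hfr, d4]; linarith, fun y hy => ?_⟩
    obtain ⟨e', he', k1, k2, k3, k4, k5, k6⟩ := key y (conv y hy)
    rw [hfr, hfr, d4, k4]
    have g1 := base_gap hδ hg ((b1 x).1 (conv x hx))
    have g2 := base_gap hδ hg ((b1 y).1 (conv y hy))
    have g3 := g1.2.2 y ((b1 y).1 (conv y hy))
    have j3 := Int.fract_nonneg (A.base z' x)
    have j4 := Int.fract_nonneg (A.base z' y)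
    rcases he with rfl | rfl <;> rcases he' with rfl | rfl <;> push_cast
    · rcases g3 with g3 | g3 | g3
      · exact Or.inl (by linarith)
      · exact Or.inr (Or.inl (by linarith))
      · exact Or.inr (Or.inr (by linarith))
    · exact Or.inr (Or.inr (by linarith [g2.2.1]))
    · exact Or.inr (Or.inl (by linarith [g1.2.1]))
    · rcases g3 with g3 | g3 | g3
      · exact Or.inl (by linarith)
      · exact Or.inr (Or.inl (by linarith))
      · exact Or.inr (Or.inr (by linarith))

variable [Finite X] [Fintype S] {M : SMP S} {c : ℝ}

lemma ofReal_mul_le [Nonempty S] (M : SMP S) {s s' : S} (h : M.trans s s' ≠ 0) {w : ℝ}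
    {m : ℝ≥0∞} (hw : ENNReal.ofReal w ≤ m) :
    ENNReal.ofReal (M.pMin * w) ≤ M.trans s s' * m := by
  rw [ENNReal.ofReal_mul M.pMin_pos.le]
  gcongr
  exact M.pMin_le h

lemma floor_natCast_eq {t : ℝ} (h : 0 ≤ t) : ((⌊t⌋ : ℤ) : ℝ) = (⌊t⌋₊ : ℝ) := by
  have := Int.natCast_floor_eq_floor h
  exact_mod_cast this.symm

/-- The region reached by a generic move from `z` is reached from all states equivalent to `z`,
with a probability that is bounded below in terms of the gaps. -/
lemma le_moveLaw_of_generic [MeasurableSpace S] (hc : IsDelayBound M A c) {z z' : State S Q X}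
    (h : A.RegionRel z z') {δ : ℝ} (hδ0 : 0 < δ) (hδ : δ ≤ 1) (hg : A.Gap δ z') {s' : S}
    (hs' : M.trans z.1 s' ≠ 0) {t : ℝ} (ht0 : 0 ≤ t) (hft : (M.delay z.1 s').toFun t ≠ 0)
    (hti : Int.fract t ≠ 0) (hgen : ∀ x, Int.fract (A.base z x + t) ≠ 0) :
    ENNReal.ofReal (M.pMin * (c * (δ / 3))) ≤ moveLaw M z'.1
      {y | A.RegionRel (moveTo A z (s', t)) (moveTo A z' y) ∧ A.Sep (δ / 3) (moveTo A z' y)} := by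
  have : Nonempty S := ⟨s'⟩
  have hnf : t ≠ ⌊t⌋₊ := fun h => hti (by rw [h]; exact Int.fract_natCast _)
  have hlt : (⌊t⌋₊ : ℝ) < t := lt_of_le_of_ne (Nat.floor_le ht0) hnf.symm
  rw [h.1] at hs' hft
  rcases lt_or_ge t A.maxConst with htB | htB
  · obtain ⟨a, ha1, ha2, ha⟩ := exists_window h hδ0 hδ hg s' ht0 hti hgen
    rw [floor_natCast_eq ht0] at ha1 ha2
    have hk : ⌊t⌋₊ < A.maxConst := by exact_mod_cast hlt.trans htB
    have hk' : (⌊t⌋₊ : ℝ) + 1 ≤ A.maxConst := by exact_mod_cast hk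
    have ha0 : 0 ≤ a := (Nat.cast_nonneg _).trans ha1
    have hlaw := hc.le_law_Ioo (s := z'.1) (s' := s') (a := a) (b := a + δ / 3) ha0
      (ha2.trans hk') fun u hu => (M.delay z'.1 s').ne_zero_of_floor hft hlt
        (Nat.lt_floor_add_one t) ⟨ha1.trans hu.1.le, hu.2.le.trans ha2⟩
    rw [add_sub_cancel_left] at hlaw
    exact (ofReal_mul_le M hs' hlaw).trans (le_moveLaw M z'.1 s' _ _ ha)
  -- Here all clocks become irrelevant, so every delay above `maxConst` gives the same region and
  -- the gap condition is void.
  · have hk : A.maxConst ≤ ⌊t⌋₊ := Nat.le_floor htB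
    have htB' : (A.maxConst : ℝ) < t := lt_of_le_of_lt (by exact_mod_cast hk) hlt
    have hlaw := hc.lt_law_Ioi hk hnf ht0 hft
    have hle : ENNReal.ofReal (c * (δ / 3)) ≤
        (M.delay z'.1 s').law (Set.Ioi (A.maxConst : ℝ)) := by
      refine le_trans (ENNReal.ofReal_le_ofReal ?_) hlaw.le
      have := hc.1
      nlinarith
    refine (ofReal_mul_le M hs' hle).trans (le_moveLaw M z'.1 s' _ _ fun u hu => ?_)
    have hu : (A.maxConst : ℝ) < u := hu
    have hu0 : 0 ≤ u := (Nat.cast_nonneg _).trans hu.le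
    refine ⟨regionRel_moveTo_of_gt h s' htB' hu, fun x hx => ?_⟩
    rw [relevant_iff, moveTo_val _ _ hu0] at hx
    have := base_nonneg (A := A) z' x
    linarith

omit [Fintype S] in
-- A single state has some gap. Without uniformity this serves only to show that probabilities are
-- positive.
lemma exists_gap (z : State S Q X) : ∃ δ, 0 < δ ∧ δ ≤ 1 ∧ A.Gap δ z := by
  classical
  have := Fintype.ofFinite X
  let F : Finset ℝ := (Finset.univ.image fun x => if fr z x = 0 then 1 else fr z x) ∪
    (Finset.univ.image fun x => 1 - fr z x) ∪
    (Finset.univ.image fun w : X × X => if fr z w.1 = fr z w.2 then 1 else |fr z w.1 - fr z w.2|) ∪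
    {1}
  have hF : F.Nonempty := ⟨1, by simp [F]⟩
  have hpos : ∀ r ∈ F, 0 < r := by
    intro r hr
    simp only [F, Finset.mem_union, Finset.mem_image, Finset.mem_univ, true_and,
      Finset.mem_singleton] at hr
    rcases hr with ((⟨x, rfl⟩ | ⟨x, rfl⟩) | ⟨w, rfl⟩) | rfl
    · split_ifs with h
      · exact one_pos
      · exact lt_of_le_of_ne (Int.fract_nonneg _) (Ne.symm h)
    · exact sub_pos.2 (Int.fract_lt_one _)
    · split_ifs with h
      · exact one_pos
      · exact abs_pos.2 (sub_ne_zero.2 h)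
    · exact one_pos
  have hle : ∀ r ∈ F, F.min' hF ≤ r := fun r hr => F.min'_le r hr
  refine ⟨F.min' hF, hpos _ (F.min'_mem hF), hle 1 (by simp [F]), fun x _ =>
    ⟨?_, ?_, fun y _ => ?_⟩⟩
  · by_cases h : fr z x = 0
    · exact Or.inl h
    · right
      have := hle (if fr z x = 0 then 1 else fr z x) (by simp [F])
      rwa [if_neg h] at this
  · have := hle (1 - fr z x) (by simp [F])
    linarith
  · by_cases h : fr z x = fr z y
    · exact Or.inl h
    · right
      have := hle (if fr z x = fr z y then 1 else |fr z x - fr z y|)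
        (by simp only [F, Finset.mem_union, Finset.mem_image, Finset.mem_univ, true_and]
            exact Or.inl (Or.inr ⟨(x, y), rfl⟩))
      rw [if_neg h] at this
      rcases le_total (fr z x) (fr z y) with h1 | h1
      · rw [abs_of_nonpos (by linarith)] at this
        exact Or.inl (by linarith)
      · rw [abs_of_nonneg (by linarith)] at this
        exact Or.inr (by linarith)

omit [Fintype S] in
lemma countable_nongeneric (z : State S Q X) :
    {t : ℝ | Int.fract t = 0 ∨ ∃ x, Int.fract (A.base z x + t) = 0}.Countable := by
  have h0 : ∀ a : ℝ, {t : ℝ | Int.fract (a + t) = 0}.Countable := by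
    intro a
    refine (Set.countable_range fun n : ℤ => (n : ℝ) - a).mono fun t ht => ?_
    obtain ⟨n, hn⟩ := Int.fract_eq_zero_iff.1 ht
    exact ⟨n, by simp only [hn]; ring⟩
  have h1 := (h0 0).union (Set.countable_iUnion fun x => h0 (A.base z x))
  refine h1.mono ?_
  rintro t (ht | ⟨x, hx⟩)
  · left
    simpa using ht
  · exact Or.inr (Set.mem_iUnion.2 ⟨x, hx⟩)

end CoreStep

/-! ### Edges of the region graph and the classes visited by the process. -/

section RegionGraph

variable {S Q X : Type*} {A : DTA Q S X}

/-- The region of a state. -/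
abbrev DTA.reg (A : DTA Q S X) (z : State S Q X) : A.Region := Quotient.mk A.regionSetoid z

lemma reg_eq {z z' : State S Q X} : A.reg z = A.reg z' ↔ A.RegionRel z z' :=
  ⟨fun h => Quotient.exact h, fun h => Quotient.sound h⟩

lemma mem_stateSpace {V : Set A.Region} {z : State S Q X} : z ∈ A.stateSpace V ↔ A.reg z ∈ V :=
  Iff.rfl

lemma mem_stateSpace_singleton {R : A.Region} {z : State S Q X} :
    z ∈ A.stateSpace {R} ↔ A.reg z = R := Iff.rfl

variable [Fintype S] [Finite Q] [Finite X]
  [MeasurableSpace S] [DiscreteMeasurableSpace S]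
  [MeasurableSpace Q] [DiscreteMeasurableSpace Q]
  {M : SMP S} {c : ℝ}

lemma exists_move_of_pos {z : State S Q X} {R : A.Region}
    (h : productKernel M A z (A.stateSpace {R}) ≠ 0) :
    ∃ (s' : S) (t : ℝ), M.trans z.1 s' ≠ 0 ∧ 0 ≤ t ∧ (M.delay z.1 s').toFun t ≠ 0 ∧
      Int.fract t ≠ 0 ∧ (∀ x, Int.fract (A.base z x + t) ≠ 0) ∧
      A.reg (moveTo A z (s', t)) = R := by
  have hm := A.measurableSet_stateSpace {R}
  rw [productKernel_apply, Measure.map_apply (measurable_moveTo_right A z) hm,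
    moveLaw_apply _ _ (measurable_moveTo_right A z hm)] at h
  obtain ⟨s', -, hs'⟩ := Finset.exists_ne_zero_of_sum_ne_zero h
  obtain ⟨t, h1, h2, h3, h4⟩ := (M.delay z.1 s').exists_mem_of_law_pos
    (measurable_prodMk_left (measurable_moveTo_right A z hm)) (countable_nongeneric (A := A) z)
    (right_ne_zero_of_mul hs')
  simp only [Set.mem_ofPred_eq, not_or, not_exists] at h4
  exact ⟨s', t, left_ne_zero_of_mul hs', h2, h3, h4.1, h4.2, h1⟩

/-- An edge of the region graph is taken, with a new gap of a third of the old one, with a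
probability that is bounded below in terms of the gap. -/
lemma le_productKernel_of_pos (hc : IsDelayBound M A c) {z₀ z : State S Q X} {R : A.Region}
    (h : productKernel M A z₀ (A.stateSpace {R}) ≠ 0) (hz : A.reg z₀ = A.reg z) {δ : ℝ}
    (hδ0 : 0 < δ) (hδ : δ ≤ 1) (hg : A.Gap δ z) :
    ENNReal.ofReal (M.pMin * (c * (δ / 3))) ≤ moveLaw M z.1
      {y | moveTo A z y ∈ A.stateSpace {R} ∩ {w | A.Sep (δ / 3) w}} := by
  obtain ⟨s', t, h1, h2, h3, h4, h5, h6⟩ := exists_move_of_pos h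
  refine (le_moveLaw_of_generic hc (reg_eq.1 hz) hδ0 hδ hg h1 h2 h3 h4 h5).trans
    (measure_mono ?_)
  rintro y ⟨h7, h8⟩
  exact ⟨(reg_eq.2 h7).symm.trans h6, h8⟩

/-- So whether there is an edge does not depend on the state chosen in the region. -/
lemma pos_of_reg_eq (hc : IsDelayBound M A c) {z₀ z : State S Q X} {R : A.Region}
    (h : productKernel M A z₀ (A.stateSpace {R}) ≠ 0) (hz : A.reg z₀ = A.reg z) :
    productKernel M A z (A.stateSpace {R}) ≠ 0 := by
  have : Nonempty S := ⟨z.1⟩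
  obtain ⟨δ, h1, h2, h3⟩ := exists_gap (A := A) z
  have := le_productKernel_of_pos hc h hz h1 h2 h3
  refine (lt_of_lt_of_le (ENNReal.ofReal_pos.2 ?_)
    (this.trans ((measure_mono fun y hy => hy.1).trans
    (le_productKernel M A z _)))).ne'
  have := hc.1
  have := M.pMin_pos
  positivity

variable {μ : Measure (State S Q X)}

lemma vertices_closed (hc : IsDelayBound M A c) {z : State S Q X} {R : A.Region}
    (hz : A.reg z ∈ vertices M A μ) (h : productKernel M A z (A.stateSpace {R}) ≠ 0) :
    R ∈ vertices M A μ := by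
  obtain ⟨n, hn⟩ := hz
  refine ⟨n + 1, ?_⟩
  have hm := A.measurableSet_stateSpace {R}
  have hm' := A.measurableSet_stateSpace {A.reg z}
  have hcomp : μ.bind (productKernel M A ^ (n + 1)) =
      (μ.bind (productKernel M A ^ n)).bind (productKernel M A) := by
    rw [Measure.comp_assoc, pow_succ']
    rfl
  rw [hcomp, pos_iff_ne_zero, Measure.bind_apply hm (Kernel.aemeasurable _)]
  intro h0
  rw [lintegral_eq_zero_iff (Kernel.measurable_coe _ hm)] at h0
  refine hn.ne' (measure_mono_null (fun y hy => ?_) h0)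
  exact pos_of_reg_eq hc h (mem_stateSpace_singleton.1 hy).symm

lemma regionEdge_of_pos (hc : IsDelayBound M A c) {z : State S Q X} {R : A.Region}
    (hz : A.reg z ∈ vertices M A μ) (h : productKernel M A z (A.stateSpace {R}) ≠ 0) :
    regionEdge M A μ (A.reg z) R :=
  ⟨hz, vertices_closed hc hz h, z, rfl, pos_iff_ne_zero.2 h⟩

omit [DiscreteMeasurableSpace S] [DiscreteMeasurableSpace Q] in
/-- A measure that charges no region outside `V` is concentrated on the union of `V`. -/
lemma measure_compl_stateSpace {ν : Measure (State S Q X)} {V : Set A.Region}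
    (h : ∀ R, ν (A.stateSpace {R}) ≠ 0 → R ∈ V) : ν (A.stateSpace V)ᶜ = 0 := by
  have : (A.stateSpace V)ᶜ ⊆ ⋃ R ∈ Vᶜ, A.stateSpace {R} := by
    intro z hz
    exact Set.mem_iUnion₂.2 ⟨A.reg z, hz, rfl⟩
  refine measure_mono_null this ((measure_biUnion_null_iff (Set.toFinite _).countable).2 ?_)
  intro R hR
  by_contra hne
  exact hR (h R hne)

omit [DiscreteMeasurableSpace S] [DiscreteMeasurableSpace Q] in
lemma exists_region_of_ne_zero {ν : Measure (State S Q X)} (h : ν Set.univ ≠ 0) :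
    ∃ R : A.Region, ν (A.stateSpace {R}) ≠ 0 := by
  by_contra! hne
  have := measure_compl_stateSpace (ν := ν) (A := A) (V := ∅) fun R hR => absurd (hne R) hR
  have h2 : (A.stateSpace (∅ : Set A.Region))ᶜ = Set.univ := by
    ext z; simp [DTA.stateSpace]
  exact h (h2 ▸ this)

lemma vertices_nonempty [IsProbabilityMeasure μ] : (vertices M A μ).Nonempty := by
  obtain ⟨R, hR⟩ := exists_region_of_ne_zero (A := A) (ν := μ) (by simp)
  refine ⟨R, 0, ?_⟩
  rw [pow_zero]
  have : μ.bind (1 : Kernel (State S Q X) (State S Q X)) = μ := by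
    change μ.bind Kernel.id = μ
    exact Measure.bind_dirac
  rw [this]
  exact pos_iff_ne_zero.2 hR

lemma niceGraph (hc : IsDelayBound M A c)
    (hconn : StronglyConnected (vertices M A μ) (regionEdge M A μ)) :
    NiceGraph (vertices M A μ) (regionEdge M A μ) where
  finite := Set.toFinite _
  left_mem h := h.1
  right_mem h := h.2.1
  conn := hconn
  out := by
    intro R hR
    obtain ⟨z, rfl⟩ := Quotient.exists_rep R
    obtain ⟨R', hR'⟩ := exists_region_of_ne_zero (A := A) (ν := productKernel M A z) (by simp)
    exact ⟨R', regionEdge_of_pos hc hR hR'⟩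

lemma pos_of_regionEdge (hc : IsDelayBound M A c) {z : State S Q X} {R : A.Region}
    (h : regionEdge M A μ (A.reg z) R) : productKernel M A z (A.stateSpace {R}) ≠ 0 := by
  obtain ⟨-, -, z₀, h1, h2⟩ := h
  exact pos_of_reg_eq hc h2.ne' h1

/-- Edges of the region graph are taken with a probability that is bounded below. -/
lemma le_moveLaw_of_regionEdge (hc : IsDelayBound M A c) {z : State S Q X} {R : A.Region}
    (h : regionEdge M A μ (A.reg z) R) {δ : ℝ} (hδ0 : 0 < δ) (hδ : δ ≤ 1) (hg : A.Gap δ z) :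
    ENNReal.ofReal (M.pMin * (c * (δ / 3))) ≤ moveLaw M z.1
      {y | moveTo A z y ∈ A.stateSpace {R} ∩ {w | A.Sep (δ / 3) w}} :=
  le_productKernel_of_pos hc (pos_of_regionEdge hc h) rfl hδ0 hδ hg

/-- In a strongly connected graph each vertex has a predecessor, and it is entered from there by a
generic move, after which no clock is an integer. -/
lemma fr_ne_zero (hc : IsDelayBound M A c)
    (hconn : StronglyConnected (vertices M A μ) (regionEdge M A μ)) {z : State S Q X}
    (hz : A.reg z ∈ vertices M A μ) {x : X} (hx : A.Relevant z.2.2 x) : fr z x ≠ 0 := by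
  obtain ⟨R, hR⟩ := (niceGraph hc hconn).exists_pred hz
  obtain ⟨-, -, z₀, -, h2⟩ := hR
  obtain ⟨s', t, -, ht, -, -, h5, h6⟩ := exists_move_of_pos h2.ne'
  have hrel := reg_eq.1 h6
  intro h0
  have hx' := (hrel.2.2.1 x).2 hx
  have := (hrel.2.2.2.1 x hx').2.2 h0
  rw [moveTo_val _ _ ht] at this
  exact h5 x this

variable {p : ℕ} {W : Fin p → Set A.Region}

lemma productKernel_cls (hc : IsDelayBound M A c)
    (hW : IsCyclicDecomposition (vertices M A μ) (regionEdge M A μ) p W) {i : ℕ}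
    {z : State S Q X} (hz : A.reg z ∈ cls W i) :
    productKernel M A z (A.stateSpace (cls W (i + 1)))ᶜ = 0 :=
  measure_compl_stateSpace fun _ hR =>
    cls_edge hW hz (regionEdge_of_pos hc (cls_subset hW _ hz) hR)

lemma moveLaw_cls (hc : IsDelayBound M A c)
    (hW : IsCyclicDecomposition (vertices M A μ) (regionEdge M A μ) p W) {i : ℕ}
    {z : State S Q X} (hz : A.reg z ∈ cls W i) :
    moveLaw M z.1 {y | A.reg (moveTo A z y) ∉ cls W (i + 1)} = 0 := by
  have := productKernel_cls hc hW hz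
  rw [productKernel_apply, Measure.map_apply (measurable_moveTo_right A z)
    (A.measurableSet_stateSpace _).compl] at this
  exact this

lemma pow_productKernel_cls (hc : IsDelayBound M A c)
    (hW : IsCyclicDecomposition (vertices M A μ) (regionEdge M A μ) p W) (n : ℕ) {i : ℕ}
    {z : State S Q X} (hz : A.reg z ∈ cls W i) :
    (productKernel M A ^ n) z (A.stateSpace (cls W (i + n)))ᶜ = 0 := by
  induction n generalizing i z with
  | zero =>
    rw [pow_zero]
    change Kernel.id z _ = 0
    rw [Kernel.id_apply, Measure.dirac_apply' _ (A.measurableSet_stateSpace _).compl]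
    simpa [mem_stateSpace] using hz
  | succ n ih =>
    have hm := (A.measurableSet_stateSpace (cls W (i + (n + 1)))).compl
    rw [lintegral_pow_succ _ _ _ hm, lintegral_eq_zero_iff (Kernel.measurable_coe _ hm)]
    have h1 := measure_eq_zero_iff_ae_notMem.1 (productKernel_cls hc hW hz)
    filter_upwards [h1] with y hy
    have hy' : A.reg y ∈ cls W (i + 1) := by simpa [mem_stateSpace] using hy
    have := ih hy'
    rwa [Nat.add_assoc, Nat.add_comm 1] at this

omit [Fintype S] [Finite Q] [DiscreteMeasurableSpace S] [DiscreteMeasurableSpace Q] in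
lemma measurableSet_sep (δ : ℝ) : MeasurableSet {z : State S Q X | A.Sep δ z} := by
  have hv : ∀ x, Measurable fun z : State S Q X => z.2.2 x := fun x =>
    (measurable_pi_apply x).comp (measurable_snd.comp measurable_snd)
  have hf : ∀ x, Measurable fun z : State S Q X => fr z x := fun x =>
    measurable_fract.comp (measurable_coe_nnreal_real.comp (hv x))
  have hr : ∀ x, Measurable fun z : State S Q X => A.Relevant z.2.2 x := fun x =>
    measurableSet_setOfPred.1 (measurableSet_le (hv x) measurable_const)
  refine measurableSet_setOfPred.2 (Measurable.forall fun x => (hr x).imp (Measurable.and ?_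
    (Measurable.and ?_ (Measurable.forall fun y => (hr y).imp (Measurable.or ?_
      (Measurable.or ?_ ?_))))))
  · exact measurableSet_setOfPred.1 (measurableSet_le measurable_const (hf x))
  · exact measurableSet_setOfPred.1 (measurableSet_le (hf x) measurable_const)
  · exact measurableSet_setOfPred.1 (measurableSet_eq_fun (hf x) (hf y))
  · exact measurableSet_setOfPred.1 (measurableSet_le ((hf x).add_const δ) (hf y))
  · exact measurableSet_setOfPred.1 (measurableSet_le ((hf y).add_const δ) (hf x))

end RegionGraph

/-! ### States that differ only in irrelevant clocks. -/

section Agreement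

variable {S Q X : Type*} {A : DTA Q S X}

lemma DTA.Sep.mono {δ δ' : ℝ} {z : State S Q X} (h : A.Sep δ z) (hδ : δ' ≤ δ) : A.Sep δ' z := by
  intro x hx
  obtain ⟨h1, h2, h3⟩ := h x hx
  refine ⟨by linarith, by linarith, fun y hy => ?_⟩
  rcases h3 y hy with h4 | h4 | h4
  · exact Or.inl h4
  · exact Or.inr (Or.inl (by linarith))
  · exact Or.inr (Or.inr (by linarith))

/-- The states differ at most in the values of irrelevant clocks. -/
def DTA.Agree (A : DTA Q S X) (z z' : State S Q X) : Prop :=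
  z.1 = z'.1 ∧ z.2.1 = z'.2.1 ∧
    ∀ x, z.2.2 x = z'.2.2 x ∨ (¬ A.Relevant z.2.2 x ∧ ¬ A.Relevant z'.2.2 x)

lemma DTA.Agree.symm {z z' : State S Q X} (h : A.Agree z z') : A.Agree z' z :=
  ⟨h.1.symm, h.2.1.symm, fun x => (h.2.2 x).imp Eq.symm And.symm⟩

lemma DTA.Agree.refl (z : State S Q X) : A.Agree z z := ⟨rfl, rfl, fun _ => Or.inl rfl⟩

lemma DTA.Agree.eq_of_relevant {z z' : State S Q X} (h : A.Agree z z') {x : X}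
    (hx : A.Relevant z.2.2 x) : z.2.2 x = z'.2.2 x :=
  (h.2.2 x).resolve_right fun h => h.1 hx

lemma DTA.Agree.relevant_iff {z z' : State S Q X} (h : A.Agree z z') (x : X) :
    A.Relevant z.2.2 x ↔ A.Relevant z'.2.2 x := by
  rcases h.2.2 x with h1 | h1
  · rw [DTA.Relevant, DTA.Relevant, h1]
  · exact iff_of_false h1.1 h1.2

lemma DTA.Agree.regionRel {z z' : State S Q X} (h : A.Agree z z') : A.RegionRel z z' := by
  refine ⟨h.1, h.2.1, h.relevant_iff, fun x hx => ?_, fun x y hx hy => ?_⟩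
  · rw [h.eq_of_relevant hx]
    exact ⟨rfl, Iff.rfl⟩
  · rw [h.eq_of_relevant hx, h.eq_of_relevant hy]

lemma DTA.Agree.sep {z z' : State S Q X} (h : A.Agree z z') {δ : ℝ} (hs : A.Sep δ z) :
    A.Sep δ z' := by
  have hf : ∀ x, A.Relevant z'.2.2 x → A.Relevant z.2.2 x ∧ fr z' x = fr z x := fun x hx => by
    have hx' := (h.relevant_iff x).2 hx
    exact ⟨hx', by rw [fr, fr, h.eq_of_relevant hx']⟩
  intro x hx
  obtain ⟨h1, h2⟩ := hf x hx
  rw [h2]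
  refine ⟨(hs x h1).1, (hs x h1).2.1, fun y hy => ?_⟩
  rw [(hf y hy).2]
  exact (hs x h1).2.2 y (hf y hy).1

lemma moveTo_apply (z : State S Q X) (y : S × ℝ) (x : X) :
    (x ∈ A.resets z → (moveTo A z y).2.2 x = y.2.toNNReal) ∧
    (x ∉ A.resets z → (moveTo A z y).2.2 x = z.2.2 x + y.2.toNNReal) := by
  constructor <;> intro h
  · have : x ∈ (A.edgeAt z).reset := h
    simp [moveTo, advance, DTA.config, resetClocks, this]
  · have : x ∉ (A.edgeAt z).reset := h
    simp [moveTo, advance, DTA.config, resetClocks, this]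

/-- The same edge is taken; an irrelevant clock either stays irrelevant or is reset, and then its
values coincide. -/
lemma DTA.Agree.moveTo {z z' : State S Q X} (h : A.Agree z z') (y : S × ℝ) :
    A.Agree (moveTo A z y) (moveTo A z' y) := by
  obtain ⟨e1, e2⟩ := edge_congr h.regionRel
  refine ⟨rfl, e2, fun x => ?_⟩
  by_cases hx : x ∈ A.resets z
  · left
    rw [(moveTo_apply z y x).1 hx, (moveTo_apply z' y x).1 (e1 ▸ hx)]
  · have v1 := (moveTo_apply z y x).2 hx
    have v2 := (moveTo_apply z' y x).2 (e1 ▸ hx)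
    rcases h.2.2 x with h1 | h1
    · left
      rw [v1, v2, h1]
    · right
      rw [DTA.Relevant, DTA.Relevant, v1, v2]
      exact ⟨fun h => h1.1 (le_trans (le_add_of_nonneg_right zero_le) h),
        fun h => h1.2 (le_trans (le_add_of_nonneg_right zero_le) h)⟩

/-- The clocks reset when the region `R` is left. -/
noncomputable def DTA.regionResets (A : DTA Q S X) (R : A.Region) : Set X := A.resets R.out

lemma resets_eq (z : State S Q X) : A.resets z = A.regionResets (A.reg z) :=
  (edge_congr (reg_eq.1 (Quotient.out_eq (A.reg z)))).1.symm

/-- States in the region `R` with gaps `δ` that differ at most in the values of irrelevant clocks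
outside `Y`. -/
def DTA.TourRel (A : DTA Q S X) (R : A.Region) (δ : ℝ) (Y : Set X) (z z' : State S Q X) : Prop :=
  A.reg z = R ∧ A.Sep δ z ∧ A.Agree z z' ∧ ∀ x ∈ Y, z.2.2 x = z'.2.2 x

end Agreement

/-! ### Walks and tours followed with shrinking gaps. -/

section Phases

variable {S Q X : Type*} {A : DTA Q S X} [Fintype S] [Finite Q] [Finite X]
  [MeasurableSpace S] [DiscreteMeasurableSpace S]
  [MeasurableSpace Q] [DiscreteMeasurableSpace Q]
  {M : SMP S} {c : ℝ} {μ : Measure (State S Q X)}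

/-- Following a walk in the region graph. -/
lemma le_pow_of_walk (hc : IsDelayBound M A c) {n : ℕ} {z : State S Q X} {R : A.Region}
    (h : Walk (regionEdge M A μ) n (A.reg z) R) {δ w : ℝ} (hδ : δ ≤ 1) (hs : A.Sep δ z)
    (hw : 0 < w) (hwδ : w * 3 ^ n ≤ δ) :
    ENNReal.ofReal (M.pMin * (c * w)) ^ n ≤
      (productKernel M A ^ n) z (A.stateSpace {R} ∩ {z | A.Sep w z}) := by
  have : Nonempty S := ⟨z.1⟩
  have hm := (A.measurableSet_stateSpace {R}).inter (measurableSet_sep (A := A) w)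
  induction n generalizing z δ with
  | zero =>
    rw [pow_zero]
    exact one_le_pow_zero M A hm ⟨h, hs.mono (by simpa using hwδ)⟩
  | succ n ih =>
    obtain ⟨R₁, h1, h2⟩ := h
    have h3 : (1 : ℝ) ≤ 3 ^ n := one_le_pow₀ (by norm_num)
    rw [pow_succ] at hwδ
    have hδ0 : 0 < δ := by nlinarith
    rw [pow_succ']
    refine le_pow_succ M A hm ((bound_mono hc (?_ : w ≤ δ / 3)).trans
      (le_moveLaw_of_regionEdge hc h1 hδ0 hδ hs.gap)) fun y hy => ?_
    · nlinarith
    · obtain ⟨hy1, hy2⟩ := hy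
      rw [mem_stateSpace_singleton] at hy1
      exact ih (hy1 ▸ h2) (δ := δ / 3) (by linarith) hy2 (by linarith)

/-- Along a tour that resets all clocks, states that agree on the relevant clocks are coupled. -/
lemma couples_of_tour (hc : IsDelayBound M A c) {n : ℕ} {R R' : A.Region} {Y : Set X}
    (h : Tour (regionEdge M A μ) A.regionResets n R Y R') {δ w : ℝ} (hδ : δ ≤ 1)
    (hw : 0 < w) (hwδ : w * 3 ^ n ≤ δ) :
    Couples M A (A.stateSpace {R'}) n (ENNReal.ofReal (M.pMin * (c * w)) ^ n)
      (A.TourRel R δ Y) := by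
  have hR' := A.measurableSet_stateSpace {R'}
  induction n generalizing R Y δ with
  | zero =>
    obtain ⟨rfl, rfl⟩ := h
    rw [pow_zero]
    refine couples_zero hR' fun z z' hz => ⟨?_, hz.1⟩
    obtain ⟨-, -, ⟨h1, h2, -⟩, h3⟩ := hz
    exact Prod.ext h1 (Prod.ext h2 (funext fun x => h3 x trivial))
  | succ n ih =>
    obtain ⟨R₁, h1, h2⟩ := h
    have h3 : (1 : ℝ) ≤ 3 ^ n := one_le_pow₀ (by norm_num)
    rw [pow_succ] at hwδ
    have hδ0 : 0 < δ := by nlinarith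
    rw [pow_succ']
    -- Whether a move enters `R₁` with gaps `δ / 3` depends only on the relevant clocks, so states
    -- that agree have the same moves in `U`.
    let U : Set (State S Q X × (S × ℝ)) :=
      {u | moveTo A u.1 u.2 ∈ A.stateSpace {R₁} ∩ {w | A.Sep (δ / 3) w}}
    have hU : MeasurableSet U := measurable_moveTo A
      ((A.measurableSet_stateSpace {R₁}).inter (measurableSet_sep (A := A) (δ / 3)))
    refine Couples.step hR' hU (D' := A.TourRel R₁ (δ / 3) (Y ∪ A.regionResets R))
      (fun z z' hz => ⟨hz.2.2.1.1, fun y => ?_, fun y hy => ?_⟩) (fun z hz => ?_)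
      (ih h2 (δ := δ / 3) (by linarith) (by linarith))
    · have ha := hz.2.2.1.moveTo y
      constructor
      · rintro ⟨g1, g2⟩
        exact ⟨(reg_eq.2 ha.symm.regionRel).trans g1, ha.sep g2⟩
      · rintro ⟨g1, g2⟩
        exact ⟨(reg_eq.2 ha.regionRel).trans g1, ha.symm.sep g2⟩
    · refine ⟨⟨hy.1, hy.2, hz.2.2.1.moveTo y, fun x hx => ?_⟩, hy.1, hy.2, .refl _, fun _ _ => rfl⟩
      have e1 := (edge_congr hz.2.2.1.regionRel).1
      by_cases hxr : x ∈ A.resets z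
      · rw [(moveTo_apply z y x).1 hxr, (moveTo_apply z' y x).1 (e1 ▸ hxr)]
      · rcases hx with hx | hx
        · rw [(moveTo_apply z y x).2 hxr, (moveTo_apply z' y x).2 (e1 ▸ hxr), hz.2.2.2 x hx]
        · rw [← hz.1, ← resets_eq] at hx
          exact absurd hx hxr
    · have : Nonempty S := ⟨z.1⟩
      refine (bound_mono hc (?_ : w ≤ δ / 3)).trans (le_moveLaw_of_regionEdge hc (μ := μ)
        (hz.1.symm ▸ h1) hδ0 hδ hz.2.1.gap)
      nlinarith

end Phases

/-! ### Descents: delays slightly below an integer. -/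

section Descents

variable {S Q X : Type*} {A : DTA Q S X}

/-- A possible successor of a state of a semi-Markov process. -/
noncomputable def SMP.next (M : SMP S) (s : S) : S := (M.trans s).support_nonempty.choose

lemma SMP.trans_next (M : SMP S) (s : S) : M.trans s (M.next s) ≠ 0 :=
  (M.trans s).support_nonempty.choose_spec

/-- The least delay of the transition to `M.next s`. -/
noncomputable def SMP.lap (M : SMP S) (s : S) : ℕ := (M.delay s (M.next s)).left

/-- Delays that are less than an integer by between `η` and `2 * η`, or that make all clocks
irrelevant. -/
def descentDelays (M : SMP S) (A : DTA Q S X) (η : ℝ) (s : S) : Set ℝ :=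
  {t | (M.lap s + 1 ≤ A.maxConst ∧ ∃ σ, η < σ ∧ σ < 2 * η ∧ t = M.lap s + 1 - σ) ∨
    (A.maxConst ≤ M.lap s ∧ (A.maxConst : ℝ) < t)}

lemma descentDelays_eq (M : SMP S) (η : ℝ) (s : S) :
    descentDelays M A η s = if M.lap s + 1 ≤ A.maxConst then
      Set.Ioo (M.lap s + 1 - 2 * η) (M.lap s + 1 - η) else Set.Ioi (A.maxConst : ℝ) := by
  ext t
  split_ifs with h
  · constructor
    · rintro (⟨-, σ, h1, h2, rfl⟩ | ⟨h1, -⟩)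
      · exact ⟨by linarith, by linarith⟩
      · omega
    · rintro ⟨h1, h2⟩
      exact Or.inl ⟨h, M.lap s + 1 - t, by linarith, by linarith, by ring⟩
  · constructor
    · rintro (⟨h1, -⟩ | ⟨-, h1⟩)
      · exact absurd h1 h
      · exact h1
    · intro h1
      exact Or.inr ⟨by omega, h1⟩

lemma measurableSet_descentDelays (M : SMP S) (η : ℝ) (s : S) :
    MeasurableSet (descentDelays M A η s) := by
  rw [descentDelays_eq]
  split_ifs
  · exact measurableSet_Ioo
  · exact measurableSet_Ioi

lemma le_law_descentDelays {M : SMP S} {c : ℝ} (hc : IsDelayBound M A c) {η : ℝ} (hη0 : 0 < η)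
    (hη : 2 * η ≤ 1) (s : S) :
    ENNReal.ofReal (c * η) ≤ (M.delay s (M.next s)).law (descentDelays M A η s) := by
  have hl : (0 : ℝ) ≤ M.lap s := Nat.cast_nonneg _
  rw [descentDelays_eq]
  split_ifs with h
  · have hB : (M.lap s : ℝ) + 1 ≤ A.maxConst := by exact_mod_cast h
    have := hc.le_law_Ioo (s := s) (s' := M.next s) (a := M.lap s + 1 - 2 * η)
      (b := M.lap s + 1 - η) (by linarith) (by linarith) fun t ht =>
        (M.delay s (M.next s)).ne_zero_of_left
          (t := t) ⟨by change (M.lap s : ℝ) ≤ t; linarith [ht.1],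
            by change t ≤ (M.lap s : ℝ) + 1; linarith [ht.2]⟩
    have e : (M.lap s : ℝ) + 1 - η - (M.lap s + 1 - 2 * η) = η := by ring
    rwa [e] at this
  -- The midpoint of the first unit interval of the support is a non-integer above `maxConst` at
  -- which the density is nonzero, as `IsDelayBound.lt_law_Ioi` requires.
  · have hf : ⌊(M.lap s : ℝ) + 1 / 2⌋₊ = M.lap s := by
      rw [Nat.floor_eq_iff (by positivity)]
      constructor <;> linarith
    refine le_trans (ENNReal.ofReal_le_ofReal ?_) (hc.lt_law_Ioi (t := M.lap s + 1 / 2) ?_ ?_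
      (by positivity) ?_).le
    · nlinarith [hc.1]
    · rw [hf]; omega
    · rw [hf]; linarith
    · exact (M.delay s (M.next s)).ne_zero_of_left
          ⟨by change (M.lap s : ℝ) ≤ _; linarith, by change _ ≤ (M.lap s : ℝ) + 1; linarith⟩

lemma fr_descent_reset (z : State S Q X) (s' : S) {l : ℕ} {σ : ℝ} (hσ0 : 0 < σ) (hσ : σ ≤ 1)
    {x : X} (hx : x ∈ A.resets z) : fr (moveTo A z (s', l + 1 - σ)) x = 1 - σ ∧
      ⌊((moveTo A z (s', l + 1 - σ)).2.2 x : ℝ)⌋ = l := by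
  have hl : (0 : ℝ) ≤ l := Nat.cast_nonneg _
  rw [fr, moveTo_val _ _ (by linarith), base_reset hx]
  obtain ⟨h1, h2⟩ := floor_fract_add (a := 0) (t := l + 1 - σ) (τ := 1 - σ) (k := l) (e := 0)
    (by push_cast; ring) (by simp; linarith) (by simp; linarith)
  exact ⟨by rw [h2]; simp, by rw [h1]; simp⟩

lemma fr_descent (z : State S Q X) (s' : S) {l : ℕ} {σ : ℝ} (hσ0 : 0 < σ)
    {x : X} (hx : x ∉ A.resets z) (h : σ ≤ fr z x) :
    fr (moveTo A z (s', l + 1 - σ)) x = fr z x - σ ∧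
      ⌊((moveTo A z (s', l + 1 - σ)).2.2 x : ℝ)⌋ = ⌊(z.2.2 x : ℝ)⌋ + l + 1 := by
  have hl : (0 : ℝ) ≤ l := Nat.cast_nonneg _
  have h1 : fr z x < 1 := Int.fract_lt_one _
  rw [fr, moveTo_val _ _ (by linarith), base_of_notMem hx]
  unfold fr at h h1 ⊢
  obtain ⟨h2, h3⟩ := floor_fract_add (a := z.2.2 x) (t := l + 1 - σ) (τ := 1 - σ) (k := l) (e := 1)
    (by push_cast; ring) (by push_cast; linarith) (by push_cast; linarith)
  exact ⟨by rw [h3]; push_cast; ring, by rw [h2]⟩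

/-- The exceptional descent: the clock misses an integer, so its integral part need not grow, but
for `σ` near `0` its fractional part is now close to `1`. -/
lemma fr_descent_of_lt (z : State S Q X) (s' : S) {l : ℕ} {σ : ℝ} (hσ : σ ≤ 1)
    {x : X} (hx : x ∉ A.resets z) (h : fr z x < σ) :
    fr (moveTo A z (s', l + 1 - σ)) x = fr z x + 1 - σ ∧
      ⌊((moveTo A z (s', l + 1 - σ)).2.2 x : ℝ)⌋ = ⌊(z.2.2 x : ℝ)⌋ + l := by
  have hl : (0 : ℝ) ≤ l := Nat.cast_nonneg _
  have h1 : 0 ≤ fr z x := Int.fract_nonneg _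
  rw [fr, moveTo_val _ _ (by linarith), base_of_notMem hx]
  unfold fr at h h1 ⊢
  obtain ⟨h2, h3⟩ := floor_fract_add (a := z.2.2 x) (t := l + 1 - σ) (τ := 1 - σ) (k := l) (e := 0)
    (by push_cast; ring) (by push_cast; linarith) (by push_cast; linarith)
  exact ⟨by rw [h3]; push_cast; ring, by rw [h2]; ring⟩

lemma relevant_of_moveTo {z : State S Q X} {y : S × ℝ} {x : X} (hx : x ∉ A.resets z)
    (h : A.Relevant (moveTo A z y).2.2 x) : A.Relevant z.2.2 x := by
  rw [DTA.Relevant, (moveTo_apply z y x).2 hx] at h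
  exact le_trans (le_add_of_nonneg_right zero_le) h

lemma not_relevant_of_gt {z : State S Q X} {s' : S} {t : ℝ} (h : (A.maxConst : ℝ) < t) (x : X) :
    ¬ A.Relevant (moveTo A z (s', t)).2.2 x := by
  have ht : 0 ≤ t := (Nat.cast_nonneg _).trans h.le
  rw [relevant_iff, moveTo_val _ _ ht]
  have := base_nonneg (A := A) z x
  linarith

/-- Invariant of sequences of `i` descents, where `O` contains the clocks not reset so far: the
fractional parts of the other relevant clocks are controlled, and the values of the clocks in `O`
that are still relevant witness that many regions have been visited. -/
def DescentInv (A : DTA Q S X) (V : Set A.Region) (η : ℝ) (i : ℕ) (O : Set X)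
    (z : State S Q X) : Prop :=
  (∀ x ∉ O, A.Relevant z.2.2 x → 1 - 2 * i * η ≤ fr z x ∧ fr z x ≤ 1 - η ∧
    ∀ y ∉ O, A.Relevant z.2.2 y →
      fr z x = fr z y ∨ fr z x + η ≤ fr z y ∨ fr z y + η ≤ fr z x) ∧
  ∀ x ∈ O, A.Relevant z.2.2 x → ∃ U : Finset A.Region,
    (∀ R ∈ U, R ∈ V ∧ ∃ w, A.reg w = R ∧ A.Relevant w.2.2 x ∧
      ⌊(w.2.2 x : ℝ)⌋ < ⌊(z.2.2 x : ℝ)⌋) ∧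
    (i ≤ U.card ∨ (i ≤ U.card + 1 ∧ 1 - 2 * i * η ≤ fr z x))

lemma descentInv_zero (V : Set A.Region) (η : ℝ) (z : State S Q X) :
    DescentInv A V η 0 Set.univ z :=
  ⟨fun x hx => absurd trivial hx, fun x _ _ => ⟨∅, by simp, Or.inl le_rfl⟩⟩

lemma insert_region {V : Set A.Region} {z : State S Q X} (hz : A.reg z ∈ V) {x : X}
    (hx : A.Relevant z.2.2 x) {U : Finset A.Region}
    (hU : ∀ R ∈ U, R ∈ V ∧ ∃ w, A.reg w = R ∧ A.Relevant w.2.2 x ∧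
      ⌊(w.2.2 x : ℝ)⌋ < ⌊(z.2.2 x : ℝ)⌋) :
    ∃ U' : Finset A.Region, U'.card = U.card + 1 ∧ ∀ R ∈ U', R ∈ V ∧ ∃ w, A.reg w = R ∧
      A.Relevant w.2.2 x ∧ ⌊(w.2.2 x : ℝ)⌋ ≤ ⌊(z.2.2 x : ℝ)⌋ := by
  classical
  refine ⟨insert (A.reg z) U, Finset.card_insert_of_notMem fun h => ?_, fun R hR => ?_⟩
  · obtain ⟨-, w, h1, h2, h3⟩ := hU _ h
    exact absurd ((reg_eq.1 h1).2.2.2.1 x h2).1 h3.ne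
  · rcases Finset.mem_insert.1 hR with rfl | hR
    · exact ⟨hz, z, rfl, hx, le_rfl⟩
    · obtain ⟨h0, w, h1, h2, h3⟩ := hU _ hR
      exact ⟨h0, w, h1, h2, h3.le⟩

/-- A clock outside `O` has fractional part at least `1 - 2 * i * η`, so it does not miss its
integer; it loses `σ > η` and is thereby separated from clocks reset now, which sit at `1 - σ`. A
clock that stays in `O` either gains at least one in integral part, so that the region being left
joins `U`, or misses its integer, which can happen only once. -/
lemma DescentInv.step {M : SMP S} {V : Set A.Region} {η : ℝ} {i : ℕ} {O : Set X}
    {z : State S Q X} (h : DescentInv A V η i O z) (hz : A.reg z ∈ V) (hη0 : 0 < η)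
    (hη : 2 * (i + 1) * η ≤ 1) {s' : S} {t : ℝ} (ht : t ∈ descentDelays M A η z.1) :
    DescentInv A V η (i + 1) (O \ A.resets z) (moveTo A z (s', t)) := by
  rcases ht with ⟨-, σ, hσ1, hσ2, rfl⟩ | ⟨-, ht⟩
  swap
  · exact ⟨fun x _ hx => absurd hx (not_relevant_of_gt ht x),
      fun x _ hx => absurd hx (not_relevant_of_gt ht x)⟩
  have hi : 0 ≤ 2 * (i : ℝ) * η := by positivity
  have hηi : 2 * (i : ℝ) * η + 2 * η ≤ 1 := by linarith
  have hσ0 : 0 < σ := by linarith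
  have hσ3 : σ ≤ 1 := by linarith
  have hi1 : 2 * ((i + 1 : ℕ) : ℝ) * η = 2 * i * η + 2 * η := by push_cast; ring
  have cases : ∀ x ∉ O \ A.resets z, A.Relevant (moveTo A z (s', M.lap z.1 + 1 - σ)).2.2 x →
      (x ∈ A.resets z ∧ fr (moveTo A z (s', M.lap z.1 + 1 - σ)) x = 1 - σ) ∨
      (x ∉ O ∧ A.Relevant z.2.2 x ∧
        fr (moveTo A z (s', M.lap z.1 + 1 - σ)) x = fr z x - σ) := by
    intro x hx hr
    by_cases hxr : x ∈ A.resets z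
    · exact Or.inl ⟨hxr, (fr_descent_reset z s' hσ0 hσ3 hxr).1⟩
    · have hxO : x ∉ O := fun h => hx ⟨h, hxr⟩
      have hr' := relevant_of_moveTo hxr hr
      exact Or.inr ⟨hxO, hr', (fr_descent z s' (by linarith) hxr
        (by linarith [(h.1 x hxO hr').1])).1⟩
  refine ⟨fun x hx hr => ?_, fun x hx hr => ?_⟩
  · rcases cases x hx hr with ⟨h1, h2⟩ | ⟨h1, h2, h3⟩
    · rw [h2]
      refine ⟨by linarith, by linarith, fun y hy hry => ?_⟩
      rcases cases y hy hry with ⟨h4, h5⟩ | ⟨h4, h5, h6⟩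
      · exact Or.inl h5.symm
      · rw [h6]
        exact Or.inr (Or.inr (by linarith [(h.1 y h4 h5).2.1]))
    · rw [h3]
      obtain ⟨g1, g2, g3⟩ := h.1 x h1 h2
      refine ⟨by linarith, by linarith, fun y hy hry => ?_⟩
      rcases cases y hy hry with ⟨h4, h5⟩ | ⟨h4, h5, h6⟩
      · rw [h5]
        exact Or.inr (Or.inl (by linarith))
      · rw [h6]
        rcases g3 y h4 h5 with g | g | g
        · exact Or.inl (by linarith)
        · exact Or.inr (Or.inl (by linarith))
        · exact Or.inr (Or.inr (by linarith))
  · obtain ⟨hxO, hxr⟩ := hx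
    have hr' := relevant_of_moveTo hxr hr
    obtain ⟨U, hU, hcard⟩ := h.2 x hxO hr'
    have hl : (0 : ℤ) ≤ M.lap z.1 := Int.natCast_nonneg _
    rcases le_or_gt σ (fr z x) with hle | hlt
    · obtain ⟨d1, d2⟩ := fr_descent z s' (l := M.lap z.1) (by linarith) hxr hle
      obtain ⟨U', hU'1, hU'2⟩ := insert_region hz hr' hU
      refine ⟨U', fun R hR => ?_, ?_⟩
      · obtain ⟨h0, w, h1, h2, h3⟩ := hU'2 R hR
        exact ⟨h0, w, h1, h2, by rw [d2]; omega⟩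
      · rw [hU'1, d1]
        rcases hcard with hcard | ⟨hcard, hf⟩
        · exact Or.inl (by omega)
        · exact Or.inr ⟨by omega, by linarith⟩
    · obtain ⟨d1, d2⟩ := fr_descent_of_lt z s' (l := M.lap z.1) hσ3 hxr hlt
      refine ⟨U, fun R hR => ?_, ?_⟩
      · obtain ⟨h0, w, h1, h2, h3⟩ := hU R hR
        exact ⟨h0, w, h1, h2, by rw [d2]; omega⟩
      · rw [d1]
        rcases hcard with hcard | ⟨hcard, hf⟩
        -- The missed integer uses up the slack in `i ≤ U.card + 1`.
        · exact Or.inr ⟨by omega, by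
            have : 0 ≤ fr z x := Int.fract_nonneg _
            linarith⟩
        -- A second miss is impossible: after the first one the fractional part is still at least `1
        -- - 2 * i * η ≥ 2 * η > σ`.
        · linarith

/-- After more descents than there are regions, each relevant clock has been reset. -/
lemma DescentInv.not_relevant {V : Set A.Region} (hV : V.Finite) {η : ℝ} {i : ℕ} {O : Set X}
    {z : State S Q X} (h : DescentInv A V η i O z) (hz : A.reg z ∈ V) (hi : V.ncard < i) {x : X}
    (hx : x ∈ O) : ¬ A.Relevant z.2.2 x := by
  intro hr
  obtain ⟨U, hU, hcard⟩ := h.2 x hx hr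
  -- The present region is not in `U`, since the integral part of `x` is larger than in the regions
  -- of `U`. Hence `U.card + 1 ≤ N`.
  obtain ⟨U', h1, h2⟩ := insert_region hz hr hU
  have h3 : (U' : Set A.Region).ncard ≤ V.ncard := Set.ncard_le_ncard (fun R hR => (h2 R hR).1) hV
  rw [Set.ncard_coe_finset, h1] at h3
  rcases hcard with hcard | ⟨hcard, -⟩ <;> omega

/-- By now every relevant clock is outside `O`, so the first half of the invariant applies to all of
them, with `1 - 2 * i * η ≥ η`. -/
lemma DescentInv.sep {V : Set A.Region} (hV : V.Finite) {η : ℝ} {i : ℕ} {O : Set X}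
    {z : State S Q X} (h : DescentInv A V η i O z) (hz : A.reg z ∈ V) (hi : V.ncard < i)
    (hη : (2 * i + 1) * η ≤ 1) : A.Sep η z := by
  have hO : ∀ x, A.Relevant z.2.2 x → x ∉ O := fun x hx hxO => h.not_relevant hV hz hi hxO hx
  intro x hx
  obtain ⟨h1, h2, h3⟩ := h.1 x (hO x hx) hx
  exact ⟨by linarith, h2, fun y hy => h3 y (hO y hy) hy⟩

/-- Descents lead from equivalent states to equivalent states. -/
lemma regionRel_descent {M : SMP S} {z z' : State S Q X} (h : A.RegionRel z z') {η : ℝ}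
    (hη : 2 * η ≤ 1)
    (hz : ∀ x, A.Relevant z.2.2 x → 2 * η ≤ fr z x)
    (hz' : ∀ x, A.Relevant z'.2.2 x → 2 * η ≤ fr z' x) (s' : S) {t t' : ℝ}
    (ht : t ∈ descentDelays M A η z.1) (ht' : t' ∈ descentDelays M A η z.1) :
    A.RegionRel (moveTo A z (s', t)) (moveTo A z' (s', t')) := by
  rcases ht with ⟨hB, σ, h1, h2, rfl⟩ | ⟨hB, ht⟩
  swap
  · rcases ht' with ⟨hB', -⟩ | ⟨-, ht'⟩
    · omega
    · exact regionRel_moveTo_of_gt h s' ht ht'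
  rcases ht' with ⟨-, σ', h1', h2', rfl⟩ | ⟨hB', -⟩
  swap
  · omega
  set l := M.lap z.1
  have hσ : σ ≤ 1 := by linarith
  have hσ' : σ' ≤ 1 := by linarith
  have e := edge_congr h
  obtain ⟨-, -, r3, r4, r5⟩ := h
  have irr : ∀ (z : State S Q X) (t : ℝ) (x : X), x ∉ A.resets z → ¬ A.Relevant z.2.2 x →
      ¬ A.Relevant (moveTo A z (s', t)).2.2 x := fun z t x hx hr h => hr (relevant_of_moveTo hx h)
  have hrel : ∀ x, A.Relevant (moveTo A z (s', l + 1 - σ)).2.2 x ↔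
      A.Relevant (moveTo A z' (s', l + 1 - σ')).2.2 x := by
    intro x
    by_cases hx : x ∈ A.resets z
    · obtain ⟨d1, d2⟩ := fr_descent_reset z s' (l := l) (by linarith) hσ hx
      obtain ⟨d3, d4⟩ := fr_descent_reset z' s' (l := l) (σ := σ') (by linarith) hσ' (e.1 ▸ hx)
      rw [relevant_iff, relevant_iff, le_natCast_iff_of_fract_ne (by change fr _ x ≠ 0; linarith),
        le_natCast_iff_of_fract_ne (by change fr _ x ≠ 0; linarith), d2, d4]
    · by_cases hr : A.Relevant z.2.2 x
      · have hr' := (r3 x).1 hr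
        have f1 := hz x hr
        have f2 := hz' x hr'
        obtain ⟨d1, d2⟩ := fr_descent z s' (l := l) (σ := σ) (by linarith) hx (by linarith)
        obtain ⟨d3, d4⟩ := fr_descent z' s' (l := l) (σ := σ') (by linarith) (e.1 ▸ hx)
          (by linarith)
        rw [relevant_iff, relevant_iff,
          le_natCast_iff_of_fract_ne (by change fr _ x ≠ 0; linarith),
          le_natCast_iff_of_fract_ne (by change fr _ x ≠ 0; linarith), d2, d4, (r4 x hr).1]
      · exact iff_of_false (irr z _ x hx hr) (irr z' _ x (e.1 ▸ hx) fun h => hr ((r3 x).2 h))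
  -- the fractional parts after the two moves
  have key : ∀ x, A.Relevant (moveTo A z (s', l + 1 - σ)).2.2 x →
      (x ∈ A.resets z ∧ fr (moveTo A z (s', l + 1 - σ)) x = 1 - σ ∧
        fr (moveTo A z' (s', l + 1 - σ')) x = 1 - σ' ∧
        ⌊((moveTo A z (s', l + 1 - σ)).2.2 x : ℝ)⌋ =
          ⌊((moveTo A z' (s', l + 1 - σ')).2.2 x : ℝ)⌋) ∨
      (x ∉ A.resets z ∧ A.Relevant z.2.2 x ∧ fr (moveTo A z (s', l + 1 - σ)) x = fr z x - σ ∧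
        fr (moveTo A z' (s', l + 1 - σ')) x = fr z' x - σ' ∧
        ⌊((moveTo A z (s', l + 1 - σ)).2.2 x : ℝ)⌋ =
          ⌊((moveTo A z' (s', l + 1 - σ')).2.2 x : ℝ)⌋ ∧ 2 * η ≤ fr z x ∧ 2 * η ≤ fr z' x) := by
    intro x hx'
    by_cases hx : x ∈ A.resets z
    · obtain ⟨d1, d2⟩ := fr_descent_reset z s' (l := l) (by linarith) hσ hx
      obtain ⟨d3, d4⟩ := fr_descent_reset z' s' (l := l) (σ := σ') (by linarith) hσ' (e.1 ▸ hx)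
      exact Or.inl ⟨hx, d1, d3, d2.trans d4.symm⟩
    · have hr := relevant_of_moveTo hx hx'
      have hr' := (r3 x).1 hr
      have f1 := hz x hr
      have f2 := hz' x hr'
      obtain ⟨d1, d2⟩ := fr_descent z s' (l := l) (σ := σ) (by linarith) hx (by linarith)
      obtain ⟨d3, d4⟩ := fr_descent z' s' (l := l) (σ := σ') (by linarith) (e.1 ▸ hx)
          (by linarith)
      exact Or.inr ⟨hx, hr, d1, d3, by rw [d2, d4, (r4 x hr).1], f1, f2⟩
  refine ⟨rfl, e.2, hrel, fun x hx => ⟨?_, ?_⟩, fun x y hx hy => ?_⟩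
  · rcases key x hx with ⟨-, -, -, k⟩ | ⟨-, -, -, -, k, -⟩ <;> exact k
  · change fr _ x = 0 ↔ fr _ x = 0
    rcases key x hx with ⟨-, k1, k2, -⟩ | ⟨-, -, k1, k2, -, k3, k4⟩ <;> rw [k1, k2]
    · exact iff_of_false (by linarith) (by linarith)
    · exact iff_of_false (by linarith) (by linarith)
  · change fr _ x ≤ fr _ y ↔ fr _ x ≤ fr _ y
    -- Clocks reset by the edge end at `1 - σ`, above all the others, and the others keep their
    -- order.
    have u1 : fr z x < 1 := Int.fract_lt_one _
    have u2 : fr z y < 1 := Int.fract_lt_one _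
    have u3 : fr z' x < 1 := Int.fract_lt_one _
    have u4 : fr z' y < 1 := Int.fract_lt_one _
    rcases key x hx with ⟨-, k1, k2, -⟩ | ⟨-, k0, k1, k2, -, k3, k4⟩ <;>
      rcases key y hy with ⟨-, j1, j2, -⟩ | ⟨-, j0, j1, j2, -, j3, j4⟩ <;> rw [k1, k2, j1, j2]
    · simp
    · exact iff_of_false (by linarith) (by linarith)
    · exact iff_of_true (by linarith) (by linarith)
    · rw [sub_le_sub_iff_right, sub_le_sub_iff_right]
      exact r5 x y k0 j0

end Descents

/-! ### Sequences of descents, alone and coupled. -/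

section DescentPhases

variable {S Q X : Type*} {A : DTA Q S X} [Fintype S] [Finite Q] [Finite X]
  [MeasurableSpace S] [DiscreteMeasurableSpace S]
  [MeasurableSpace Q] [DiscreteMeasurableSpace Q]
  {M : SMP S} {c : ℝ} {μ : Measure (State S Q X)}

omit [Finite Q] [Finite X] [DiscreteMeasurableSpace S] [MeasurableSpace Q]
  [DiscreteMeasurableSpace Q] in
lemma le_moveLaw_descent (hc : IsDelayBound M A c) {η : ℝ} (hη0 : 0 < η) (hη : 2 * η ≤ 1) (s : S) :
    ENNReal.ofReal (M.pMin * (c * η)) ≤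
      moveLaw M s {y | y.1 = M.next s ∧ y.2 ∈ descentDelays M A η s} := by
  have : Nonempty S := ⟨s⟩
  exact (ofReal_mul_le M (M.trans_next s) (le_law_descentDelays hc hη0 hη s)).trans
    (le_moveLaw M s (M.next s) _ _ fun t ht => ⟨rfl, ht⟩)

variable {p : ℕ} {W : Fin p → Set A.Region}

/-- After more descents than there are regions, the state has gaps `η`. -/
lemma le_pow_descent (hc : IsDelayBound M A c)
    (hW : IsCyclicDecomposition (vertices M A μ) (regionEdge M A μ) p W) {m : ℕ}
    (hm : (vertices M A μ).ncard < m) {η : ℝ} (hη0 : 0 < η) (hη : (2 * m + 1) * η ≤ 1) {k : ℕ}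
    (j : ℕ) : ∀ i, i + j = m → ∀ z : State S Q X, A.reg z ∈ cls W (k + i) → ∀ O,
      DescentInv A (vertices M A μ) η i O z →
      ENNReal.ofReal (M.pMin * (c * η)) ^ j ≤
        (productKernel M A ^ j) z (A.stateSpace (cls W (k + m)) ∩ {z | A.Sep η z}) := by
  have hms := (A.measurableSet_stateSpace (cls W (k + m))).inter (measurableSet_sep (A := A) η)
  induction j with
  | zero =>
    intro i hij z hz O h
    obtain rfl : i = m := hij
    rw [pow_zero]
    exact one_le_pow_zero M A hms ⟨hz, h.sep (Set.toFinite _) (cls_subset hW _ hz) hm hη⟩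
  | succ j ih =>
    intro i hij z hz O h
    have him : (i : ℝ) + 1 ≤ m := by exact_mod_cast (show i + 1 ≤ m by omega)
    have hη2 : 2 * ((i : ℝ) + 1) * η ≤ 1 := by nlinarith
    have hη1 : 2 * η ≤ 1 := by
      have : (0 : ℝ) ≤ i := Nat.cast_nonneg _
      nlinarith
    rw [pow_succ']
    refine le_pow_succ M A hms (G := {w | A.reg w ∈ cls W (k + (i + 1)) ∧
      ∃ O, DescentInv A (vertices M A μ) η (i + 1) O w}) ?_
      fun y hy => ?_
    · refine (le_moveLaw_descent hc hη0 hη1 z.1).trans ?_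
      have h0 := moveLaw_cls hc hW hz
      -- Membership in the next class holds only for almost all moves; the exceptional ones are
      -- split off as a null set.
      refine (measure_mono (?_ : _ ⊆ {y | moveTo A z y ∈ {w | A.reg w ∈ cls W (k + (i + 1)) ∧
        ∃ O, DescentInv A (vertices M A μ) η (i + 1) O w}} ∪
        {y | A.reg (moveTo A z y) ∉ cls W (k + i + 1)})).trans
        ((measure_union_le _ _).trans (by rw [h0, add_zero]))
      rintro ⟨s', t⟩ ⟨-, ht⟩
      by_cases hy : A.reg (moveTo A z (s', t)) ∈ cls W (k + i + 1)
      · exact Or.inl ⟨hy, _, h.step (cls_subset hW _ hz) hη0 hη2 ht⟩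
      · exact Or.inr hy
    · obtain ⟨h1, O', h2⟩ := hy
      exact ih (i + 1) (by omega) y h1 O' h2

/-- Equivalent states after `i` descents that agree on the clocks reset so far and have room for
further descents. -/
def DescentRel (A : DTA Q S X) (V : Set A.Region) (η δ : ℝ) (i : ℕ) (R : A.Region)
    (z z' : State S Q X) : Prop :=
  A.reg z = R ∧ A.reg z' = R ∧ (∀ x, A.Relevant z.2.2 x → δ - 2 * i * η ≤ fr z x) ∧
    (∀ x, A.Relevant z'.2.2 x → δ - 2 * i * η ≤ fr z' x) ∧
    ∃ O, DescentInv A V η i O z ∧ ∀ x ∉ O, A.Relevant z.2.2 x → z.2.2 x = z'.2.2 x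

omit [Fintype S] [Finite Q] [Finite X] [MeasurableSpace S] [DiscreteMeasurableSpace S]
  [MeasurableSpace Q] [DiscreteMeasurableSpace Q] in
-- Each descent consumes less than `2 * η` of the room, and clocks that are reset start afresh near
-- `1`.
lemma room_descent {z : State S Q X} {η δ : ℝ} {i : ℕ} (hη0 : 0 < η) (hη : 2 * η ≤ 1)
    (hδ : δ ≤ 1) (hi : 2 * (i + 1) * η ≤ δ)
    (hz : ∀ x, A.Relevant z.2.2 x → δ - 2 * i * η ≤ fr z x) (s' : S) {t : ℝ}
    (ht : t ∈ descentDelays M A η z.1) (x : X)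
    (hx : A.Relevant (moveTo A z (s', t)).2.2 x) :
    δ - 2 * (i + 1 : ℕ) * η ≤ fr (moveTo A z (s', t)) x := by
  rcases ht with ⟨-, σ, h1, h2, rfl⟩ | ⟨-, ht⟩
  swap
  · exact absurd hx (not_relevant_of_gt ht x)
  have hi1 : 2 * ((i + 1 : ℕ) : ℝ) * η = 2 * i * η + 2 * η := by push_cast; ring
  have hi0 : 0 ≤ 2 * (i : ℝ) * η := by positivity
  by_cases hxr : x ∈ A.resets z
  · rw [(fr_descent_reset z s' (by linarith) (by linarith) hxr).1]
    linarith
  · have := hz x (relevant_of_moveTo hxr hx)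
    rw [(fr_descent z s' (by linarith) hxr (by linarith)).1]
    linarith

/-- With fractional parts at least `δ` at the start and a total shift below `δ`, no clock misses its
integer, so all states of a region move to one and the same region, and one representative `z₀`
determines the whole walk. Shared delays make the clocks that have been reset agree, and after `m`
descents these include all relevant clocks. The end `R'` is found along the way, so the coupling
that continues from it is a hypothesis inside the conclusion. -/
lemma couples_of_descent (hc : IsDelayBound M A c) {m : ℕ}
    (hm : (vertices M A μ).ncard < m) {η δ : ℝ} (hη0 : 0 < η) (hη : (2 * m + 1) * η ≤ δ)
    (hδ : δ ≤ 1) {T : Set (State S Q X)} (hT : MeasurableSet T) (j : ℕ) :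
    ∀ i, i + j = m → ∀ z₀ : State S Q X, A.reg z₀ ∈ vertices M A μ →
      (∀ x, A.Relevant z₀.2.2 x → δ - 2 * i * η ≤ fr z₀ x) →
      ∃ R', Walk (regionEdge M A μ) j (A.reg z₀) R' ∧ R' ∈ vertices M A μ ∧ ∀ n β,
        Couples M A T n β (A.TourRel R' η ∅) →
        Couples M A T (n + j) (ENNReal.ofReal (M.pMin * (c * η)) ^ j * β)
          (DescentRel A (vertices M A μ) η δ i (A.reg z₀)) := by
  induction j with
  | zero =>
    intro i hij z₀ hz₀ _
    obtain rfl : i = m := hij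
    refine ⟨A.reg z₀, rfl, hz₀, fun n β h => ?_⟩
    rw [pow_zero, one_mul]
    refine h.mono le_rfl fun z z' hz => ?_
    obtain ⟨h1, h2, -, -, O, h4, h5⟩ := hz
    have hrel := reg_eq.1 (h1.trans h2.symm)
    have hO : ∀ x, A.Relevant z.2.2 x → x ∉ O := fun x hx hxO =>
      h4.not_relevant (Set.toFinite _) (h1 ▸ hz₀) hm hxO hx
    refine ⟨h1, h4.sep (Set.toFinite _) (h1 ▸ hz₀) hm (by linarith),
      ⟨hrel.1, hrel.2.1, fun x => ?_⟩, fun x hx => absurd hx (Set.notMem_empty x)⟩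
    by_cases hx : A.Relevant z.2.2 x
    · exact Or.inl (h5 x (hO x hx) hx)
    · exact Or.inr ⟨hx, fun h => hx ((hrel.2.2.1 x).2 h)⟩
  | succ j ih =>
    intro i hij z₀ hz₀ hroom
    have him : (i : ℝ) + 1 ≤ m := by exact_mod_cast (show i + 1 ≤ m by omega)
    have hi0 : (0 : ℝ) ≤ i := Nat.cast_nonneg _
    have hiη : 2 * ((i : ℝ) + 1) * η + η ≤ δ := by nlinarith
    have hη1 : 2 * η ≤ 1 := by nlinarith
    have hroom2 : ∀ z : State S Q X, (∀ x, A.Relevant z.2.2 x → δ - 2 * i * η ≤ fr z x) →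
        ∀ x, A.Relevant z.2.2 x → 2 * η ≤ fr z x := fun z hz x hx => by
      have := hz x hx
      linarith
    have hlaw := le_moveLaw_descent hc hη0 hη1 z₀.1
    have : Nonempty S := ⟨z₀.1⟩
    have hq : 0 < M.pMin * (c * η) := by
      have := hc.1
      have := M.pMin_pos
      positivity
    obtain ⟨y₀, hy₀1, hy₀2⟩ : {y : S × ℝ | y.1 = M.next z₀.1 ∧
        y.2 ∈ descentDelays M A η z₀.1}.Nonempty := by
      by_contra hne
      rw [Set.not_nonempty_iff_eq_empty] at hne
      rw [hne, measure_empty] at hlaw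
      exact absurd hlaw (not_le.2 (ENNReal.ofReal_pos.2 hq))
    -- all descents from the region lead to the same region
    have hsame : ∀ z, A.reg z = A.reg z₀ →
        (∀ x, A.Relevant z.2.2 x → δ - 2 * i * η ≤ fr z x) → ∀ y : S × ℝ, y.1 = M.next z₀.1 →
        y.2 ∈ descentDelays M A η z₀.1 → A.reg (moveTo A z y) = A.reg (moveTo A z₀ y₀) := by
      rintro z hz hr ⟨s', t⟩ hy1 hy2
      refine (reg_eq.2 ?_).symm
      have : y₀ = (s', y₀.2) := Prod.ext (hy₀1.trans hy1.symm) rfl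
      rw [this]
      exact regionRel_descent (reg_eq.1 hz.symm) hη1 (hroom2 _ hroom) (hroom2 _ hr) s' hy₀2 hy2
    have hedge : regionEdge M A μ (A.reg z₀) (A.reg (moveTo A z₀ y₀)) := by
      refine regionEdge_of_pos hc hz₀ (ne_of_gt ?_)
      refine (ENNReal.ofReal_pos.2 hq).trans_le (hlaw.trans ((measure_mono ?_).trans
        (le_productKernel M A z₀ _)))
      exact fun y hy => hsame z₀ rfl hroom y hy.1 hy.2
    have hroom' : ∀ z : State S Q X, A.reg z = A.reg z₀ →
        (∀ x, A.Relevant z.2.2 x → δ - 2 * i * η ≤ fr z x) →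
        ∀ y : S × ℝ, y.2 ∈ descentDelays M A η z₀.1 → ∀ x,
          A.Relevant (moveTo A z y).2.2 x → δ - 2 * (i + 1 : ℕ) * η ≤ fr (moveTo A z y) x := by
      rintro z hz hr ⟨s', t⟩ hy x hx
      rw [← (reg_eq.1 hz).1] at hy
      exact room_descent hη0 hη1 hδ (by linarith) hr s' hy x hx
    obtain ⟨R', h1, h2, h3⟩ := ih (i + 1) (by omega) (moveTo A z₀ y₀) hedge.2.1
      (hroom' z₀ rfl hroom y₀ hy₀2)
    refine ⟨R', ⟨_, hedge, h1⟩, h2, fun n β h => ?_⟩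
    let U : Set (State S Q X × (S × ℝ)) :=
      {u | u.2.1 = M.next z₀.1 ∧ u.2.2 ∈ descentDelays M A η z₀.1}
    have hU : MeasurableSet U := by
      refine MeasurableSet.inter ?_ ?_
      · exact measurable_snd.fst (MeasurableSet.of_discrete (s := {M.next z₀.1}))
      · exact measurable_snd.snd (measurableSet_descentDelays M η z₀.1)
    rw [pow_succ', mul_assoc]
    refine Couples.step hT hU (fun z z' hz => ⟨?_, fun y => Iff.rfl, fun y hy => ?_⟩)
      (fun z hz => ?_) (h3 n β h)
    · exact (reg_eq.1 (hz.1.trans hz.2.1.symm)).1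
    · obtain ⟨g1, g2, g3, g4, O, g5, g6⟩ := hz
      have hy2 : y.2 ∈ descentDelays M A η z.1 := by
        rw [(reg_eq.1 g1).1]
        exact hy.2
      have hinv := g5.step (M := M) (s' := y.1) (t := y.2) (g1 ▸ hz₀) hη0 (by linarith) hy2
      have e := (edge_congr (reg_eq.1 (g1.trans g2.symm))).1
      refine ⟨⟨hsame z g1 g3 y hy.1 hy.2, hsame z' g2 g4 y hy.1 hy.2, hroom' z g1 g3 y hy.2,
        hroom' z' g2 g4 y hy.2, _, hinv, fun x hx hxr => ?_⟩, hsame z g1 g3 y hy.1 hy.2,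
        hsame z g1 g3 y hy.1 hy.2, hroom' z g1 g3 y hy.2, hroom' z g1 g3 y hy.2, _, hinv,
        fun _ _ _ => rfl⟩
      by_cases hxz : x ∈ A.resets z
      · rw [(moveTo_apply z y x).1 hxz, (moveTo_apply z' y x).1 (e ▸ hxz)]
      · rw [(moveTo_apply z y x).2 hxz, (moveTo_apply z' y x).2 (e ▸ hxz),
          g6 x (fun h => hx ⟨h, hxz⟩) (relevant_of_moveTo hxz hxr)]
    · have := (reg_eq.1 hz.1).1
      rw [this]
      exact hlaw

end DescentPhases

/-! ### Restriction of a kernel to a closed set of states. -/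

section Restriction

variable {Γ : Type*} [MeasurableSpace Γ]

/-- The powers of the restriction of a kernel to a set that is not left. -/
lemma restrictKernel_pow (P : Kernel Γ Γ) {C : Set Γ} (hC : MeasurableSet C)
    (hP : ∀ z ∈ C, P z Cᶜ = 0) (n : ℕ) (z : C) {B : Set C} (hB : MeasurableSet B) :
    (restrictKernel P C hC ^ n) z B = (P ^ n) z (Subtype.val '' B) := by
  have he := MeasurableEmbedding.subtype_coe hC
  induction n generalizing z with
  | zero =>
    rw [pow_zero, pow_zero]
    change Kernel.id z B = Kernel.id z.1 _
    rw [Kernel.id_apply, Kernel.id_apply, Measure.dirac_apply' _ hB,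
      Measure.dirac_apply' _ (he.measurableSet_image.2 hB)]
    by_cases hz : z ∈ B
    · have : z.1 ∈ Subtype.val '' B := ⟨z, hz, rfl⟩
      simp [hz, this]
    · have : z.1 ∉ Subtype.val '' B := by
        rintro ⟨y, hy, hyz⟩
        exact hz (Subtype.ext hyz ▸ hy)
      rw [Set.indicator_of_notMem hz, Set.indicator_of_notMem this]
  | succ n ih =>
    have hB' := he.measurableSet_image.2 hB
    rw [lintegral_pow_succ _ _ _ hB, lintegral_pow_succ _ _ _ hB']
    simp only [ih]
    have h1 : restrictKernel P C hC z = (P z).comap Subtype.val := by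
      rw [restrictKernel, Kernel.comapRight_apply, Kernel.comap_apply]
    rw [h1, ← he.lintegral_map (fun b => (P ^ n) b (Subtype.val '' B)), he.map_comap,
      Subtype.range_coe, Measure.restrict_eq_self_of_ae_mem]
    exact measure_eq_zero_iff_ae_notMem.1 (hP z z.2) |>.mono fun b hb => not_not.1 hb

end Restriction

/-! ### From a minorizing measure to a small set. -/

section SmallSets

variable {S Q X : Type*} {A : DTA Q S X} [Fintype S] [Finite Q] [Finite X]
  [MeasurableSpace S] [DiscreteMeasurableSpace S]
  [MeasurableSpace Q] [DiscreteMeasurableSpace Q]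

/-- The union of the regions in `C` is small for a multiple of `p` steps of the product process,
with a minorizing measure on one region and bounds in terms of `r`. -/
def HasSmallSet (M : SMP S) (A : DTA Q S X) (p : ℕ) (C : Set A.Region) (c : ℝ) (r : ℕ) : Prop :=
  ∃ R ∈ C, ∃ T₀ : Set (State S Q X), MeasurableSet T₀ ∧ T₀ ⊆ A.stateSpace {R} ∧
    ∃ (n : ℕ) (b : ℝ) (κ : Measure (State S Q X)),
      0 < n ∧ 0 < b ∧ IsProbabilityMeasure κ ∧ κ T₀ = 1 ∧
      (∀ z ∈ A.stateSpace C, ∀ T, MeasurableSet T → T ⊆ T₀ → 0 < κ T →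
        ENNReal.ofReal b * κ T < (productKernel M A ^ (n * p)) z T) ∧
      IsSmall (cyclicKernel M A p C) Set.univ n b (κ.comap Subtype.val) ∧
      n * p ≤ r ∧ (M.pMin * c / r) ^ r ≤ b

variable {M : SMP S} {c : ℝ} {μ : Measure (State S Q X)} {p : ℕ} {W : Fin p → Set A.Region}

/-- A minorizing measure for a multiple of `p` steps gives the small set. -/
lemma small_of_minorizing (hc : IsDelayBound M A c)
    (hW : IsCyclicDecomposition (vertices M A μ) (regionEdge M A μ) p W) {k : Fin p}
    {R : A.Region} (hR : R ∈ W k) {κ : Measure (State S Q X)} (hκ : IsProbabilityMeasure κ)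
    (hκR : κ (A.stateSpace {R}) = 1) {t : ℕ} (ht : 0 < t) (hpt : p ∣ t) {β : ℝ≥0∞}
    (hmin : ∀ z ∈ A.stateSpace (W k), ∀ T, MeasurableSet T →
      β * κ T ≤ (productKernel M A ^ t) z T) {b : ℝ} (hb : 0 < b) (hβ : ENNReal.ofReal b < β)
    {r : ℕ} (hr : t ≤ r) (hbr : (M.pMin * c / r) ^ r ≤ b) :
    HasSmallSet M A p (W k) c r := by
  obtain ⟨n, rfl⟩ := hpt
  rw [mul_comm] at ht hmin hr
  have hn : 0 < n := Nat.pos_of_mul_pos_right ht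
  have hmW := A.measurableSet_stateSpace (W k)
  have hmR := A.measurableSet_stateSpace {R}
  refine ⟨R, hR, A.stateSpace {R}, hmR, subset_rfl, n, b, κ, hn, hb, hκ, hκR, ?_, ?_, hr, hbr⟩
  · intro z hz T hT _ hpos
    refine lt_of_lt_of_le ?_ (hmin z hz T hT)
    -- Strictness comes from choosing `b` below the mass `β` of the minorization.
    exact ENNReal.mul_lt_mul_left hpos.ne' (measure_ne_top κ T) hβ
  · have he := MeasurableEmbedding.subtype_coe hmW
    have hinv : ∀ z ∈ A.stateSpace (W k), (productKernel M A ^ p) z (A.stateSpace (W k))ᶜ = 0 := by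
      intro z hz
      have h1 : A.reg z ∈ cls W (k : ℕ) := by rw [cls_coe]; exact hz
      have := pow_productKernel_cls hc hW p h1
      rwa [cls_congr (Nat.add_mod_right _ _), cls_coe] at this
    have hκW : κ (A.stateSpace (W k)) = 1 := by
      refine le_antisymm prob_le_one (hκR ▸ measure_mono fun z hz => ?_)
      rw [mem_stateSpace_singleton] at hz
      exact mem_stateSpace.2 (hz ▸ hR)
    refine ⟨hn, hb, ⟨?_⟩, MeasurableSet.univ, fun z _ B hB => ?_⟩
    · rw [he.comap_apply, Set.image_univ, Subtype.range_coe, hκW]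
    · rw [cyclicKernel, restrictKernel_pow _ hmW hinv n z hB, he.comap_apply, ← pow_mul]
      rw [mul_comm p n]
      refine le_trans ?_ (hmin z z.2 _ (he.measurableSet_image.2 hB))
      gcongr

end SmallSets

/-! ### Estimates for `rBound`. -/

section Numerics

lemma rBound_one : rBound 1 = 1 := by simp [rBound]

lemma rpow_log_eq {N : ℕ} (hN : 0 < N) :
    (N : ℝ) ^ (4 * Real.log N) = Real.exp (4 * Real.log N * Real.log N) := by
  rw [Real.rpow_def_of_pos (by exact_mod_cast hN)]
  ring_nf

lemma five_le_rBound_two : 5 ≤ rBound 2 := by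
  refine Nat.le_floor ?_
  rw [rpow_log_eq two_pos]
  have h1 := Real.log_two_gt_d9
  have h2 : (1.92 : ℝ) ≤ 4 * Real.log (2 : ℕ) * Real.log (2 : ℕ) := by
    push_cast
    nlinarith
  refine le_trans ?_ (Real.exp_le_exp.2 h2)
  have h3 : Real.exp 1.92 = Real.exp 0.48 ^ 4 := by
    rw [← Real.exp_nat_mul]
    norm_num
  have h4 := Real.quadratic_le_exp_of_nonneg (x := 0.48) (by norm_num)
  rw [h3]
  calc ((5 : ℕ) : ℝ) ≤ (1 + 0.48 + 0.48 ^ 2 / 2) ^ 4 := by norm_num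
    _ ≤ _ := by gcongr

/-- For `N ≥ 3` one has `4 * (ln N) ^ 2 ≥ 4 * ln N + 1 / 3`, so the power exceeds `exp (1 / 3) * N ^
4 ≥ (4 / 3) * N ^ 4`, and a third of `N ^ 4` is at least `N ^ 3`. -/
lemma le_rBound {N : ℕ} (hN : 3 ≤ N) : N ^ 4 + N ^ 3 ≤ rBound N := by
  have hN' : (3 : ℝ) ≤ N := by exact_mod_cast hN
  have hN0 : (0 : ℝ) < N := by linarith
  have h1 : 1.09 ≤ Real.log N :=
    (by linarith [Real.log_three_gt_d9] : (1.09 : ℝ) ≤ Real.log 3).trans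
      (Real.log_le_log (by norm_num) hN')
  refine Nat.le_floor ?_
  rw [rpow_log_eq (by omega)]
  have h2 : Real.log N * 4 + 1 / 3 ≤ 4 * Real.log N * Real.log N := by nlinarith
  refine le_trans ?_ (Real.exp_le_exp.2 h2)
  have h3 : Real.exp (Real.log N * 4) = (N : ℝ) ^ 4 := by
    rw [← Real.rpow_def_of_pos hN0]
    norm_cast
  rw [Real.exp_add, h3]
  have h4 : (1 / 3 : ℝ) + 1 ≤ Real.exp (1 / 3) := Real.add_one_le_exp _
  have h5 : (N : ℝ) ^ 3 * 3 ≤ N ^ 4 := by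
    rw [pow_succ _ 3]
    gcongr
  push_cast
  nlinarith [pow_pos hN0 4]

/-- Here `1 / a` is the width of the narrowest window and `t` the number of steps: the probability
of the path beats the required bound once `a ^ t < r ^ r`. -/
lemma pow_div_lt_pow_div {q a : ℝ} {r t : ℕ} (hq : 0 < q) (hq1 : q ≤ 1) (ht : t ≤ r) (ha : 0 < a)
    (h : a ^ t < (r : ℝ) ^ r) : (q / r) ^ r < (q / a) ^ t := by
  rw [div_pow, div_pow]
  have h1 : q ^ r ≤ q ^ t := pow_le_pow_of_le_one hq.le hq1 ht
  have h2 : 0 < a ^ t := by positivity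
  have h3 : 0 < q ^ r := by positivity
  rw [div_lt_div_iff₀ (h2.trans h) h2]
  calc q ^ r * a ^ t ≤ q ^ t * a ^ t := by gcongr
    _ < _ := by gcongr

lemma two_mul_add_three_le {N : ℕ} (hN : 3 ≤ N) : 2 * N + 3 ≤ 3 ^ (N - 1) := by
  induction N, hN using Nat.le_induction with
  | base => norm_num
  | succ n hn ih =>
    obtain ⟨k, rfl⟩ := Nat.exists_eq_add_of_le' (show 1 ≤ n by omega)
    simp only [Nat.add_sub_cancel] at ih ⊢
    rw [pow_succ]
    omega

/-- Everything is compared with powers of `3`: since `2 * N + 3 ≤ 3 ^ (N - 1)`, the base is at most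
`3 ^ (2 * N ^ 2 - 1)`. The total exponent is at most `4 * N ^ 4 + 4 * N ^ 2 - 3`, which is less than
`4 * r`, and `3 ^ 4 ≤ r`. -/
lemma window_pow_lt {N l t : ℕ} (hN : 3 ≤ N) (hl : l + 2 * N ≤ 2 * N ^ 2 + 1)
    (ht : t ≤ 2 * N ^ 2 + 3) :
    t ≤ rBound N ∧ ((2 * N + 3) ^ 2 * 3 ^ l) ^ t < rBound N ^ rBound N := by
  have hr := le_rBound hN
  have h3 : 3 * N ^ 2 ≤ N ^ 3 := by rw [pow_succ N 2, mul_comm]; gcongr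
  have h4 : 3 * N ^ 3 ≤ N ^ 4 := by rw [pow_succ N 3, mul_comm]; gcongr
  have h9 : 9 ≤ N ^ 2 := by nlinarith
  have h81 : 3 ^ 4 ≤ rBound N := by omega
  have h1 : (2 * N + 3) ^ 2 * 3 ^ l ≤ 3 ^ (2 * N ^ 2 - 1) := by
    calc (2 * N + 3) ^ 2 * 3 ^ l ≤ (3 ^ (N - 1)) ^ 2 * 3 ^ l := by
          gcongr
          exact two_mul_add_three_le hN
      _ = 3 ^ ((N - 1) * 2 + l) := by rw [← pow_mul, ← pow_add]
      _ ≤ _ := Nat.pow_le_pow_right (by norm_num) (by omega)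
  refine ⟨by omega, ?_⟩
  have h5 : (2 * N ^ 2 - 1) * (2 * N ^ 2 + 3) < 4 * rBound N := by
    obtain ⟨y, hy⟩ := Nat.exists_eq_add_of_le (show 1 ≤ 2 * N ^ 2 by omega)
    have e : 2 * N ^ 2 - 1 = y := by omega
    rw [e]
    have e2 : y * (2 * N ^ 2 + 3) + 3 = 4 * N ^ 4 + 4 * N ^ 2 := by
      have : 4 * N ^ 4 + 4 * N ^ 2 = (2 * N ^ 2) * (2 * N ^ 2 + 2) := by ring
      rw [this, hy]; ring
    omega
  calc ((2 * N + 3) ^ 2 * 3 ^ l) ^ t ≤ (3 ^ (2 * N ^ 2 - 1)) ^ (2 * N ^ 2 + 3) :=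
        (Nat.pow_le_pow_left h1 t).trans (Nat.pow_le_pow_right (by positivity) ht)
    _ = 3 ^ ((2 * N ^ 2 - 1) * (2 * N ^ 2 + 3)) := by rw [← pow_mul]
    _ < 3 ^ (4 * rBound N) := Nat.pow_lt_pow_right (by norm_num) h5
    _ = (3 ^ 4) ^ rBound N := by rw [← pow_mul]
    _ ≤ _ := Nat.pow_le_pow_left h81 _

end Numerics

/-! ### Region graphs with at least three regions. -/

section Many

variable {S Q X : Type*} {A : DTA Q S X} [Fintype S] [Finite Q] [Finite X]
  [MeasurableSpace S] [DiscreteMeasurableSpace S]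
  [MeasurableSpace Q] [DiscreteMeasurableSpace Q]
  {M : SMP S} {c : ℝ} {μ : Measure (State S Q X)} {p : ℕ} {W : Fin p → Set A.Region}

omit [Fintype S] [Finite Q] [Finite X] [MeasurableSpace S] [DiscreteMeasurableSpace S]
  [MeasurableSpace Q] [DiscreteMeasurableSpace Q] in
-- Some interval of delays has probability larger than `c`: the first unit interval of the support,
-- or the tail beyond `maxConst`.
lemma IsDelayBound.lt_one (hc : IsDelayBound M A c) (s : S) : c < 1 := by
  set f := M.delay s s
  suffices h : ENNReal.ofReal c < 1 by simpa using h
  have hl : ∀ t ∈ Set.Icc (f.left : ℝ) (f.left + 1), f.toFun t ≠ 0 := fun t => f.ne_zero_of_left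
  by_cases hB : f.left + 1 ≤ A.maxConst
  · have hB' : (f.left : ℝ) + 1 ≤ A.maxConst := by exact_mod_cast hB
    have := hc.lt_law_Ioo (s := s) (s' := s) (Nat.cast_nonneg f.left) (lt_add_one _) hB'
      fun t ht => hl t ⟨ht.1.le, ht.2.le⟩
    rw [add_sub_cancel_left, mul_one] at this
    exact this.trans_le prob_le_one
  · have e : (f.left : ℝ) + 1 / 2 = (1 / 2 : ℝ) + (f.left : ℝ) := add_comm _ _
    have hfl : ⌊(f.left : ℝ) + 1 / 2⌋₊ = f.left := by
      rw [e, Nat.floor_add_natCast (by norm_num)]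
      norm_num
    refine (hc.lt_law_Ioi (s := s) (s' := s) (t := f.left + 1 / 2) (by rw [hfl]; omega)
      (by rw [hfl]; norm_num) (by positivity)
      (hl _ ⟨by linarith, by linarith⟩)).trans_le prob_le_one

lemma exists_small_of_three_le (hc : IsDelayBound M A c)
    (hconn : StronglyConnected (vertices M A μ) (regionEdge M A μ))
    (hgrow : NoGrowingClocks M A μ) (hp : IsPeriod (regionEdge M A μ) p)
    (hW : IsCyclicDecomposition (vertices M A μ) (regionEdge M A μ) p W) (k : Fin p)
    (hne : (vertices M A μ).Nonempty) (hN : 3 ≤ (vertices M A μ).ncard) :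
    HasSmallSet M A p (W k) c (rBound (vertices M A μ).ncard) := by
  have hnice := niceGraph hc hconn
  set N := (vertices M A μ).ncard with hNdef
  have hN' : (3 : ℝ) ≤ N := by exact_mod_cast hN
  set m := N + 1 with hm
  -- The meeting region lies in the class that is reached after `m` descents.
  obtain ⟨Rs, hRs⟩ := NiceGraph.cls_nonempty hW hnice hne (k + m)
  obtain ⟨L, hL, ⟨L', hL'⟩, hLw⟩ := NiceGraph.exists_uniform_walk hW hnice hp hRs
  obtain ⟨v, hv⟩ := NiceGraph.cls_nonempty hW hnice hne k
  obtain ⟨z₁, rfl⟩ : ∃ z, A.reg z = v := ⟨v.out, Quotient.out_eq v⟩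
  have hS : Nonempty S := ⟨z₁.1⟩
  have hc0 := hc.1
  have hp0 := M.pMin_pos
  -- The largest `η` that `m = N + 1` descents allow, namely `(2 * m + 1) * η = 1`; the walk of
  -- length `L` then divides the gap by `3` at each step.
  set η : ℝ := 1 / (2 * N + 3) with hη
  have hη0 : 0 < η := by positivity
  have hηm : (2 * (m : ℝ) + 1) * η = 1 := by rw [hη, hm]; push_cast; field_simp; ring
  set δ : ℝ := η / 3 ^ L with hδ
  have hδ0 : 0 < δ := by positivity
  have hδη : δ ≤ η := div_le_self hη0.le (one_le_pow₀ (by norm_num))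
  have hη1 : η ≤ 1 := by rw [hη]; exact (div_le_one (by positivity)).2 (by linarith)
  -- The coupled descents must fit into the room `δ` instead of `1`.
  set η' : ℝ := δ / (2 * N + 3) with hη'
  have hη'0 : 0 < η' := by positivity
  have hηm' : (2 * (m : ℝ) + 1) * η' = δ := by rw [hη', hm]; push_cast; field_simp; ring
  have hη'δ : η' ≤ δ := div_le_self hδ0.le (by linarith)
  set G := A.stateSpace {Rs} ∩ {z | A.Sep δ z} with hG
  have hGm : MeasurableSet G := (A.measurableSet_stateSpace _).inter (measurableSet_sep δ)
  have phase1 : ∀ z ∈ A.stateSpace (W k), ENNReal.ofReal (M.pMin * (c * η)) ^ m *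
      ENNReal.ofReal (M.pMin * (c * δ)) ^ L ≤ (productKernel M A ^ (m + L)) z G := by
    intro z hz
    refine le_pow_add M A hGm (le_pow_descent hc hW (k := k) (Nat.lt_succ_self N) hη0 hηm.le m 0
      (zero_add m) z ?_ _ (descentInv_zero _ _ z)) fun y hy => ?_
    · rw [add_zero, cls_coe]
      exact hz
    · exact le_pow_of_walk hc (hLw _ hy.1) hη1 hy.2 hδ0 (by rw [hδ]; field_simp; rfl)
  have hzk : ∃ z, z ∈ A.stateSpace (W k) := by
    rw [cls_coe] at hv
    exact ⟨z₁, hv⟩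
  have hq0 : ENNReal.ofReal (M.pMin * (c * η)) ^ m * ENNReal.ofReal (M.pMin * (c * δ)) ^ L ≠ 0 := by
    refine mul_ne_zero (pow_ne_zero _ ?_) (pow_ne_zero _ ?_) <;>
    exact (ENNReal.ofReal_pos.2 (by positivity)).ne'
  obtain ⟨z₀, hz₀⟩ : G.Nonempty := by
    by_contra h
    rw [Set.not_nonempty_iff_eq_empty] at h
    obtain ⟨z, hz⟩ := hzk
    have := phase1 z hz
    rw [h, measure_empty] at this
    exact hq0 (le_zero_iff.1 this)
  have hroom : ∀ z ∈ G, ∀ x, A.Relevant z.2.2 x → δ - 2 * (0 : ℕ) * η' ≤ fr z x := by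
    intro z hz x hx
    have := (hz.2 x hx).1
    simpa using this
  have hz₀R : A.reg z₀ = Rs := hz₀.1
  have hT := A.measurableSet_stateSpace {A.reg z₁}
  obtain ⟨R', hw1, hR', hcouple⟩ := couples_of_descent hc (Nat.lt_succ_self N) hη'0 hηm'.le
    (hδη.trans hη1) hT m 0 (zero_add m) z₀ (by rw [hz₀R]; exact cls_subset hW _ hRs)
    (hroom z₀ hz₀)
  obtain ⟨d, -, hd, htour⟩ := hnice.exists_tour (f := A.regionResets) hR' (cls_subset hW _ hv)
    fun x => by
      obtain ⟨z, hz, hx⟩ := hgrow x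
      exact ⟨A.reg z, hz, by rw [← resets_eq]; exact hx⟩
  rw [hz₀R] at hw1
  set w : ℝ := η' / 3 ^ d with hw
  have hw0 : 0 < w := by positivity
  have hwη : w ≤ η' := div_le_self hη'0.le (one_le_pow₀ (by norm_num))
  have hcd := hcouple d _ (couples_of_tour hc htour (hη'δ.trans (hδη.trans hη1)) hw0
    (by rw [hw]; field_simp; rfl))
  rw [hz₀R] at hcd
  -- The coupled part leads from class `k + m` to class `k` in `m + d` steps, so `p` divides `2 * m
  -- + d`; it divides `L` by construction.
  have hdiv : p ∣ (m + L) + (d + m) := by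
    have h1 := cls_walk hW (cls_walk hW hRs hw1) htour.walk
    have h2 := cls_index hW h1 hv
    obtain ⟨u, hu⟩ := hzk
    have h3 : A.reg u ∈ cls W k := by rw [cls_coe]; exact hu
    rw [hL']
    have : (k + 0) % p = (k + (m + m + d)) % p := by rw [add_zero, ← h2]; congr 1; ring
    have := (Nat.modEq_zero_iff_dvd.1 (Nat.ModEq.add_left_cancel' _ this).symm)
    obtain ⟨e, he⟩ := this
    exact ⟨L' + e, by rw [mul_add, ← he]; ring⟩
  obtain ⟨κ, hκ, hκR, hmin⟩ := exists_minorizing hT hGm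
    (fun z hz z' hz' => ⟨hz.1, hz'.1, hroom z hz, hroom z' hz', _, descentInv_zero _ _ z,
      fun x hx => absurd trivial hx⟩) hcd hq0
    (mul_ne_zero (pow_ne_zero _ (ENNReal.ofReal_pos.2 (by positivity)).ne')
      (pow_ne_zero _ (ENNReal.ofReal_pos.2 (by positivity)).ne')) phase1 hzk
  -- From `L ≤ N * (N - 1)` and `d ≤ (N - 1) ^ 2 + N`.
  have hLd : (L + d) + 2 * N ≤ 2 * N ^ 2 + 1 ∧ (m + L) + (d + m) ≤ 2 * N ^ 2 + 3 := by
    obtain ⟨y, hy⟩ := Nat.exists_eq_add_of_le (show 1 ≤ N by omega)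
    rw [← hNdef, hy, Nat.add_sub_cancel_left] at hL hd
    rw [hm, hy]
    constructor <;> nlinarith
  obtain ⟨htr, hpow⟩ := window_pow_lt hN hLd.1 hLd.2
  have hweq : M.pMin * (c * w) = M.pMin * c / (((2 * N + 3) ^ 2 * 3 ^ (L + d) : ℕ) : ℝ) := by
    rw [hw, hη', hδ, hη]
    push_cast
    rw [pow_add]
    field_simp
  have hlt := pow_div_lt_pow_div (q := M.pMin * c) (a := (((2 * N + 3) ^ 2 * 3 ^ (L + d) : ℕ) : ℝ))
    (by positivity) (mul_le_one₀ M.pMin_le_one hc0.le (hc.lt_one z₁.1).le) htr (by positivity)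
    (by exact_mod_cast hpow)
  rw [← hweq] at hlt
  rw [cls_coe] at hv
  have hr0 : 0 < rBound N := by omega
  refine small_of_minorizing hc hW hv hκ hκR (by omega) hdiv hmin
    (b := (M.pMin * c / rBound N) ^ rBound N) (by positivity)
    (lt_of_lt_of_le ((ENNReal.ofReal_lt_ofReal_iff (by positivity)).2 hlt) ?_) htr le_rfl
  rw [ENNReal.ofReal_pow (by positivity)]
  calc ENNReal.ofReal (M.pMin * (c * w)) ^ (m + L + (d + m))
      = ENNReal.ofReal (M.pMin * (c * w)) ^ m * ENNReal.ofReal (M.pMin * (c * w)) ^ L *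
        (ENNReal.ofReal (M.pMin * (c * w)) ^ m * ENNReal.ofReal (M.pMin * (c * w)) ^ d) := by
        rw [pow_add, pow_add, pow_add]; ring
    _ ≤ _ := by
        have hle : ∀ u n, w ≤ u → ENNReal.ofReal (M.pMin * (c * w)) ^ n ≤
            ENNReal.ofReal (M.pMin * (c * u)) ^ n := fun u n h =>
              pow_le_pow_left' (bound_mono hc h) n
        exact mul_le_mul' (mul_le_mul' (hle η m (by linarith)) (hle δ L (by linarith)))
          (mul_le_mul' (hle η' m hwη) le_rfl)

end Many

/-! ### Unit windows of delays. -/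

section UnitWindows

variable {S Q X : Type*} {A : DTA Q S X}

/-- The delays with integral part `k`, or all delays above `maxConst` if `maxConst ≤ k`. -/
def DTA.unitWindow (A : DTA Q S X) (k : ℕ) : Set ℝ :=
  if k < A.maxConst then Set.Ioo (k : ℝ) (k + 1) else Set.Ioi (A.maxConst : ℝ)

lemma measurableSet_unitWindow (k : ℕ) : MeasurableSet (A.unitWindow k) := by
  rw [DTA.unitWindow]
  split_ifs
  · exact measurableSet_Ioo
  · exact measurableSet_Ioi

lemma IsDelayBound.lt_law_unitWindow {M : SMP S} {c : ℝ} (hc : IsDelayBound M A c) {s s' : S}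
    {t : ℝ} (h0 : 0 ≤ t) (ht : Int.fract t ≠ 0) (h : (M.delay s s').toFun t ≠ 0) :
    ENNReal.ofReal c < (M.delay s s').law (A.unitWindow ⌊t⌋₊) := by
  have hne : t ≠ ⌊t⌋₊ := fun h1 => ht (by rw [h1, Int.fract_natCast])
  rw [DTA.unitWindow]
  split_ifs with hB
  · have hB' : (⌊t⌋₊ : ℝ) + 1 ≤ A.maxConst := by exact_mod_cast hB
    have := hc.lt_law_Ioo (s := s) (s' := s') (Nat.cast_nonneg ⌊t⌋₊) (lt_add_one _) hB'
      fun u hu => (M.delay s s').ne_zero_of_floor h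
        (lt_of_le_of_ne (Nat.floor_le h0) hne.symm) (Nat.lt_floor_add_one t) ⟨hu.1.le, hu.2.le⟩
    rwa [add_sub_cancel_left, mul_one] at this
  · exact hc.lt_law_Ioi (not_lt.1 hB) hne h0 h

/-- All windows beyond `maxConst` coincide, so only finitely many strict inequalities are involved
and `c` can be increased a little in all of them. -/
lemma IsDelayBound.exists_gt [Finite S] {M : SMP S} {c : ℝ} (hc : IsDelayBound M A c) :
    ∃ c₁ > c, ∀ (s s' : S) (t : ℝ), 0 ≤ t → Int.fract t ≠ 0 → (M.delay s s').toFun t ≠ 0 →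
      ENNReal.ofReal c₁ ≤ (M.delay s s').law (A.unitWindow ⌊t⌋₊) := by
  let g : S × S × Fin (A.maxConst + 1) → ℝ≥0∞ := fun i =>
    (M.delay i.1 i.2.1).law (A.unitWindow i.2.2)
  have hev : ∀ i, ∀ᶠ c₁ in nhdsWithin c (Set.Ioi c),
      ENNReal.ofReal c < g i → ENNReal.ofReal c₁ ≤ g i := by
    intro i
    by_cases h : ENNReal.ofReal c < g i
    · have := (ENNReal.continuous_ofReal.tendsto c).eventually (gt_mem_nhds h)
      exact (this.filter_mono nhdsWithin_le_nhds).mono fun x hx _ => hx.le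
    · exact Filter.Eventually.of_forall fun x hx => absurd hx h
  obtain ⟨c₁, h1, h2⟩ := ((Filter.eventually_all.2 hev).and self_mem_nhdsWithin).exists
  refine ⟨c₁, h2, fun s s' t h0 ht h => ?_⟩
  have e : A.unitWindow ⌊t⌋₊ = A.unitWindow (min ⌊t⌋₊ A.maxConst) := by
    by_cases hB : ⌊t⌋₊ < A.maxConst
    · rw [min_eq_left hB.le]
    · rw [min_eq_right (not_lt.1 hB), DTA.unitWindow, DTA.unitWindow, if_neg hB,
        if_neg (lt_irrefl _)]
  have := h1 (s, s', ⟨min ⌊t⌋₊ A.maxConst, by omega⟩)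
  simp only [g, ← e] at this
  exact this (hc.lt_law_unitWindow h0 ht h)

end UnitWindows

/-! ### The fast case: the fractional parts play no role. -/

section Fast

variable {S Q X : Type*} {A : DTA Q S X}

/-- Each clock that is not reset becomes irrelevant in the next step, whatever its fractional
part. -/
def Fast (M : SMP S) (A : DTA Q S X) (V : Set A.Region) : Prop :=
  ∀ z, A.reg z ∈ V → ∀ s', M.trans z.1 s' ≠ 0 → ∀ x ∉ A.resets z, A.Relevant z.2.2 x →
    A.maxConst ≤ ⌊(z.2.2 x : ℝ)⌋₊ + (M.delay z.1 s').left

/-- Clocks that are relevant after the move have just been reset, so all of them equal the delay,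
and the region depends only on the unit window. -/
lemma regionRel_moveTo_of_unitWindow {z z' : State S Q X} (h : A.RegionRel z z') (s' : S)
    {l k : ℕ} (hlk : l ≤ k) (hz : ∀ x ∉ A.resets z, (A.maxConst : ℝ) ≤ A.base z x + l)
    (hz' : ∀ x ∉ A.resets z', (A.maxConst : ℝ) ≤ A.base z' x + l) {t u : ℝ}
    (ht : t ∈ A.unitWindow k) (hu : u ∈ A.unitWindow k) :
    A.RegionRel (moveTo A z (s', t)) (moveTo A z' (s', u)) := by
  rw [DTA.unitWindow] at ht hu
  split_ifs at ht hu with hB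
  swap
  · exact regionRel_moveTo_of_gt h s' ht hu
  have hl : (l : ℝ) ≤ k := by exact_mod_cast hlk
  have hk : (0 : ℝ) ≤ k := Nat.cast_nonneg k
  have hB' : (k : ℝ) + 1 ≤ A.maxConst := by exact_mod_cast hB
  have hr := (edge_congr h).1
  have e : ∀ x, A.base z x + t ≤ A.maxConst → A.base z x = 0 ∧ A.base z' x = 0 := by
    intro x hx
    by_cases hxr : x ∈ A.resets z
    · exact ⟨base_reset hxr, base_reset (hr ▸ hxr)⟩
    · linarith [hz x hxr, ht.1]
  have e' : ∀ x, A.base z' x + u ≤ A.maxConst → A.base z x = 0 := by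
    intro x hx
    by_cases hxr : x ∈ A.resets z
    · exact base_reset hxr
    · linarith [hz' x (hr ▸ hxr), hu.1]
  have hfl : ∀ v ∈ Set.Ioo (k : ℝ) (k + 1), ⌊v⌋ = k ∧ Int.fract v ≠ 0 := by
    intro v hv
    have hf : ⌊v⌋ = k := by
      rw [Int.floor_eq_iff]
      exact ⟨by exact_mod_cast hv.1.le, by exact_mod_cast hv.2⟩
    refine ⟨hf, ?_⟩
    rw [Int.fract, hf]
    have := hv.1
    push_cast
    exact sub_ne_zero.2 this.ne'
  refine regionRel_moveTo h s' (hk.trans ht.1.le) (hk.trans hu.1.le) (fun x => ⟨fun hx => ?_,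
    fun hx => ?_⟩) (fun x hx => ?_) fun x y hx hy => ?_
  · rw [(e x hx).2]
    linarith [hu.2]
  · rw [e' x hx]
    linarith [ht.2]
  · rw [(e x hx).1, (e x hx).2, zero_add, zero_add]
    obtain ⟨h1, h2⟩ := hfl t ht
    obtain ⟨h3, h4⟩ := hfl u hu
    exact ⟨h1.trans h3.symm, iff_of_false h2 h4⟩
  · rw [(e x hx).1, (e x hx).2, (e y hy).1, (e y hy).2]
    exact iff_of_true le_rfl le_rfl

variable [Fintype S] [Finite Q] [Finite X]
  [MeasurableSpace S] [DiscreteMeasurableSpace S]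
  [MeasurableSpace Q] [DiscreteMeasurableSpace Q]
  {M : SMP S} {c : ℝ} {μ : Measure (State S Q X)}

/-- An edge of the region graph is taken for all delays in some unit window. -/
lemma Fast.exists_unitWindow (hfast : Fast M A (vertices M A μ)) {c₁ : ℝ}
    (hc₁ : ∀ (s s' : S) (t : ℝ), 0 ≤ t → Int.fract t ≠ 0 → (M.delay s s').toFun t ≠ 0 →
      ENNReal.ofReal c₁ ≤ (M.delay s s').law (A.unitWindow ⌊t⌋₊)) {R R' : A.Region}
    (h : regionEdge M A μ R R') :
    ∃ (s' : S) (k : ℕ), ∀ z, A.reg z = R →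
      (∀ u ∈ A.unitWindow k, A.reg (moveTo A z (s', u)) = R') ∧
      ENNReal.ofReal (M.pMin * c₁) ≤ moveLaw M z.1 {y | y.1 = s' ∧ y.2 ∈ A.unitWindow k} := by
  obtain ⟨hR, -, z₀, rfl, h2⟩ := h
  change A.reg z₀ ∈ _ at hR
  obtain ⟨s', t, ht, h0, hft, hti, -, hmv⟩ := exists_move_of_pos h2.ne'
  have hl : (M.delay z₀.1 s').left ≤ ⌊t⌋₊ := by
    refine Nat.le_floor ?_
    by_contra! hlt
    exact hft ((M.delay z₀.1 s').eq_zero_of_lt_left hlt)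
  have hbase : ∀ z, A.reg z = A.reg z₀ → ∀ x ∉ A.resets z,
      (A.maxConst : ℝ) ≤ A.base z x + (M.delay z₀.1 s').left := by
    intro z hz x hx
    have hs := (reg_eq.1 hz).1
    rw [base_of_notMem hx]
    have hl0 : (0 : ℝ) ≤ (M.delay z₀.1 s').left := Nat.cast_nonneg _
    by_cases hr : A.Relevant z.2.2 x
    · have h1 := hfast z (hz ▸ hR) s' (hs ▸ ht) x hx hr
      rw [hs] at h1
      have h2 : (A.maxConst : ℝ) ≤ ⌊(z.2.2 x : ℝ)⌋₊ + (M.delay z₀.1 s').left := by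
        exact_mod_cast h1
      linarith [Nat.floor_le (NNReal.coe_nonneg (z.2.2 x))]
    · rw [relevant_iff] at hr
      linarith
  have htw : t ∈ A.unitWindow ⌊t⌋₊ := by
    have h1 : (⌊t⌋₊ : ℝ) < t := lt_of_le_of_ne (Nat.floor_le h0)
      fun h1 => hti (by rw [← h1, Int.fract_natCast])
    rw [DTA.unitWindow]
    split_ifs with hB
    · exact ⟨h1, Nat.lt_floor_add_one t⟩
    · exact lt_of_le_of_lt (by exact_mod_cast not_lt.1 hB) h1
  refine ⟨s', ⌊t⌋₊, fun z hz => ⟨fun u hu => ?_, ?_⟩⟩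
  · rw [← show A.reg (moveTo A z₀ (s', t)) = _ from hmv]
    exact reg_eq.2 (regionRel_moveTo_of_unitWindow (reg_eq.1 hz) s' hl (hbase z hz)
      (hbase z₀ rfl) hu htw)
  · have : Nonempty S := ⟨z₀.1⟩
    rw [(reg_eq.1 hz).1]
    exact (ofReal_mul_le M ht (hc₁ _ _ t h0 hti hft)).trans
      (le_moveLaw M z₀.1 s' _ _ fun u hu => ⟨rfl, hu⟩)

lemma Fast.le_pow_of_walk (hfast : Fast M A (vertices M A μ)) {c₁ : ℝ}
    (hc₁ : ∀ (s s' : S) (t : ℝ), 0 ≤ t → Int.fract t ≠ 0 → (M.delay s s').toFun t ≠ 0 →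
      ENNReal.ofReal c₁ ≤ (M.delay s s').law (A.unitWindow ⌊t⌋₊)) {n : ℕ} {z : State S Q X}
    {R : A.Region} (h : Walk (regionEdge M A μ) n (A.reg z) R) :
    ENNReal.ofReal (M.pMin * c₁) ^ n ≤ (productKernel M A ^ n) z (A.stateSpace {R}) := by
  have hm := A.measurableSet_stateSpace {R}
  induction n generalizing z with
  | zero =>
    rw [pow_zero]
    exact one_le_pow_zero M A hm h
  | succ n ih =>
    obtain ⟨R₁, h1, h2⟩ := h
    obtain ⟨s', k, hk⟩ := hfast.exists_unitWindow hc₁ h1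
    obtain ⟨h3, h4⟩ := hk z rfl
    rw [pow_succ']
    refine le_pow_succ M A hm (G := A.stateSpace {R₁}) (h4.trans (measure_mono ?_)) fun y hy => ?_
    · rintro ⟨s, u⟩ ⟨rfl, hu⟩
      exact h3 u hu
    · rw [mem_stateSpace_singleton] at hy
      exact ih (hy ▸ h2)

/-- Equivalent states can share any delay of a unit window and stay equivalent, so no agreement or
gap is needed at the start. -/
lemma Fast.couples_of_tour (hfast : Fast M A (vertices M A μ)) {c₁ : ℝ}
    (hc₁ : ∀ (s s' : S) (t : ℝ), 0 ≤ t → Int.fract t ≠ 0 → (M.delay s s').toFun t ≠ 0 →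
      ENNReal.ofReal c₁ ≤ (M.delay s s').law (A.unitWindow ⌊t⌋₊)) {n : ℕ} {R R' : A.Region}
    {Y : Set X} (h : Tour (regionEdge M A μ) A.regionResets n R Y R') :
    Couples M A (A.stateSpace {R'}) n (ENNReal.ofReal (M.pMin * c₁) ^ n)
      fun z z' => A.reg z = R ∧ A.reg z' = R ∧ ∀ x ∈ Y, z.2.2 x = z'.2.2 x := by
  have hR' := A.measurableSet_stateSpace {R'}
  induction n generalizing R Y with
  | zero =>
    obtain ⟨rfl, rfl⟩ := h
    rw [pow_zero]
    refine couples_zero hR' fun z z' ⟨h1, h2, h3⟩ => ⟨?_, h1⟩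
    have hrel := reg_eq.1 (h1.trans h2.symm)
    exact Prod.ext hrel.1 (Prod.ext hrel.2.1 (funext fun x => h3 x trivial))
  | succ n ih =>
    obtain ⟨R₁, h1, h2⟩ := h
    obtain ⟨s', k, hk⟩ := hfast.exists_unitWindow hc₁ h1
    have hU : MeasurableSet {u : State S Q X × (S × ℝ) | u.2.1 = s' ∧ u.2.2 ∈ A.unitWindow k} := by
      refine MeasurableSet.inter ?_ ?_
      · exact measurable_snd.fst (MeasurableSet.of_discrete (s := {s'}))
      · exact measurable_snd.snd (measurableSet_unitWindow k)
    rw [pow_succ']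
    refine Couples.step hR' hU (fun z z' ⟨h3, h4, h5⟩ => ?_) (fun z hz => (hk z hz.1).2) (ih h2)
    have hrel := reg_eq.1 (h3.trans h4.symm)
    refine ⟨hrel.1, fun y => Iff.rfl, ?_⟩
    rintro ⟨_, u⟩ ⟨rfl, hu⟩
    refine ⟨⟨(hk z h3).1 u hu, (hk z' h4).1 u hu, fun x hx => ?_⟩, (hk z h3).1 u hu,
      (hk z h3).1 u hu, fun _ _ => rfl⟩
    have e1 := (edge_congr hrel).1
    by_cases hxr : x ∈ A.resets z
    · rw [(moveTo_apply z _ x).1 hxr, (moveTo_apply z' _ x).1 (e1 ▸ hxr)]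
    · rcases hx with hx | hx
      · rw [(moveTo_apply z _ x).2 hxr, (moveTo_apply z' _ x).2 (e1 ▸ hxr), h5 x hx]
      · rw [← h3, ← resets_eq] at hx
        exact absurd hx hxr

variable {p : ℕ} {W : Fin p → Set A.Region}

/-- A walk of common length and a tour suffice. For `N = 1` and `r = 1` the required bound leaves no
slack in the numbers, and the strict inequality rests on `c₁ > c`. -/
lemma Fast.exists_small (hc : IsDelayBound M A c)
    (hconn : StronglyConnected (vertices M A μ) (regionEdge M A μ))
    (hgrow : NoGrowingClocks M A μ) (hp : IsPeriod (regionEdge M A μ) p)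
    (hW : IsCyclicDecomposition (vertices M A μ) (regionEdge M A μ) p W) (k : Fin p)
    (hne : (vertices M A μ).Nonempty) (hfast : Fast M A (vertices M A μ)) {r : ℕ}
    (hr : (vertices M A μ).ncard * ((vertices M A μ).ncard - 1) +
      (((vertices M A μ).ncard - 1) * ((vertices M A μ).ncard - 1) + (vertices M A μ).ncard) ≤ r) :
    HasSmallSet M A p (W k) c r := by
  have hnice := niceGraph hc hconn
  obtain ⟨c₁, hcc, hc₁⟩ := hc.exists_gt
  obtain ⟨v, hv⟩ := NiceGraph.cls_nonempty hW hnice hne k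
  obtain ⟨L, hL, hpL, hLw⟩ := NiceGraph.exists_uniform_walk hW hnice hp hv
  have hvV := cls_subset hW _ hv
  obtain ⟨d, hd0, hd, htour⟩ := hnice.exists_tour (f := A.regionResets) hvV hvV fun x => by
    obtain ⟨z, hz, hx⟩ := hgrow x
    exact ⟨A.reg z, hz, by rw [← resets_eq]; exact hx⟩
  obtain ⟨z₁, rfl⟩ : ∃ z, A.reg z = v := ⟨v.out, Quotient.out_eq v⟩
  have hS : Nonempty S := ⟨z₁.1⟩
  have hc0 := hc.1
  have hp0 := M.pMin_pos
  have hc10 : 0 < c₁ := hc0.trans hcc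
  have hR := A.measurableSet_stateSpace {A.reg z₁}
  have hq : ∀ n, ENNReal.ofReal (M.pMin * c₁) ^ n ≠ 0 := fun n =>
    pow_ne_zero _ (ENNReal.ofReal_pos.2 (by positivity)).ne'
  rw [cls_coe] at hv hLw
  obtain ⟨κ, hκ, hκR, hmin⟩ := exists_minorizing hR hR
    (fun z hz z' hz' => ⟨hz, hz', fun x hx => absurd hx (Set.notMem_empty x)⟩)
    (hfast.couples_of_tour hc₁ htour) (hq L) (hq d)
    (fun z hz => hfast.le_pow_of_walk hc₁ (hLw (A.reg z) hz)) ⟨z₁, hv⟩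
  rw [← pow_add] at hmin
  have hr0 : (1 : ℝ) ≤ r := by exact_mod_cast (show 1 ≤ r by omega)
  have hq1 : M.pMin * c ≤ 1 := mul_le_one₀ M.pMin_le_one hc0.le (hc.lt_one z₁.1).le
  refine small_of_minorizing hc hW hv hκ hκR (by omega)
    (dvd_add hpL (dvd_of_closed_walk hp htour.walk)) hmin (b := (M.pMin * c / r) ^ r)
    (by positivity) ?_ (by omega) le_rfl
  rw [← ENNReal.ofReal_pow (by positivity)]
  refine (ENNReal.ofReal_lt_ofReal_iff (by positivity)).2 ?_
  calc (M.pMin * c / r) ^ r ≤ (M.pMin * c) ^ r :=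
        pow_le_pow_left₀ (by positivity) (div_le_self (by positivity) hr0) r
    _ ≤ (M.pMin * c) ^ (L + d) := pow_le_pow_of_le_one (by positivity) hq1 (by omega)
    _ < _ := pow_lt_pow_left₀ (by gcongr) (by positivity) (by omega)

end Fast

/-! ### Two regions without the fast property: the structure of the process. -/

section TwoRegions

variable {S Q X : Type*} {A : DTA Q S X}

lemma mem_Ico_of_reg_eq {z z' : State S Q X} (h : A.reg z = A.reg z') {x : X} {k : ℕ}
    (hk : k + 1 ≤ A.maxConst) (hx : (z.2.2 x : ℝ) ∈ Set.Ioo (k : ℝ) (k + 1)) :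
    (z'.2.2 x : ℝ) ∈ Set.Ico (k : ℝ) (k + 1) := by
  have hk' : (k : ℝ) + 1 ≤ A.maxConst := by exact_mod_cast hk
  have h1 := ((reg_eq.1 h).2.2.2.1 x ((relevant_iff _ _).2 (hx.2.le.trans hk'))).1
  rw [(Int.floor_eq_iff (z := (k : ℤ))).2 ⟨by exact_mod_cast hx.1.le, by exact_mod_cast hx.2⟩,
    eq_comm, Int.floor_eq_iff] at h1
  exact_mod_cast h1

lemma fr_eq_of_reg_eq {z z' : State S Q X} (h : A.reg z = A.reg z') {x y : X}
    (hx : A.Relevant z.2.2 x) (hy : A.Relevant z.2.2 y) (hxy : fr z x = fr z y) :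
    fr z' x = fr z' y := by
  have h5 := (reg_eq.1 h).2.2.2.2
  exact le_antisymm ((h5 x y hx hy).1 hxy.le) ((h5 y x hy hx).1 hxy.ge)

lemma fr_eq_sub {z : State S Q X} {x : X} {k : ℕ} (h : (z.2.2 x : ℝ) ∈ Set.Ico (k : ℝ) (k + 1)) :
    fr z x = z.2.2 x - k := by
  rw [fr, Int.fract, (Int.floor_eq_iff (z := (k : ℤ))).2
    ⟨by exact_mod_cast h.1, by exact_mod_cast h.2⟩]
  push_cast
  rfl

/-- If all clocks are equal after the edge, only the integer interval of their common value after
the delay matters. -/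
lemma regionRel_moveTo_of_const {z z' : State S Q X} (h : A.RegionRel z z') (s' : S)
    {a a' t t' : ℝ} (hz : ∀ x, A.base z x = a) (hz' : ∀ x, A.base z' x = a') (ht : 0 ≤ t)
    (ht' : 0 ≤ t') {k : ℕ} (hk : a + t ∈ Set.Ioo (k : ℝ) (k + 1))
    (hk' : a' + t' ∈ Set.Ioo (k : ℝ) (k + 1)) :
    A.RegionRel (moveTo A z (s', t)) (moveTo A z' (s', t')) := by
  have key : ∀ u ∈ Set.Ioo (k : ℝ) (k + 1), (u ≤ A.maxConst ↔ k + 1 ≤ A.maxConst) ∧ ⌊u⌋ = k ∧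
      Int.fract u ≠ 0 := by
    intro u hu
    have hf : ⌊u⌋ = k := by
      rw [Int.floor_eq_iff]
      exact ⟨by exact_mod_cast hu.1.le, by exact_mod_cast hu.2⟩
    refine ⟨⟨fun h => ?_, fun h => ?_⟩, hf, ?_⟩
    · have : (k : ℝ) < A.maxConst := hu.1.trans_le h
      exact_mod_cast this
    · have : (k : ℝ) + 1 ≤ A.maxConst := by exact_mod_cast h
      exact hu.2.le.trans this
    · rw [Int.fract, hf]
      exact sub_ne_zero.2 (by exact_mod_cast hu.1.ne')
  obtain ⟨h1, h2, h3⟩ := key _ hk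
  obtain ⟨h4, h5, h6⟩ := key _ hk'
  refine regionRel_moveTo h s' ht ht' (fun x => ?_) (fun x _ => ?_) fun x y _ _ => ?_
  · rw [hz, hz', h1, h4]
  · rw [hz, hz']
    exact ⟨h2.trans h5.symm, iff_of_false h3 h6⟩
  · rw [hz, hz, hz', hz']
    exact iff_of_true le_rfl le_rfl

/-- A region graph on two regions `R₁` and `R₂`: in `R₁` no clock is reset and all clocks are equal
and less than `1`; in `R₂` all clocks are reset. -/
structure TwoPhase (M : SMP S) (A : DTA Q S X) (s : S) (R₁ R₂ : A.Region) : Prop where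
  letter : ∀ z, A.reg z = R₁ ∨ A.reg z = R₂ → z.1 = s
  trans_ne : M.trans s s ≠ 0
  density_ne : ∀ t ∈ Set.Ioo (0 : ℝ) 1, (M.delay s s).toFun t ≠ 0
  one_le : 1 ≤ A.maxConst
  nonempty : Nonempty X
  first : ∀ z, A.reg z = R₁ → ∃ v ∈ Set.Ioo (0 : ℝ) 1, ∀ x, (z.2.2 x : ℝ) = v ∧ A.base z x = v
  second : ∀ z, A.reg z = R₂ → ∀ x, x ∈ A.resets z
  to_first : ∀ z, A.reg z = R₁ ∨ A.reg z = R₂ → ∀ a, (∀ x, A.base z x = a) → ∀ t, 0 ≤ t →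
    a + t ∈ Set.Ioo (0 : ℝ) 1 → A.reg (moveTo A z (s, t)) = R₁
  to_second : ∀ z, A.reg z = R₁ → ∀ a, (∀ x, A.base z x = a) → ∀ t, 0 ≤ t →
    a + t ∈ Set.Ioo (1 : ℝ) 2 → A.reg (moveTo A z (s, t)) = R₂

variable [Fintype S] [Finite Q] [Finite X]
  [MeasurableSpace S] [DiscreteMeasurableSpace S]
  [MeasurableSpace Q] [DiscreteMeasurableSpace Q]
  {M : SMP S} {c : ℝ} {μ : Measure (State S Q X)}

/-- Moves that do not follow an edge have probability zero, whereas an interval on which the density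
does not vanish has positive probability. -/
lemma exists_move_Ioo (hc : IsDelayBound M A c) {z : State S Q X}
    (hz : A.reg z ∈ vertices M A μ) {s' : S} (hs : M.trans z.1 s' ≠ 0) {a b : ℝ} (ha : 0 ≤ a)
    (hab : a < b) (h : ∀ t ∈ Set.Ioo a b, (M.delay z.1 s').toFun t ≠ 0) :
    ∃ t ∈ Set.Ioo a b, regionEdge M A μ (A.reg z) (A.reg (moveTo A z (s', t))) := by
  by_contra! hne
  have h0 : productKernel M A z (A.stateSpace {R | regionEdge M A μ (A.reg z) R})ᶜ = 0 :=
    measure_compl_stateSpace fun R hR => regionEdge_of_pos hc hz hR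
  rw [productKernel_apply, Measure.map_apply (measurable_moveTo_right A z)
    (A.measurableSet_stateSpace _).compl] at h0
  have h1 := le_moveLaw M z.1 s' (Set.Ioo a b) _ fun t ht => (show (s', t) ∈ moveTo A z ⁻¹'
    (A.stateSpace {R | regionEdge M A μ (A.reg z) R})ᶜ from hne t ht)
  rw [h0, le_zero_iff, mul_eq_zero] at h1
  refine h1.elim hs fun h2 => ?_
  have := (M.delay z.1 s').lt_law_Ioo le_rfl ha hab fun t ht =>
    lt_of_le_of_ne (NNReal.coe_nonneg _) (NNReal.coe_ne_zero.2 (h t ht)).symm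
  rw [h2] at this
  exact not_lt_zero this

/-- A clock `x` that violates `Fast` can reach two different integral parts in one step. These moves
already exhaust the two regions, and any further behaviour would need a third one. -/
lemma exists_twoPhase (hc : IsDelayBound M A c)
    (hconn : StronglyConnected (vertices M A μ) (regionEdge M A μ))
    (hgrow : NoGrowingClocks M A μ) (hN : (vertices M A μ).ncard = 2)
    (hfast : ¬ Fast M A (vertices M A μ)) :
    ∃ s R₁ R₂, vertices M A μ = {R₁, R₂} ∧ regionEdge M A μ R₁ R₁ ∧ TwoPhase M A s R₁ R₂ := by
  simp only [Fast, not_forall, not_le] at hfast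
  obtain ⟨z, hz, s, hs, x, hxr, hx, hlt⟩ := hfast
  have hf0 : 0 < fr z x := lt_of_le_of_ne (Int.fract_nonneg _) (fr_ne_zero hc hconn hz hx).symm
  have hf1 : fr z x < 1 := Int.fract_lt_one _
  obtain ⟨K, hK⟩ : ∃ K, K = ⌊(z.2.2 x : ℝ)⌋₊ := ⟨_, rfl⟩
  obtain ⟨l, hl⟩ : ∃ l, l = (M.delay z.1 s).left := ⟨_, rfl⟩
  have hd : ∀ t ∈ Set.Icc (l : ℝ) (l + 1), (M.delay z.1 s).toFun t ≠ 0 := fun t ht =>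
    (M.delay z.1 s).ne_zero_of_left (hl ▸ ht)
  rw [← hK, ← hl] at hlt
  have hl0 : (0 : ℝ) ≤ l := Nat.cast_nonneg l
  have hzx : (z.2.2 x : ℝ) = K + fr z x := by
    rw [fr_eq_sub (k := K), add_sub_cancel]
    rw [hK]
    exact ⟨Nat.floor_le (NNReal.coe_nonneg _), Nat.lt_floor_add_one _⟩
  -- With `t₁` the clock `x` stops before the integer `K + l + 1`, with `t₂` it passes it.
  obtain ⟨t₁, ht₁, e₁⟩ := exists_move_Ioo hc hz hs hl0 (b := l + 1 - fr z x) (by linarith)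
    fun t ht => hd t ⟨ht.1.le, by linarith [ht.2]⟩
  obtain ⟨t₂, ht₂, e₂⟩ := exists_move_Ioo hc hz hs (a := l + 1 - fr z x) (b := l + 1)
    (by linarith) (by linarith) fun t ht => hd t ⟨by linarith [ht.1], ht.2.le⟩
  have ht₁0 : 0 ≤ t₁ := hl0.trans ht₁.1.le
  have ht₂0 : 0 ≤ t₂ := by linarith [ht₂.1]
  obtain ⟨w₁, hw₁⟩ : ∃ w, w = moveTo A z (s, t₁) := ⟨_, rfl⟩
  obtain ⟨w₂, hw₂⟩ : ∃ w, w = moveTo A z (s, t₂) := ⟨_, rfl⟩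
  rw [← hw₁] at e₁
  rw [← hw₂] at e₂
  have v₁ : ∀ y, (w₁.2.2 y : ℝ) = A.base z y + t₁ := fun y => by rw [hw₁, moveTo_val _ _ ht₁0]
  have v₂ : ∀ y, (w₂.2.2 y : ℝ) = A.base z y + t₂ := fun y => by rw [hw₂, moveTo_val _ _ ht₂0]
  have x₁ := v₁ x
  have x₂ := v₂ x
  rw [base_of_notMem hxr, hzx] at x₁ x₂
  have hne : A.reg w₁ ≠ A.reg w₂ := by
    intro h
    have := (mem_Ico_of_reg_eq h (x := x) (k := K + l) (by omega)
      (by push_cast; constructor <;> linarith [ht₁.1, ht₁.2])).2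
    push_cast at this
    linarith [ht₂.1]
  have hV : vertices M A μ = {A.reg w₁, A.reg w₂} := by
    refine (Set.eq_of_subset_of_ncard_le ?_ ?_ (Set.toFinite _)).symm
    · rintro R (rfl | rfl)
      exacts [e₁.2.1, e₂.2.1]
    · rw [hN, Set.ncard_pair hne]
  have hzbd : (z.2.2 x : ℝ) ∈ Set.Ioo (K : ℝ) (K + 1) := by constructor <;> linarith
  -- The integral part of `x` is at least `K + 1` at `w₂`, so `z` is equivalent to `w₁`; comparing
  -- integral parts there gives `l = 0`.
  have hz₁ : A.reg z = A.reg w₁ := by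
    rw [hV] at hz
    refine hz.resolve_right fun h => ?_
    have := (mem_Ico_of_reg_eq h (by omega) hzbd).2
    linarith [ht₂.1]
  obtain rfl : l = 0 := by
    have := (mem_Ico_of_reg_eq hz₁ (by omega) hzbd).2
    have : (l : ℝ) < 1 := by linarith [ht₁.1]
    have : l < 1 := by exact_mod_cast this
    omega
  have hB : 1 ≤ A.maxConst := by omega
  have hB' : (1 : ℝ) ≤ A.maxConst := by exact_mod_cast hB
  simp only [Nat.cast_zero, zero_add] at ht₁ ht₂ hd
  have hs₁ : w₁.1 = s := by rw [hw₁]; rfl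
  have hs₂ : w₂.1 = s := by rw [hw₂]; rfl
  have hzs : z.1 = s := (reg_eq.1 hz₁).1.trans hs₁
  rw [hzs] at hs hd
  have hmem : ∀ R, R ∈ vertices M A μ → R = A.reg w₁ ∨ R = A.reg w₂ := fun R hR => by
    rw [hV] at hR
    exact hR
  -- There are no growing clocks, so a clock that is not reset in one of the two regions is reset in
  -- the other.
  have hreset : ∀ y, y ∉ A.resets z → y ∈ A.resets w₂ := by
    intro y hy
    obtain ⟨u, hu, hyu⟩ := hgrow y
    change y ∈ A.resets u at hyu
    rcases hmem (A.reg u) hu with h | h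
    · rw [resets_eq, h, ← hz₁, ← resets_eq] at hyu
      exact absurd hyu hy
    · rwa [resets_eq, h, ← resets_eq] at hyu
  have hstep : ∀ a b : ℝ, 0 ≤ a → a < b → b ≤ 1 → ∃ t ∈ Set.Ioo a b, ∃ w : State S Q X,
      (A.reg w = A.reg w₁ ∨ A.reg w = A.reg w₂) ∧ w = moveTo A w₂ (s, t) ∧
      ∀ y, (w.2.2 y : ℝ) = A.base w₂ y + t := by
    intro a b ha hab hb
    obtain ⟨t, ht, e⟩ := exists_move_Ioo hc (z := w₂) e₂.2.1 (s' := s) (by rwa [hs₂]) ha hab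
      fun t ht => by
        rw [hs₂]
        exact hd t ⟨by linarith [ht.1], by linarith [ht.2]⟩
    exact ⟨t, ht, _, hmem _ e.2.1, rfl, moveTo_val _ _ (ha.trans ht.1.le)⟩
  have hnone : ∀ y, y ∉ A.resets z := by
    intro y hy
    have y₁ := v₁ y
    have y₂ := v₂ y
    rw [base_reset hy, zero_add] at y₁ y₂
    by_cases hy₂ : y ∈ A.resets w₂
    -- If `y` is reset in both regions, `x` and `y` coincide after a move from `w₂`, but their
    -- fractional parts differ in both regions.
    · obtain ⟨t, ht, w, hw, -, v⟩ := hstep 0 1 le_rfl one_pos le_rfl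
      have vx := v x
      have vy := v y
      rw [base_reset (hreset x hxr), zero_add] at vx
      rw [base_reset hy₂, zero_add] at vy
      have heq : fr w x = fr w y := by rw [fr, fr, vx, vy]
      have rx : A.Relevant w.2.2 x := (relevant_iff _ _).2 (by linarith [ht.2])
      have ry : A.Relevant w.2.2 y := (relevant_iff _ _).2 (by linarith [ht.2])
      rcases hw with h | h
      · have := fr_eq_of_reg_eq h rx ry heq
        rw [fr_eq_sub (k := K) (by constructor <;> linarith [ht₁.1, ht₁.2]),
          fr_eq_sub (k := 0) (by push_cast; constructor <;> linarith [ht₁.1, ht₁.2])] at this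
        push_cast at this
        linarith
      · have := fr_eq_of_reg_eq h rx ry heq
        rw [fr_eq_sub (k := K + 1) (by push_cast; constructor <;> linarith [ht₂.1, ht₂.2]),
          fr_eq_sub (k := 0) (by push_cast; constructor <;> linarith [ht₂.1, ht₂.2])] at this
        push_cast at this
        linarith
    -- If `y` is not reset at `w₂`, it can be brought above `1`, but `y` is less than `1` in both
    -- regions.
    · obtain ⟨t, ht, w, hw, -, v⟩ := hstep (1 - t₂) 1 (by linarith [ht₂.2])
        (by linarith [ht₂.1]) le_rfl
      have vy := v y
      rw [base_of_notMem hy₂] at vy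
      rcases hw with h | h
      · have := (mem_Ico_of_reg_eq h.symm (x := y) (k := 0) (by omega)
          (by push_cast; constructor <;> linarith [ht₁.1, ht₁.2])).2
        push_cast at this
        linarith [ht.1]
      · have := (mem_Ico_of_reg_eq h.symm (x := y) (k := 0) (by omega)
          (by push_cast; constructor <;> linarith [ht₂.1, ht₂.2])).2
        push_cast at this
        linarith [ht.1]
  have hall : ∀ y, y ∈ A.resets w₂ := fun y => hreset y (hnone y)
  -- A move from `w₂` with delay below `1` makes all clocks equal and less than `1`. It cannot end
  -- in the region of `w₂`, where `x > 1`, so this describes the first region.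
  obtain ⟨t₃, ht₃, w₃, hw₃, e₃, v₃⟩ := hstep 0 1 le_rfl one_pos le_rfl
  simp only [base_reset (hall _), zero_add] at v₃
  have hw₃' : A.reg w₃ = A.reg z := by
    rw [hz₁]
    refine hw₃.resolve_right fun h => ?_
    have := (mem_Ico_of_reg_eq h (x := x) (k := 0) (by omega)
      (by rw [v₃]; push_cast; constructor <;> linarith [ht₃.1, ht₃.2])).2
    push_cast at this
    have hK0 : (0 : ℝ) ≤ K := Nat.cast_nonneg K
    linarith [ht₂.1]
  have hfirst : ∀ u, A.reg u = A.reg z → ∃ v ∈ Set.Ioo (0 : ℝ) 1,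
      ∀ y, (u.2.2 y : ℝ) = v ∧ A.base u y = v := by
    intro u hu
    have hbd : ∀ y, (u.2.2 y : ℝ) ∈ Set.Ico ((0 : ℕ) : ℝ) ((0 : ℕ) + 1) := fun y =>
      mem_Ico_of_reg_eq (hw₃'.trans hu.symm) (by omega)
        (by rw [v₃]; push_cast; constructor <;> linarith [ht₃.1, ht₃.2])
    have hrel : ∀ y, A.Relevant u.2.2 y := fun y => by
      have := (hbd y).2
      push_cast at this
      exact (relevant_iff _ _).2 (by linarith)
    have hval : ∀ y, (u.2.2 y : ℝ) = u.2.2 x := by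
      intro y
      have r : ∀ y, A.Relevant w₃.2.2 y := fun y =>
        (relevant_iff _ _).2 (by rw [v₃]; linarith [ht₃.2])
      have := fr_eq_of_reg_eq (hw₃'.trans hu.symm) (r y) (r x) (by rw [fr, fr, v₃, v₃])
      rwa [fr_eq_sub (hbd y), fr_eq_sub (hbd x), sub_left_inj] at this
    refine ⟨u.2.2 x, ⟨lt_of_le_of_ne (NNReal.coe_nonneg _) ?_, ?_⟩, fun y => ⟨hval y, ?_⟩⟩
    · have := fr_ne_zero hc hconn (hu ▸ hz) (hrel x)
      rw [fr_eq_sub (hbd x)] at this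
      push_cast at this
      rw [sub_zero] at this
      exact this.symm
    · have := (hbd x).2
      push_cast at this
      linarith
    · rw [base_of_notMem, hval]
      rw [resets_eq, hu, ← resets_eq]
      exact hnone y
  obtain ⟨v, hv, hvz⟩ := hfirst z rfl
  have hfr : fr z x = v := by
    rw [fr, (hvz x).1, Int.fract_eq_self.2 ⟨hv.1.le, hv.2⟩]
  rw [hfr] at ht₁ ht₂
  have hsecond : ∀ u, A.reg u = A.reg w₂ → ∀ y, y ∈ A.resets u := fun u hu y => by
    rw [resets_eq, hu, ← resets_eq]
    exact hall y
  rw [← hz₁] at hV e₁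
  refine ⟨s, A.reg z, A.reg w₂, hV, e₁, ⟨?_, hs, fun t ht => hd t ⟨ht.1.le, ht.2.le⟩, hB, ⟨x⟩,
    hfirst, hsecond, ?_, ?_⟩⟩
  · rintro u (hu | hu)
    · exact (reg_eq.1 hu).1.trans hzs
    · exact (reg_eq.1 hu).1.trans hs₂
  · rintro u (hu | hu) a ha t ht hat
    · rw [hz₁, hw₁]
      exact reg_eq.2 (regionRel_moveTo_of_const (k := 0) (reg_eq.1 hu) s ha (fun y => (hvz y).2) ht
        ht₁0 (by simpa using hat) (by push_cast; constructor <;> linarith [ht₁.1, ht₁.2, hv.1]))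
    · rw [← hw₃', e₃]
      exact reg_eq.2 (regionRel_moveTo_of_const (k := 0) (reg_eq.1 hu) s ha
        (fun y => base_reset (hall y)) ht ht₃.1.le (by simpa using hat)
        (by push_cast; constructor <;> linarith [ht₃.1, ht₃.2]))
  · intro u hu a ha t ht hat
    rw [hw₂]
    exact reg_eq.2 (regionRel_moveTo_of_const (k := 1) (reg_eq.1 hu) s ha (fun y => (hvz y).2) ht
      ht₂0 (by push_cast; constructor <;> linarith [hat.1, hat.2])
      (by push_cast; constructor <;> linarith [ht₂.1, ht₂.2, hv.2]))

end TwoRegions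

/-! ### Two regions without the fast property: the small set. -/

section TwoRegionsSmall

variable {S Q X : Type*} {A : DTA Q S X} [Fintype S] [Finite Q] [Finite X]
  [MeasurableSpace S] [DiscreteMeasurableSpace S]
  [MeasurableSpace Q] [DiscreteMeasurableSpace Q]
  {M : SMP S} {c : ℝ} {μ : Measure (State S Q X)} {s : S} {R₁ R₂ : A.Region}

/-- The states in the first region with clock values in the interval. -/
def firstIn (R : A.Region) (a b : ℝ) : Set (State S Q X) :=
  {z | A.reg z = R ∧ ∀ x, (z.2.2 x : ℝ) ∈ Set.Ioo a b}

omit [Finite Q] [Finite X] [DiscreteMeasurableSpace S] [MeasurableSpace Q]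
  [DiscreteMeasurableSpace Q] in
lemma TwoPhase.le_law (hc : IsDelayBound M A c) (h : TwoPhase M A s R₁ R₂) {a b : ℝ} (ha : 0 ≤ a)
    (hb : b ≤ 1) : ENNReal.ofReal (M.pMin * (c * (b - a))) ≤
      moveLaw M s {y | y.1 = s ∧ y.2 ∈ Set.Ioo a b} := by
  have : Nonempty S := ⟨s⟩
  have hB : (1 : ℝ) ≤ A.maxConst := by exact_mod_cast h.one_le
  exact (ofReal_mul_le M h.trans_ne (hc.le_law_Ioo ha (hb.trans hB) fun t ht =>
    h.density_ne t ⟨by linarith [ht.1], by linarith [ht.2]⟩)).trans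
    (le_moveLaw M s s _ _ fun t ht => ⟨rfl, ht⟩)

omit [Finite Q] [Finite X] [DiscreteMeasurableSpace S] [MeasurableSpace Q]
  [DiscreteMeasurableSpace Q] in
lemma TwoPhase.le_first (hc : IsDelayBound M A c) (h : TwoPhase M A s R₁ R₂) {z : State S Q X}
    (hz : A.reg z = R₁ ∨ A.reg z = R₂) {a : ℝ} (ha : ∀ x, A.base z x = a) (ha0 : 0 ≤ a) {u v : ℝ}
    (hu : a ≤ u) (hv : v ≤ 1) : ENNReal.ofReal (M.pMin * (c * (v - u))) ≤
      moveLaw M z.1 {y | moveTo A z y ∈ firstIn R₁ u v} := by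
  have h1 := h.le_law hc (a := u - a) (b := v - a) (by linarith) (by linarith)
  rw [sub_sub_sub_cancel_right] at h1
  rw [h.letter z hz]
  refine h1.trans (measure_mono ?_)
  rintro ⟨_, t⟩ ⟨rfl, ht⟩
  have ht0 : 0 ≤ t := by linarith [ht.1]
  refine ⟨h.to_first z hz a ha t ht0 ⟨by linarith [ht.1], by linarith [ht.2]⟩, fun x => ?_⟩
  rw [moveTo_val _ _ ht0, ha]
  exact ⟨by linarith [ht.1], by linarith [ht.2]⟩

omit [Finite Q] [Finite X] [DiscreteMeasurableSpace S] [MeasurableSpace Q]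
  [DiscreteMeasurableSpace Q] in
-- From common clock value `u` the delays in `(1 - u, 1)` lead to the second region, and `u ≥ v`.
lemma TwoPhase.le_second (hc : IsDelayBound M A c) (h : TwoPhase M A s R₁ R₂) {z : State S Q X}
    (hz : A.reg z = R₁) {v : ℝ} (hv : ∀ x, v ≤ z.2.2 x) :
    ENNReal.ofReal (M.pMin * (c * v)) ≤
      moveLaw M z.1 {y | moveTo A z y ∈ A.stateSpace {R₂}} := by
  have : Nonempty S := ⟨s⟩
  obtain ⟨u, hu, hval⟩ := h.first z hz
  obtain ⟨x⟩ := h.nonempty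
  have hvu : v ≤ u := (hval x).1 ▸ hv x
  have h1 := h.le_law hc (a := 1 - u) (b := 1) (by linarith [hu.2]) le_rfl
  rw [sub_sub_cancel] at h1
  refine (bound_mono hc hvu).trans ?_
  rw [h.letter z (Or.inl hz)]
  refine h1.trans (measure_mono ?_)
  rintro ⟨_, t⟩ ⟨rfl, ht⟩
  exact h.to_second z hz u (fun x => (hval x).2) t (by linarith [ht.1, hu.2])
    ⟨by linarith [ht.1], by linarith [ht.2, hu.2]⟩

omit [Finite Q] [Finite X] in
lemma TwoPhase.le_second_pow (hc : IsDelayBound M A c) (h : TwoPhase M A s R₁ R₂)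
    {z : State S Q X} (hz : A.reg z = R₁) {v : ℝ} (hv : ∀ x, v ≤ z.2.2 x) :
    ENNReal.ofReal (M.pMin * (c * v)) ≤ (productKernel M A ^ 1) z (A.stateSpace {R₂}) := by
  rw [pow_one]
  exact (h.le_second hc hz hv).trans (le_productKernel M A z _)

/-- After three steps the second region has a probability that is bounded below. -/
lemma TwoPhase.le_pow_three (hc : IsDelayBound M A c) (h : TwoPhase M A s R₁ R₂)
    {z : State S Q X} (hz : A.reg z = R₁ ∨ A.reg z = R₂) :
    ENNReal.ofReal ((M.pMin * c) ^ 3 / 32) ≤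
      (productKernel M A ^ 3) z (A.stateSpace {R₂}) := by
  have : Nonempty S := ⟨s⟩
  have hc0 := hc.1
  have hp0 := M.pMin_pos
  have hq0 : 0 < M.pMin * c := by positivity
  have hm := A.measurableSet_stateSpace {R₂}
  have hbase : ∀ {w u v}, w ∈ firstIn R₁ u v → ∃ a ∈ Set.Ioo u v, ∀ x, A.base w x = a := by
    intro w u v hw
    obtain ⟨a, -, ha⟩ := h.first w hw.1
    obtain ⟨x⟩ := h.nonempty
    exact ⟨a, (ha x).1 ▸ hw.2 x, fun x => (ha x).2⟩
  -- From a base value of at most `1 / 2`, the clocks are raised to `(1 / 2, 3 / 4)`, then to `(3 /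
  -- 4, 1)`, then past `1`. The windows have product `3 / 64 ≥ 1 / 32`.
  have hslow : ∀ a, (∀ x, A.base z x = a) → 0 ≤ a → a ≤ 1 / 2 →
      ENNReal.ofReal ((M.pMin * c) ^ 3 / 32) ≤ (productKernel M A ^ 3) z (A.stateSpace {R₂}) := by
    intro a ha ha0 ha1
    have h2 : ∀ w ∈ firstIn R₁ (1 / 2) (3 / 4), ENNReal.ofReal (M.pMin * (c * (1 - 3 / 4))) *
        ENNReal.ofReal (M.pMin * (c * (3 / 4))) ≤
          (productKernel M A ^ 2) w (A.stateSpace {R₂}) := by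
      intro w hw
      obtain ⟨a', ha', hwa⟩ := hbase hw
      exact le_pow_succ M A hm (h.le_first hc (Or.inl hw.1) hwa (by linarith [ha'.1]) (u := 3 / 4)
        (v := 1) ha'.2.le le_rfl) fun w' hw' =>
          h.le_second_pow hc hw'.1 (v := 3 / 4) fun x => (hw'.2 x).1.le
    refine le_trans ?_ (le_pow_succ M A hm (h.le_first hc hz ha ha0 (u := 1 / 2) (v := 3 / 4) ha1
      (by norm_num)) h2)
    rw [← ENNReal.ofReal_mul (by positivity), ← ENNReal.ofReal_mul (by positivity)]
    exact ENNReal.ofReal_le_ofReal (by nlinarith [pow_pos hq0 3])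
  rcases hz with hz' | hz'
  · obtain ⟨a, ha, hval⟩ := h.first z hz'
    by_cases ha1 : a ≤ 1 / 2
    · exact hslow a (fun x => (hval x).2) ha.1.le ha1
    -- Larger values pass `1` at once, return to the first region in `(1 / 2, 1)` and pass `1`
    -- again; three windows of length at least `1 / 2`.
    · have h2 : ∀ w ∈ A.stateSpace {R₂}, ENNReal.ofReal (M.pMin * (c * (1 - 1 / 2))) *
          ENNReal.ofReal (M.pMin * (c * (1 / 2))) ≤
            (productKernel M A ^ 2) w (A.stateSpace {R₂}) := fun w hw =>
        le_pow_succ M A hm (h.le_first hc (Or.inr hw) (fun x => base_reset (h.second w hw x)) le_rfl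
          (u := 1 / 2) (v := 1) (by norm_num) le_rfl) fun w' hw' =>
            h.le_second_pow hc hw'.1 (v := 1 / 2) fun x => (hw'.2 x).1.le
      refine le_trans ?_ (le_pow_succ M A hm (h.le_second hc hz' (v := 1 / 2)
        fun x => by rw [(hval x).1]; linarith) h2)
      rw [← ENNReal.ofReal_mul (by positivity), ← ENNReal.ofReal_mul (by positivity)]
      exact ENNReal.ofReal_le_ofReal (by nlinarith [pow_pos hq0 3])
  · exact hslow 0 (fun x => base_reset (h.second z hz' x)) le_rfl (by norm_num)

/-- All clocks are reset in the second region, so a shared delay makes the states equal after one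
step. -/
lemma TwoPhase.couples (hc : IsDelayBound M A c) (h : TwoPhase M A s R₁ R₂) :
    Couples M A (A.stateSpace {R₁}) 1 (ENNReal.ofReal (M.pMin * c))
      fun z z' => A.reg z = R₂ ∧ A.reg z' = R₂ := by
  have hm := A.measurableSet_stateSpace {R₁}
  have hU : MeasurableSet {u : State S Q X × (S × ℝ) | u.2.1 = s ∧ u.2.2 ∈ Set.Ioo (0 : ℝ) 1} := by
    refine MeasurableSet.inter ?_ ?_
    · exact measurable_snd.fst (MeasurableSet.of_discrete (s := {s}))
    · exact measurable_snd.snd measurableSet_Ioo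
  have h0 := couples_zero (M := M) (A := A) hm
    (D := fun z z' => z = z' ∧ A.reg z = R₁) fun z z' hz => hz
  rw [← mul_one (ENNReal.ofReal (M.pMin * c))]
  refine Couples.step hm hU (fun z z' ⟨h1, h2⟩ => ?_) (fun z hz => ?_) h0
  · have hrel := reg_eq.1 (h1.trans h2.symm)
    refine ⟨hrel.1, fun y => Iff.rfl, ?_⟩
    rintro ⟨_, t⟩ ⟨rfl, ht⟩
    have hR := h.to_first z (Or.inr h1) 0 (fun x => base_reset (h.second z h1 x)) t ht.1.le
      (by rwa [zero_add])
    refine ⟨⟨Prod.ext rfl (Prod.ext (edge_congr hrel).2 (funext fun x => ?_)), hR⟩, rfl, hR⟩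
    rw [(moveTo_apply z _ x).1 (h.second z h1 x), (moveTo_apply z' _ x).1 (h.second z' h2 x)]
  · have h1 := h.le_law hc (a := 0) (b := 1) le_rfl le_rfl
    rw [sub_zero, mul_one] at h1
    rw [h.letter z (Or.inr hz.1)]
    exact h1

variable {p : ℕ} {W : Fin p → Set A.Region}

lemma exists_small_of_not_fast (hc : IsDelayBound M A c)
    (hconn : StronglyConnected (vertices M A μ) (regionEdge M A μ))
    (hgrow : NoGrowingClocks M A μ) (hp : IsPeriod (regionEdge M A μ) p)
    (hW : IsCyclicDecomposition (vertices M A μ) (regionEdge M A μ) p W) (k : Fin p)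
    (hN : (vertices M A μ).ncard = 2) (hfast : ¬ Fast M A (vertices M A μ)) {r : ℕ} (hr : 5 ≤ r) :
    HasSmallSet M A p (W k) c r := by
  obtain ⟨s, R₁, R₂, hV, he, h⟩ := exists_twoPhase hc hconn hgrow hN hfast
  have hS : Nonempty S := ⟨s⟩
  have hc0 := hc.1
  have hp0 := M.pMin_pos
  -- The loop at `R₁` forces the period to be `1`.
  obtain rfl : p = 1 := Nat.dvd_one.1 (dvd_of_closed_walk hp (⟨R₁, he, rfl⟩ : Walk _ 1 R₁ R₁))
  have hWk : W k = vertices M A μ := by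
    rw [← hW.union]
    refine Set.Subset.antisymm (Set.subset_iUnion W k) (Set.iUnion_subset fun i => ?_)
    rw [Subsingleton.elim i k]
  have hR₁ : R₁ ∈ W k := hWk ▸ he.1
  have hΓ : ∀ z ∈ A.stateSpace (W k), A.reg z = R₁ ∨ A.reg z = R₂ := by
    intro z hz
    rw [hWk, hV] at hz
    exact hz
  obtain ⟨z₁, rfl⟩ : ∃ z, A.reg z = R₁ := ⟨R₁.out, Quotient.out_eq R₁⟩
  have hq1 : ENNReal.ofReal ((M.pMin * c) ^ 3 / 32) ≠ 0 :=
    (ENNReal.ofReal_pos.2 (by positivity)).ne'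
  have hq2 : ENNReal.ofReal (M.pMin * c) ≠ 0 := (ENNReal.ofReal_pos.2 (by positivity)).ne'
  obtain ⟨κ, hκ, hκR, hmin⟩ := exists_minorizing (A.measurableSet_stateSpace {A.reg z₁})
    (A.measurableSet_stateSpace {R₂}) (fun z hz z' hz' => ⟨hz, hz'⟩) (h.couples hc) hq1 hq2
    (fun z hz => h.le_pow_three hc (hΓ z hz)) ⟨z₁, hR₁⟩
  refine small_of_minorizing hc hW hR₁ hκ hκR (by norm_num) (one_dvd _) hmin
    (b := (M.pMin * c / r) ^ r) (by positivity) ?_ (by omega) le_rfl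
  rw [← ENNReal.ofReal_mul (by positivity)]
  refine (ENNReal.ofReal_lt_ofReal_iff (by positivity)).2 ?_
  -- The four steps have probability at least `(pMin * c) ^ 4 / 32`, which exceeds `(pMin * c / 3) ^
  -- 4`.
  have hpow : (3 : ℝ) ^ 4 < (r : ℝ) ^ r := by
    have h1 : 5 ^ 5 ≤ r ^ r := (Nat.pow_le_pow_left hr 5).trans (Nat.pow_le_pow_right (by omega) hr)
    have h2 : 3 ^ 4 < r ^ r := lt_of_lt_of_le (by norm_num) h1
    exact_mod_cast h2
  refine (pow_div_lt_pow_div (q := M.pMin * c) (by positivity)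
    (mul_le_one₀ M.pMin_le_one hc0.le (hc.lt_one s).le) (by omega) (by norm_num) hpow).trans_le ?_
  have : 0 < (M.pMin * c) ^ 4 := by positivity
  rw [div_pow]
  linarith

end TwoRegionsSmall

/-! ### A single region. -/

section OneRegion

variable {S Q X : Type*} {A : DTA Q S X} [Fintype S] [Finite Q] [Finite X]
  [MeasurableSpace S] [DiscreteMeasurableSpace S]
  [MeasurableSpace Q] [DiscreteMeasurableSpace Q]
  {M : SMP S} {μ : Measure (State S Q X)}

omit [Finite Q] [Finite X] in
-- The only region resets every clock, so the condition on clocks that are not reset is empty.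
lemma fast_of_ncard_eq_one (hgrow : NoGrowingClocks M A μ) (hN : (vertices M A μ).ncard = 1) :
    Fast M A (vertices M A μ) := by
  intro z hz s' _ x hx _
  obtain ⟨u, hu, hxu⟩ := hgrow x
  obtain ⟨R, hR⟩ := Set.ncard_eq_one.1 hN
  rw [hR] at hz
  change A.reg u ∈ vertices M A μ at hu
  rw [hR] at hu
  change x ∈ A.resets u at hxu
  rw [resets_eq, (show A.reg u = A.reg z from hu.trans hz.symm), ← resets_eq] at hxu
  exact absurd hxu hx

end OneRegion

end SMPDTA

theorem mainTheorem3 {S Q X : Type*} [Fintype S] [Finite Q] [Finite X]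
    [MeasurableSpace S] [DiscreteMeasurableSpace S]
    [MeasurableSpace Q] [DiscreteMeasurableSpace Q]
    (M : SMPDTA.SMP S) (A : SMPDTA.DTA Q S X)
    (μ : MeasureTheory.Measure (SMPDTA.State S Q X)) [MeasureTheory.IsProbabilityMeasure μ]
    (hconn : SMPDTA.StronglyConnected (SMPDTA.vertices M A μ) (SMPDTA.regionEdge M A μ))
    (hgrow : SMPDTA.NoGrowingClocks M A μ)
    (p : ℕ) (hp : SMPDTA.IsPeriod (SMPDTA.regionEdge M A μ) p)
    (W : Fin p → Set A.Region)
    (hW : SMPDTA.IsCyclicDecomposition (SMPDTA.vertices M A μ) (SMPDTA.regionEdge M A μ) p W)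
    (c : ℝ) (hc : SMPDTA.IsDelayBound M A c) (k : Fin p) :
    ∃ R ∈ W k, ∃ T₀ : Set (SMPDTA.State S Q X), MeasurableSet T₀ ∧ T₀ ⊆ A.stateSpace {R} ∧
      ∃ (n : ℕ) (b : ℝ) (κ : MeasureTheory.Measure (SMPDTA.State S Q X)),
        0 < n ∧ 0 < b ∧ MeasureTheory.IsProbabilityMeasure κ ∧ κ T₀ = 1 ∧
        (∀ z ∈ A.stateSpace (W k), ∀ T, MeasurableSet T → T ⊆ T₀ → 0 < κ T →
          ENNReal.ofReal b * κ T < (SMPDTA.productKernel M A ^ (n * p)) z T) ∧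
        SMPDTA.IsSmall (SMPDTA.cyclicKernel M A p (W k)) Set.univ n b (κ.comap Subtype.val) ∧
        n * p ≤ SMPDTA.rBound (SMPDTA.vertices M A μ).ncard ∧
        (M.pMin * c / SMPDTA.rBound (SMPDTA.vertices M A μ).ncard) ^
          SMPDTA.rBound (SMPDTA.vertices M A μ).ncard ≤ b := by
  have hne := SMPDTA.vertices_nonempty (M := M) (A := A) (μ := μ)
  have hpos := (Set.ncard_pos (Set.toFinite _)).2 hne
  rcases (by omega : (SMPDTA.vertices M A μ).ncard = 1 ∨ (SMPDTA.vertices M A μ).ncard = 2 ∨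
    3 ≤ (SMPDTA.vertices M A μ).ncard) with hN | hN | hN
  · refine (SMPDTA.fast_of_ncard_eq_one hgrow hN).exists_small hc hconn hgrow hp hW k hne ?_
    rw [hN, SMPDTA.rBound_one]
  · by_cases hfast : SMPDTA.Fast M A (SMPDTA.vertices M A μ)
    · refine hfast.exists_small hc hconn hgrow hp hW k hne ?_
      rw [hN]
      exact SMPDTA.five_le_rBound_two
    · refine SMPDTA.exists_small_of_not_fast hc hconn hgrow hp hW k hN hfast ?_
      rw [hN]
      exact SMPDTA.five_le_rBound_two
  · exact SMPDTA.exists_small_of_three_le hc hconn hgrow hp hW k hne hN
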